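/- **Setting.** A tangential base point in $\mathbb{C}$ is a pair $\tilde p=(p,v)$ with $p\in\mathbb{C}$ and $v\in\mathbb{C}\setminus\{0\}$. For $M\subseteq\mathbb{C}$, a path from $\tilde p=(p,v)$ to $\tilde q=(q,w)$ on $M$ is a piecewise smooth map $\gamma\colon[0,1]\to\mathbb{C}$ with $\gamma(0)=p$, $\gamma(1)=q$, $\lim_{t\searrow0}\frac{\gamma(t)-p}{t}=v$, $\lim_{t\nearrow1}\frac{\gamma(t)-q}{t-1}=-w$ and $\gamma((0,1))\subseteq M$. Let $D$ be a finite subset of $\mathbb{C}$ with $0\in D$, let $\tilde p,\tilde q$ be tangential base points, and let $\gamma$ be a path from $\tilde p$ to $\tilde q$ on $\mathbb{C}\setminus D$. **Words.** Let $\mathfrak H_D=\mathbb{Q}\langle e_z\mid z\in D\rangle$, with the $\mathbb{Q}$-bilinear shuffle product $⧢$ given by $1⧢w=w⧢1=w$ and $we_z⧢w'e_{z'}=(we_z⧢w')e_{z'}+(w⧢w'e_{z'})e_z$. For a word $e_{a_1}\cdots e_{a_k}$, the integral $$\int_{z<t_1<\cdots<t_k<1-z}\prod_{i=1}^k\frac{d\gamma(t_i)}{\gamma(t_i)-a_i}$$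 has an asymptotic expansion in non-negative integral powers of $z$ and $\log z$ as $z\to+0$; its constant term is denoted by $I_\gamma(\tilde p;e_{a_1}\cdots e_{a_k};\tilde q)$, and $I_\gamma(\tilde p;-;\tilde q)$ is extended $\mathbb{Q}$-linearly to $\mathfrak H_D$. **Trees.** Let $X=(V,E,\mathrm{rt},C)$ be a $D$-colored rooted tree, i.e. a finite tree $(V,E)$ with a root $\mathrm{rt}\in V$ and a map $C\colon V\to D$, and let $\mathbf k\colon E\to\mathbb{Z}_{\ge0}$ be an index on $X$. For $v\neq\mathrm{rt}$ let $p_v$ be the parent of $v$ (the adjacent vertex nearest to the root) and $\mathbf k_v=\mathbf k(\{v,p_v\})$; put $\mathbf k_{\mathrm{rt}}=1$. Assume that $(X;\mathbf k)$ is $\gamma$-harvestable, that is: * $C(\mathrm{rt})\notin\{\gamma(0),\gamma(1)\}$, and every $v$ with $C(v)=\gamma(0)$ has degree greater than $1$; * $\deg(\mathrm{rt})=1$; * $\deg(v)\le2$ if $C(v)\ne0$, and $\deg(v)\neq2$ if $C(v)=0$; * if $\mathbf k_v=0$, then $C(v)=0$ and $C(p_v)\neq0$. Assume moreover that $\mathbf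 k_v>0$ for every vertex $v$ of degree $1$. **The integral of the tree.** Let $\Delta(X;\mathbf k)$ be the set of $(t_v)_{v\in V}\in[0,1]^V$ such that, for every $v\ne\mathrm{rt}$, $t_v<t_{p_v}$ if $\mathbf k_v>0$ and $t_v=t_{p_v}$ if $\mathbf k_v=0$. Put $$I_\gamma(X;\mathbf k)=\int_{\Delta(X;\mathbf k)}\ \prod_{v:\,\mathbf k_v>0}\frac{(\log\gamma(t_{p_v})-\log\gamma(t_v))^{\mathbf k_v-1}}{(\mathbf k_v-1)!}\frac{d\gamma(t_v)}{\gamma(t_v)-C(v)}\ \prod_{v:\,\mathbf k_v=0}\frac{\gamma(t_v)}{\gamma(t_v)-C(v)},$$ where $\log\gamma$ is a continuous branch on $(0,1)$ (for $v=\mathrm{rt}$ the power is $1$), and the integration variables are the $t_v$ with $\mathbf k_v>0$. **The word of the tree.** Define $s_v\in\mathfrak H_D$ for $v\in V$ recursively, from the leaves to the root: if $u_1,\dots,u_m$ are the vertices with parent $v$ (the empty shuffle product being $1$), then $$s_v=\begin{cases}(s_{u_1}⧢\cdots⧢s_{u_m})\,e_0^{\mathbf k_v}&\text{if }\deg(v)\ge3,\\(s_{u_1}⧢\cdots⧢s_{u_m})\,e_{C(v)}e_0^{\mathbf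 k_v-1}&\text{if }\deg(v)\le2,\end{cases}$$ and put $w_{(X;\mathbf k)}=s_{\mathrm{rt}}$. In particular, for a path $v_1,\dots,v_{r+1}=\mathrm{rt}$ one has $w_{(X;\mathbf k)}=e_{C(v_1)}e_0^{\mathbf k_{v_1}-1}\cdots e_{C(v_r)}e_0^{\mathbf k_{v_r}-1}e_{C(\mathrm{rt})}$. **Theorem.** The integral $I_\gamma(X;\mathbf k)$ converges absolutely, the constant term that defines $I_\gamma(\tilde p;u;\tilde q)$ exists for every word $u$ occurring in $w_{(X;\mathbf k)}$, and $$I_\gamma(X;\mathbf k)=I_\gamma(\tilde p;w_{(X;\mathbf k)};\tilde q).$$ -/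

import Mathlib

open MeasureTheory Set Filter Topology
open scoped ContDiff

noncomputable section

namespace TreeIntegral

/-! ### Tangential base points and paths -/

/-- A tangential base point in `ℂ`: a point with a non-zero tangent vector. -/
structure TangentialBasePoint where
  pt : ℂ
  vec : ℂ
  vec_ne_zero : vec ≠ 0

/-- `γ`, restricted to `[0,1]`, is continuous and smooth up to the end points on each closed
subinterval that has no break point in its interior, for some finite set of break points. -/
def PiecewiseSmooth (γ : ℝ → ℂ) : Prop :=
  ContinuousOn γ (Icc 0 1) ∧
    ∃ S : Finset ℝ, ∀ a b : ℝ, 0 ≤ a → a < b → b ≤ 1 → (∀ s ∈ S, s ∉ Ioo a b) →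
      ContDiffOn ℝ ∞ γ (Icc a b)

/-- `γ|_[0,1]` is a path from the tangential base point `p` to the tangential base point `q` on
the subset `M` of `ℂ`. The end points themselves need not lie in `M`. -/
structure IsPathOn (γ : ℝ → ℂ) (p q : TangentialBasePoint) (M : Set ℂ) : Prop where
  piecewiseSmooth : PiecewiseSmooth γ
  source : γ 0 = p.pt
  target : γ 1 = q.pt
  tangent_source : Tendsto (fun t : ℝ => (γ t - p.pt) / (t : ℂ)) (𝓝[>] 0) (𝓝 p.vec)
  tangent_target : Tendsto (fun t : ℝ => (γ t - q.pt) / ((t : ℂ) - 1)) (𝓝[<] 1) (𝓝 (-q.vec))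
  mapsTo : ∀ t ∈ Ioo (0 : ℝ) 1, γ t ∈ M

/-- `L` is a continuous branch of `log γ` on the open interval `(0,1)`. -/
def IsLogAlong (γ : ℝ → ℂ) (L : ℝ → ℂ) : Prop :=
  ContinuousOn L (Ioo 0 1) ∧ ∀ t ∈ Ioo (0 : ℝ) 1, Complex.exp (L t) = γ t

open Classical in
/-- A continuous branch of `log γ` on `(0,1)`. It exists when `γ` is continuous and avoids `0`
there, and then differences of its values do not depend on the choice of the branch. -/
def logAlong (γ : ℝ → ℂ) : ℝ → ℂ :=
  if h : ∃ L, IsLogAlong γ L then h.choose else 0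

/-! ### Words and the shuffle product -/

/-- The non-commutative polynomial ring `ℚ⟨e_z | z ∈ ℂ⟩`, with the words as a basis. -/
abbrev WordAlg : Type := MonoidAlgebra ℚ (FreeMonoid ℂ)

/-- The letter `e_z`. -/
def e (z : ℂ) : WordAlg := MonoidAlgebra.of ℚ (FreeMonoid ℂ) (FreeMonoid.of z)

/-- The shuffle product of two words, each given by the list of its letters read from the last
letter to the first: `1 ⧢ w = w ⧢ 1 = w` and
`w e_a ⧢ w' e_b = (w e_a ⧢ w') e_b + (w ⧢ w' e_b) e_a`. -/
def shuffleRev : List ℂ → List ℂ → WordAlg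
  | [], l => MonoidAlgebra.of ℚ (FreeMonoid ℂ) (FreeMonoid.ofList l.reverse)
  | a :: l, [] => MonoidAlgebra.of ℚ (FreeMonoid ℂ) (FreeMonoid.ofList (a :: l).reverse)
  | a :: l, b :: l' => shuffleRev (a :: l) l' * e b + shuffleRev l (b :: l') * e a
termination_by l l' => l.length + l'.length

/-- The `ℚ`-bilinear shuffle product. -/
def shuffle : WordAlg →ₗ[ℚ] WordAlg →ₗ[ℚ] WordAlg :=
  (MonoidAlgebra.basis (FreeMonoid ℂ) ℚ).constr ℚ fun u =>
    (MonoidAlgebra.basis (FreeMonoid ℂ) ℚ).constr ℚ fun v =>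
      shuffleRev u.toList.reverse v.toList.reverse

/-- The shuffle product of a list of elements (`1` for the empty list). -/
def shuffleList (l : List WordAlg) : WordAlg :=
  l.foldr (fun x y => shuffle x y) 1

/-! ### Regularized iterated integrals along a path -/

/-- The integral of `∏ dγ(tᵢ) / (γ(tᵢ) - aᵢ)` over `z < t₁ < ⋯ < tₖ < 1 - z`. -/
def cutoffIntegral (γ : ℝ → ℂ) (a : List ℂ) (z : ℝ) : ℂ :=
  ∫ t in {t : Fin a.length → ℝ | StrictMono t ∧ ∀ i, t i ∈ Ioo z (1 - z)},
    ∏ i, deriv γ (t i) / (γ (t i) - a.get i)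

/-- `c` is the constant term in the asymptotic expansion of the cut-off integral in powers of
`log z` and `z` as `z → +0`. The terms with a positive power of `z` tend to `0`, so this is the
constant coefficient of the polynomial in `log z` that remains modulo `o(1)`. -/
def HasRegularizedIntegral (γ : ℝ → ℂ) (a : List ℂ) (c : ℂ) : Prop :=
  ∃ P : Polynomial ℂ,
    Tendsto (fun z : ℝ => cutoffIntegral γ a z - P.eval (Real.log z : ℂ)) (𝓝[>] 0) (𝓝 0) ∧
      P.coeff 0 = c

open Classical in
/-- The regularized iterated integral of a word (`0` if there is no asymptotic expansion). -/
def regularizedWord (γ : ℝ → ℂ) (a : List ℂ) : ℂ :=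
  if h : ∃ c, HasRegularizedIntegral γ a c then h.choose else 0

/-- The regularized iterated integral `I_γ(p̃; -; q̃)` as a `ℚ`-linear map; the tangential base
points are determined by `γ`. -/
def regularizedIntegral (γ : ℝ → ℂ) : WordAlg →ₗ[ℚ] ℂ :=
  (MonoidAlgebra.basis (FreeMonoid ℂ) ℚ).constr ℚ fun u => regularizedWord γ u.toList

/-! ### Colored rooted trees -/

/-- A `D`-colored rooted tree with vertex set `V`. -/
structure ColoredTree (D : Set ℂ) (V : Type*) where
  graph : SimpleGraph V
  isTree : graph.IsTree
  root : V
  color : V → ℂ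
  color_mem : ∀ v, color v ∈ D

namespace ColoredTree

variable {D : Set ℂ} {V : Type*} (X : ColoredTree D V)

/-- An index on `X`: a map from the edges to the non-negative integers. -/
abbrev Index : Type _ := X.graph.edgeSet → ℕ

/-- The number of edges at `v`. -/
def deg (v : V) : ℕ := (X.graph.neighborSet v).ncard

theorem exists_parent {v : V} (hv : v ≠ X.root) :
    ∃ w, X.graph.Adj v w ∧ X.graph.dist X.root w + 1 = X.graph.dist X.root v := by
  have hc := X.isTree.1
  obtain ⟨p, hp⟩ := hc.exists_walk_length_eq_dist v X.root
  cases p with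
  | nil => exact absurd rfl hv
  | @cons _ w _ h q =>
    refine ⟨w, h, ?_⟩
    have h1 : X.graph.dist w X.root ≤ q.length := SimpleGraph.dist_le q
    have h2 : X.graph.dist v X.root ≤ X.graph.dist v w + X.graph.dist w X.root :=
      hc.dist_triangle
    have h3 : X.graph.dist v w = 1 := SimpleGraph.dist_eq_one_iff_adj.2 h
    simp only [SimpleGraph.Walk.length_cons] at hp
    rw [SimpleGraph.dist_comm (u := X.root) (v := w),
      SimpleGraph.dist_comm (u := X.root) (v := v)]
    omega

open Classical in
/-- The parent of `v ≠ rt`: the adjacent vertex that is nearest to the root. By convention the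
root is its own parent. -/
def parent (v : V) : V :=
  if h : v ≠ X.root then (X.exists_parent h).choose else v

theorem adj_parent {v : V} (hv : v ≠ X.root) : X.graph.Adj v (X.parent v) := by
  rw [parent, dif_pos hv]
  exact (X.exists_parent hv).choose_spec.1

theorem dist_parent {v : V} (hv : v ≠ X.root) :
    X.graph.dist X.root (X.parent v) + 1 = X.graph.dist X.root v := by
  rw [parent, dif_pos hv]
  exact (X.exists_parent hv).choose_spec.2

open Classical in
/-- The value `k_v` of the index at the edge from `v` to its parent, and `k_rt = 1`. -/
def idx (k : X.Index) (v : V) : ℕ :=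
  if h : v ≠ X.root then k ⟨s(v, X.parent v), X.adj_parent h⟩ else 1

theorem ne_root_of_idx_eq_zero {k : X.Index} {v : V} (h : ¬ 0 < X.idx k v) : v ≠ X.root := by
  rintro rfl
  simp [idx] at h

/-- `X` is `γ`-admissible. -/
def Admissible (γ : ℝ → ℂ) : Prop :=
  (∀ v, X.color v = γ 0 → 1 < X.deg v) ∧ X.color X.root ≠ γ 0 ∧ X.color X.root ≠ γ 1

/-- The pair `(X; k)` is `γ`-harvestable. -/
structure Harvestable (γ : ℝ → ℂ) (k : X.Index) : Prop where
  admissible : X.Admissible γ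
  deg_root : X.deg X.root = 1
  deg_of_color_ne_zero : ∀ v, X.color v ≠ 0 → X.deg v ≤ 2
  deg_of_color_eq_zero : ∀ v, X.color v = 0 → X.deg v ≠ 2
  of_idx_eq_zero : ∀ v, X.idx k v = 0 → X.color v = 0 ∧ X.color (X.parent v) ≠ 0

/-! ### The iterated integral of a colored rooted tree -/

/-- The integration domain `Δ(X; k)`. -/
def domain (k : X.Index) : Set (V → ℝ) :=
  {t | (∀ v, t v ∈ Icc (0 : ℝ) 1) ∧ ∀ v, v ≠ X.root →
    (0 < X.idx k v → t v < t (X.parent v)) ∧ (X.idx k v = 0 → t v = t (X.parent v))}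

/-- The vertices with `k_v > 0`, which carry the actual integration variables. -/
abbrev Free (k : X.Index) : Type _ := {v : V // 0 < X.idx k v}

/-- The nearest vertex `u` with `k_u > 0` on the way from `v` to the root, `v` included. On
`Δ(X; k)` one has `t_v = t_u`. -/
def rep (k : X.Index) (v : V) : X.Free k :=
  if h : 0 < X.idx k v then ⟨v, h⟩ else rep k (X.parent v)
termination_by X.graph.dist X.root v
decreasing_by
  have := X.dist_parent (X.ne_root_of_idx_eq_zero h)
  omega

/-- The point `(t_v)_{v ∈ V}` with the given free coordinates and `t_v = t_{p_v}` whenever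
`k_v = 0`. -/
def extend (k : X.Index) (s : X.Free k → ℝ) : V → ℝ := fun v => s (X.rep k v)

/-- The factor `F_{v,k_v}` at `(γ(t_v))_v`, where `d γ(t_v)` is written as `γ'(t_v) d t_v` and the
logarithm is continued along `γ`. -/
def factor (γ : ℝ → ℂ) (k : X.Index) (t : V → ℝ) (v : V) : ℂ :=
  if 0 < X.idx k v then
    1 / ((X.idx k v - 1).factorial : ℂ) *
      (logAlong γ (t (X.parent v)) - logAlong γ (t v)) ^ (X.idx k v - 1) *
        (deriv γ (t v) / (γ (t v) - X.color v))
  else γ (t v) / (γ (t v) - X.color v)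

variable [Fintype V]

/-- The integrand of `I_γ(X; k)` in the free coordinates. -/
def integrand (γ : ℝ → ℂ) (k : X.Index) (s : X.Free k → ℝ) : ℂ :=
  ∏ v, X.factor γ k (X.extend k s) v

/-- `Δ(X; k)` in the free coordinates. -/
def freeDomain (k : X.Index) : Set (X.Free k → ℝ) := {s | X.extend k s ∈ X.domain k}

/-- The iterated integral `I_γ(X; k)` over `Δ(X; k)`. -/
def treeIntegral (γ : ℝ → ℂ) (k : X.Index) : ℂ :=
  letI := Fintype.ofFinite (X.Free k)
  ∫ s in X.freeDomain k, X.integrand γ k s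

/-- Absolute convergence of the integral `I_γ(X; k)`. -/
def TreeIntegrable (γ : ℝ → ℂ) (k : X.Index) : Prop :=
  letI := Fintype.ofFinite (X.Free k)
  IntegrableOn (X.integrand γ k) (X.freeDomain k)

/-! ### The word of a colored rooted tree -/

open Classical in
/-- The vertices whose parent is `v`. -/
def children (v : V) : Finset V := Finset.univ.filter fun u => u ≠ X.root ∧ X.parent u = v

theorem dist_lt_card (v : V) : X.graph.dist X.root v < Fintype.card V := by
  obtain ⟨p, hp, hl⟩ := X.isTree.1.exists_path_of_dist X.root v
  rw [← hl]
  exact hp.length_lt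

/-- The part of the word of `(X; k)` that comes from the vertex `v` and its descendants. The
words of the children of `v` are shuffled. Then `e_0 ^ k_v` is appended if `v` is branched
(a branched vertex of a harvestable pair has color `0`), and `e_{C(v)} e_0 ^ (k_v - 1)` if it is
not (in a harvestable pair such a `v` has at most one child). For `v ≠ rt` this is the word, with
its last letter removed, of the pair cut off at `v`, i.e. `v` and its descendants with a new root
attached to `v` by an edge of index `k_v`. -/
def subword (k : X.Index) (v : V) : WordAlg :=
  shuffleList ((X.children v).attach.toList.map fun u => subword k u.1) *
    (if 2 < X.deg v then e 0 ^ X.idx k v else e (X.color v) * e 0 ^ (X.idx k v - 1))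
termination_by Fintype.card V - X.graph.dist X.root v
decreasing_by
  obtain ⟨u, hu⟩ := u
  simp only [children, Finset.mem_filter] at hu
  have h1 := X.dist_parent hu.2.1
  rw [hu.2.2] at h1
  have h2 := X.dist_lt_card v
  simp only
  omega

/-- The word `w_{(X; k)}`. With `k_rt = 1` and `deg rt = 1`, it is the word of the pair cut off at
the child of the root, followed by `e_{C(rt)}`. -/
def word (k : X.Index) : WordAlg := X.subword k X.root

end ColoredTree

end TreeIntegral

end

noncomputable section

namespace TreeIntegral

/-! ### Integration over a rooted system of variables -/

/-! The identity is Fubini's theorem, carried out from the leaves to the root. Integrating out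
everything below `v`, and then `t_v` itself, with `t = t_{p_v}` fixed gives `F_v(t) = ∫_0^t (log
γ(t) - log γ(x))^(k_v - 1) / (k_v - 1)! · ∏_u F_u(x) · dγ(x) / (γ(x) - C(v))`, with `u` over the
children of `v`. The claim is that `F_v(t)` is the iterated integral from `0` to `t` of the word
`s_v` (`iterLin_subword_of_free`). Two facts carry it. By the product rule, a product of iterated
integrals is the iterated integral of the shuffle product (`prim_mul_prim`,
`TamePath.iterLin_shuffle`). By parts, each power of the logarithm is one more integration of `dγ /
γ`, i.e. one more letter `e_0` (`TamePath.integral_log_pow`). A vertex of index `0` has color `0`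
and contributes `γ / γ = 1`, so it drops out and its children pass to its parent
(`prod_freeSystem_ch`). A branched vertex has color `0`, so both cases of the definition of `s_v`
follow the same rule.

Convergence rests on two growth classes, with `ell t = 1 - log (1 - t)`: densities of size `x^(-1/2)
(1 - x)^(-1) ell^n` (`Dens`) and amplitudes of size `t^(1/2) ell^n` (`Amp`). Since the tangent
vectors are non-zero, `dγ / (γ - a)` has at most simple poles at the end points
(`IsPathOn.exists_tamePath`). The color of a leaf is not `γ 0`, so its form is a density; any form
times an amplitude is a density; convolving a density with a power of the logarithm gives an
amplitude. The color of the root is not `γ 1`, so the last integral converges up to `1`. The same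
recursion on absolute values, with Tonelli, gives absolute convergence
(`TamePath.integrable_prod_kernel`).

The words in `w_{(X; k)}` start with a letter other than `γ 0` and end with one other than `γ 1`.
Their cut-off integrals therefore converge to ordinary iterated integrals
(`tendsto_cutoffIntegral`), and the expansion in `log z` is a constant. This is the same Fubini
argument for a system in the shape of a path (`chain`). -/

theorem measurePreserving_funUnique_volume (ι : Type*) [Fintype ι] [Unique ι] :
    MeasurePreserving (MeasurableEquiv.funUnique ι ℝ) := by
  convert volume_preserving_funUnique ι ℝ <;> rfl

/-- Splitting off the coordinate `v`. -/
def splitCoord {ι : Type*} [DecidableEq ι] (v : ι) :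
    (ι → ℝ) ≃ᵐ ({i // i ≠ v} → ℝ) × ℝ :=
  haveI : Unique {i // ¬ i ≠ v} := ⟨⟨⟨v, by simp⟩⟩, fun i => Subtype.ext (not_not.1 i.2)⟩
  (MeasurableEquiv.piEquivPiSubtypeProd (fun _ : ι => ℝ) (fun i => i ≠ v)).trans
    (MeasurableEquiv.prodCongr (MeasurableEquiv.refl _) (MeasurableEquiv.funUnique _ ℝ))

theorem splitCoord_symm_of_ne {ι : Type*} [DecidableEq ι] (v : ι) (z : ({i // i ≠ v} → ℝ) × ℝ)
    (i : {i // i ≠ v}) : (splitCoord v).symm z i = z.1 i := by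
  have h := congrArg (fun w => w.1 i) ((splitCoord v).apply_symm_apply z)
  exact h

theorem splitCoord_symm_self {ι : Type*} [DecidableEq ι] (v : ι) (z : ({i // i ≠ v} → ℝ) × ℝ) :
    (splitCoord v).symm z v = z.2 := by
  have h := congrArg (fun w => w.2) ((splitCoord v).apply_symm_apply z)
  exact h

theorem volume_preserving_splitCoord {ι : Type*} [Fintype ι] [DecidableEq ι] (v : ι) :
    MeasurePreserving (splitCoord v) := by
  let _ : Unique {i // ¬ i ≠ v} := ⟨⟨⟨v, by simp⟩⟩, fun i => Subtype.ext (not_not.1 i.2)⟩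
  have h1 := volume_preserving_piEquivPiSubtypeProd (fun _ : ι => ℝ) (fun i => i ≠ v)
  have h2 := measurePreserving_funUnique_volume {i // ¬ i ≠ v}
  have h3 := (MeasurePreserving.id (volume : Measure ({i // i ≠ v} → ℝ))).prod h2
  rw [Measure.volume_eq_prod] at h1
  have h4 := h3.comp h1
  rw [Measure.volume_eq_prod]
  exact h4

/-- A finite rooted system: every index but the root has a parent of smaller depth. -/
structure RootedSystem (ι : Type*) where
  root : ι
  par : ι → ι
  depth : ι → ℕ
  par_root : par root = root
  depth_par : ∀ v, v ≠ root → depth (par v) < depth v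

namespace RootedSystem

variable {ι : Type*} (R : RootedSystem ι)

/-- The children of `v`. -/
def ch [Fintype ι] [DecidableEq ι] (v : ι) : Finset ι :=
  Finset.univ.filter fun u => u ≠ R.root ∧ R.par u = v

theorem mem_ch [Fintype ι] [DecidableEq ι] {u v : ι} :
    u ∈ R.ch v ↔ u ≠ R.root ∧ R.par u = v := by
  simp [ch]

/-- The system without the leaf `v`. -/
def erase (v : ι) (hv : v ≠ R.root) (hleaf : ∀ u, R.par u ≠ v) : RootedSystem {i // i ≠ v} where
  root := ⟨R.root, hv.symm⟩
  par i := ⟨R.par i, hleaf i⟩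
  depth i := R.depth i
  par_root := Subtype.ext R.par_root
  depth_par i hi := R.depth_par i fun h => hi (Subtype.ext h)

theorem exists_leaf [Fintype ι] [DecidableEq ι] (h : ∃ v, v ≠ R.root) :
    ∃ v, v ≠ R.root ∧ ∀ u, R.par u ≠ v := by
  obtain ⟨w, hw⟩ := h
  obtain ⟨v, hv, hmax⟩ := Finset.exists_max_image (Finset.univ.filter fun u => u ≠ R.root) R.depth
    ⟨w, by simp [hw]⟩
  have hv' : v ≠ R.root := by simpa using hv
  refine ⟨v, hv', fun u hu => ?_⟩
  by_cases hur : u = R.root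
  · rw [hur, R.par_root] at hu
    exact hv' hu.symm
  · have h1 := R.depth_par u hur
    have h2 := hmax u (by simp [hur])
    rw [hu] at h1
    omega

theorem prod_eq_mul_leaf [Fintype ι] [DecidableEq ι] {M : Type*} [CommMonoid M]
    (g : ι → ℝ → ℝ → M) (v : ι)
    (hv : v ≠ R.root) (hleaf : ∀ u, R.par u ≠ v) (z : ({i // i ≠ v} → ℝ) × ℝ) :
    ∏ i, g i ((splitCoord v).symm z i) ((splitCoord v).symm z (R.par i)) =
      (∏ i : {i // i ≠ v}, g i (z.1 i) (z.1 ((R.erase v hv hleaf).par i))) *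
        g v z.2 (z.1 ⟨R.par v, hleaf v⟩) := by
  rw [← Finset.prod_erase_mul _ _ (Finset.mem_univ v)]
  congr 1
  · rw [Finset.prod_subtype (Finset.univ.erase v) (p := fun i => i ≠ v) (by simp)
      (fun i => g i ((splitCoord v).symm z i) ((splitCoord v).symm z (R.par i)))]
    refine Finset.prod_congr rfl fun i _ => ?_
    rw [splitCoord_symm_of_ne v z i, ← splitCoord_symm_of_ne v z ((R.erase v hv hleaf).par i)]
    rfl
  · rw [splitCoord_symm_self, ← splitCoord_symm_of_ne v z ⟨R.par v, hleaf v⟩]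

/-- The weights after the leaf `v` has been integrated out. -/
def eraseWeight [DecidableEq ι] {M : Type*} [CommMonoid M] (g : ι → ℝ → ℝ → M) (F : ι → ℝ → M)
    (v : ι) : {i // i ≠ v} → ℝ → ℝ → M :=
  fun i x t => g i x t * if i.1 = R.par v then F v x else 1

theorem prod_eraseWeight [Fintype ι] [DecidableEq ι] {M : Type*} [CommMonoid M]
    (g : ι → ℝ → ℝ → M) (F : ι → ℝ → M)
    (v : ι) (hv : v ≠ R.root) (hleaf : ∀ u, R.par u ≠ v) (s : {i // i ≠ v} → ℝ) :
    ∏ i, R.eraseWeight g F v i (s i) (s ((R.erase v hv hleaf).par i)) =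
      (∏ i : {i // i ≠ v}, g i (s i) (s ((R.erase v hv hleaf).par i))) *
        F v (s ⟨R.par v, hleaf v⟩) := by
  simp only [eraseWeight, Finset.prod_mul_distrib]
  congr 1
  rw [Finset.prod_eq_single_of_mem ⟨R.par v, hleaf v⟩ (Finset.mem_univ _)]
  · simp
  · intro i _ hi
    rw [if_neg]
    exact fun h => hi (Subtype.ext h)

/-- Moving the factor of the leaf from the product over the children of its parent into the weight
of the parent leaves every recursive equation unchanged. So the same family solves the recursion of
the smaller system. -/
theorem eraseWeight_mul_prod [Fintype ι] [DecidableEq ι] {M : Type*} [CommMonoid M]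
    (g : ι → ℝ → ℝ → M) (F : ι → ℝ → M)
    (v : ι) (hv : v ≠ R.root) (hleaf : ∀ u, R.par u ≠ v) (i : {i // i ≠ v}) (x t : ℝ) :
    R.eraseWeight g F v i x t * ∏ u ∈ (R.erase v hv hleaf).ch i, F u x =
      g i x t * ∏ u ∈ R.ch i, F u x := by
  have key : ∏ u ∈ (R.erase v hv hleaf).ch i, F u x = ∏ u ∈ (R.ch i).erase v, F u x := by
    refine Finset.prod_bij (fun u _ => u.1) ?_ ?_ ?_ ?_
    · intro u hu
      rw [mem_ch] at hu
      rw [Finset.mem_erase, mem_ch]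
      exact ⟨u.2, fun h => hu.1 (Subtype.ext h), congrArg Subtype.val hu.2⟩
    · intro a _ b _ h
      exact Subtype.ext h
    · intro u hu
      rw [Finset.mem_erase, mem_ch] at hu
      refine ⟨⟨u, hu.1⟩, ?_, rfl⟩
      rw [mem_ch]
      exact ⟨fun h => hu.2.1 (congrArg Subtype.val h), Subtype.ext hu.2.2⟩
    · intro u _
      rfl
  rw [key, eraseWeight, mul_assoc]
  congr 1
  split_ifs with h
  · exact Finset.mul_prod_erase _ (fun u => F u x) (R.mem_ch.2 ⟨hv, h.symm⟩)
  · rw [one_mul, Finset.erase_eq_of_notMem]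
    rw [mem_ch]
    exact fun h' => h h'.2.symm

theorem ch_leaf [Fintype ι] [DecidableEq ι] {v : ι} (hleaf : ∀ u, R.par u ≠ v) : R.ch v = ∅ := by
  ext u
  simp [mem_ch, hleaf]

/-- The variable of a leaf occurs only in its own weight, next to that of its parent. Tonelli
integrates it out, and the result joins the weight of the parent; induction on the number of
variables does the rest. The value `t₀` is arbitrary because the weight of the root ignores its
upper limit. -/
theorem lintegral_prod_eq {ι : Type*} [Fintype ι] [DecidableEq ι] (R : RootedSystem ι)
    (g : ι → ℝ → ℝ → ENNReal) (A : ι → ℝ → ENNReal)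
    (hg : ∀ v, Measurable (fun z : ℝ × ℝ => g v z.1 z.2))
    (hroot : ∀ x t t', g R.root x t = g R.root x t')
    (hA : ∀ v t, A v t = ∫⁻ x, g v x t * ∏ u ∈ R.ch v, A u x) (t₀ : ℝ) :
    ∫⁻ s : ι → ℝ, ∏ v, g v (s v) (s (R.par v)) = A R.root t₀ := by
  obtain ⟨n, hn⟩ : ∃ n, Fintype.card ι = n := ⟨_, rfl⟩
  induction n generalizing ι with
  | zero => exact ((Fintype.card_eq_zero_iff.1 hn).false R.root).elim
  | succ n ih =>
    by_cases h : ∃ v, v ≠ R.root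
    · obtain ⟨v, hv, hleaf⟩ := R.exists_leaf h
      have hAv : ∀ t, A v t = ∫⁻ x, g v x t := by
        intro t
        rw [hA, R.ch_leaf hleaf]
        simp
      have hAm : Measurable (A v) := by
        rw [funext hAv]
        exact Measurable.lintegral_prod_left' (hg v)
      have := ih (R.erase v hv hleaf) (R.eraseWeight g A v) (fun i => A i)
        (fun i => by
          refine (hg i).mul ?_
          split_ifs
          · exact hAm.comp measurable_fst
          · exact measurable_const)
        (fun x t t' => by simp only [eraseWeight, erase]; rw [hroot])
        (fun i t => by
          rw [hA]
          exact lintegral_congr fun x => (R.eraseWeight_mul_prod g A v hv hleaf i x t).symm)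
        (by simp [Fintype.card_subtype_compl, hn])
      refine Eq.trans ?_ this
      rw [← (volume_preserving_splitCoord v).symm.lintegral_comp_emb
        (splitCoord v).symm.measurableEmbedding]
      simp only [R.prod_eq_mul_leaf g v hv hleaf, R.prod_eraseWeight g A v hv hleaf]
      rw [Measure.volume_eq_prod, lintegral_prod]
      · refine lintegral_congr fun s => ?_
        rw [hAv, ← lintegral_const_mul]
        exact (hg v).comp (by fun_prop : Measurable fun x : ℝ => (x, s ⟨R.par v, hleaf v⟩))
      · refine Measurable.aemeasurable (Measurable.mul ?_ ?_)
        · refine Finset.measurable_prod _ fun i _ => ?_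
          exact (hg i).comp (by fun_prop : Measurable fun z : ({i // i ≠ v} → ℝ) × ℝ =>
            (z.1 i, z.1 ((R.erase v hv hleaf).par i)))
        · exact (hg v).comp (by fun_prop : Measurable fun z : ({i // i ≠ v} → ℝ) × ℝ =>
            (z.2, z.1 ⟨R.par v, hleaf v⟩))
    · push Not at h
      let _ : Unique ι := ⟨⟨R.root⟩, h⟩
      have hd : (default : ι) = R.root := rfl
      have hch : R.ch R.root = ∅ := by
        ext u
        simp [mem_ch, h]
      rw [hA, hch, ← (measurePreserving_funUnique_volume ι).symm.lintegral_comp_emb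
        (MeasurableEquiv.funUnique ι ℝ).symm.measurableEmbedding]
      refine lintegral_congr fun x => ?_
      rw [Fintype.prod_unique, Finset.prod_empty, mul_one, hd, R.par_root]
      exact hroot _ _ _

/-- The induction is that of `lintegral_prod_eq`, with Fubini. Joint integrability is the only
analytic input: it is inherited by the smaller system when the leaf is integrated out. -/
theorem integral_prod_eq {ι : Type*} [Fintype ι] [DecidableEq ι] (R : RootedSystem ι)
    (G : ι → ℝ → ℝ → ℂ) (F : ι → ℝ → ℂ)
    (hint : Integrable fun s : ι → ℝ => ∏ v, G v (s v) (s (R.par v)))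
    (hroot : ∀ x t t', G R.root x t = G R.root x t')
    (hF : ∀ v t, F v t = ∫ x, G v x t * ∏ u ∈ R.ch v, F u x) (t₀ : ℝ) :
    ∫ s : ι → ℝ, ∏ v, G v (s v) (s (R.par v)) = F R.root t₀ := by
  obtain ⟨n, hn⟩ : ∃ n, Fintype.card ι = n := ⟨_, rfl⟩
  induction n generalizing ι with
  | zero => exact ((Fintype.card_eq_zero_iff.1 hn).false R.root).elim
  | succ n ih =>
    by_cases h : ∃ v, v ≠ R.root
    · obtain ⟨v, hv, hleaf⟩ := R.exists_leaf h
      have hFv : ∀ t, F v t = ∫ x, G v x t := by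
        intro t
        rw [hF, R.ch_leaf hleaf]
        simp
      have hint' := ((volume_preserving_splitCoord v).symm.integrable_comp_emb
        (splitCoord v).symm.measurableEmbedding).2 hint
      simp only [Function.comp_def, R.prod_eq_mul_leaf G v hv hleaf] at hint'
      rw [Measure.volume_eq_prod] at hint'
      have hinner : ∀ s : {i // i ≠ v} → ℝ,
          ∫ x, (∏ i : {i // i ≠ v}, G i (s i) (s ((R.erase v hv hleaf).par i))) *
            G v x (s ⟨R.par v, hleaf v⟩) =
          ∏ i, R.eraseWeight G F v i (s i) (s ((R.erase v hv hleaf).par i)) := fun s => by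
        rw [R.prod_eraseWeight G F v hv hleaf, hFv, integral_const_mul]
      have := ih (R.erase v hv hleaf) (R.eraseWeight G F v) (fun i => F i)
        (by simpa only [hinner] using hint'.integral_prod_left)
        (fun x t t' => by simp only [eraseWeight, erase]; rw [hroot])
        (fun i t => by
          rw [hF]
          exact integral_congr_ae (Eventually.of_forall
            fun x => (R.eraseWeight_mul_prod G F v hv hleaf i x t).symm))
        (by simp [Fintype.card_subtype_compl, hn])
      refine Eq.trans ?_ this
      rw [← (volume_preserving_splitCoord v).symm.integral_comp
        (splitCoord v).symm.measurableEmbedding]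
      simp only [R.prod_eq_mul_leaf G v hv hleaf, ← hinner]
      rw [Measure.volume_eq_prod, integral_prod _ hint']
    · push Not at h
      let _ : Unique ι := ⟨⟨R.root⟩, h⟩
      have hd : (default : ι) = R.root := rfl
      have hch : R.ch R.root = ∅ := by
        ext u
        simp [mem_ch, h]
      rw [hF, hch, ← (measurePreserving_funUnique_volume ι).symm.integral_comp
        (MeasurableEquiv.funUnique ι ℝ).symm.measurableEmbedding]
      refine integral_congr_ae (Eventually.of_forall fun x => ?_)
      simp only
      rw [Fintype.prod_unique, Finset.prod_empty, mul_one, hd, R.par_root]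
      exact hroot _ _ _

/-- Induction from the leaves to the root. -/
theorem induction_ch [Fintype ι] [DecidableEq ι] {P : ι → Prop}
    (h : ∀ v, (∀ u ∈ R.ch v, P u) → P v) (v : ι) : P v := by
  obtain ⟨N, hN⟩ : ∃ N, ∀ v, R.depth v ≤ N :=
    ⟨Finset.univ.sup R.depth, fun v => Finset.le_sup (Finset.mem_univ v)⟩
  obtain ⟨n, hn⟩ : ∃ n, N ≤ R.depth v + n := ⟨N, by omega⟩
  induction n generalizing v with
  | zero =>
    refine h v fun u hu => ?_
    rw [mem_ch] at hu
    have h1 := R.depth_par u hu.1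
    have h2 := hN u
    rw [hu.2] at h1
    omega
  | succ n ih =>
    refine h v fun u hu => ih u ?_
    rw [mem_ch] at hu
    have h1 := R.depth_par u hu.1
    rw [hu.2] at h1
    omega

/-- Recursion from the leaves to the root. -/
theorem exists_recursive [Fintype ι] [DecidableEq ι] {α : Type*} [Nonempty α]
    (op : ι → (ι → α) → α)
    (hop : ∀ v A A', (∀ u ∈ R.ch v, A u = A' u) → op v A = op v A') :
    ∃ A : ι → α, ∀ v, A v = op v A := by
  obtain ⟨N, hN⟩ : ∃ N, ∀ v, R.depth v ≤ N :=
    ⟨Finset.univ.sup R.depth, fun v => Finset.le_sup (Finset.mem_univ v)⟩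
  -- Each application of `op` makes the recursion valid one level of depth closer to the root; `N +
  -- 1` applications reach every index.
  have key : ∀ n, ∃ A : ι → α, ∀ v, N < R.depth v + n → A v = op v A := by
    intro n
    induction n with
    | zero => exact ⟨fun _ => Classical.arbitrary α, fun v hv => by have := hN v; omega⟩
    | succ n ih =>
      obtain ⟨A, hA⟩ := ih
      refine ⟨fun v => op v A, fun v hv => hop v _ _ fun u hu => hA u ?_⟩
      rw [mem_ch] at hu
      have h1 := R.depth_par u hu.1
      rw [hu.2] at h1
      omega
  obtain ⟨A, hA⟩ := key (N + 1)
  exact ⟨A, fun v => hA v (by omega)⟩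

end RootedSystem

/-! ### Real bounds -/

/-- The logarithmic growth function at the end point `1`. -/
def ell (t : ℝ) : ℝ := 1 - Real.log (1 - t)

theorem one_le_ell {t : ℝ} (h0 : 0 ≤ t) (h1 : t < 1) : 1 ≤ ell t := by
  have := Real.log_nonpos (by linarith : 0 ≤ 1 - t) (by linarith)
  unfold ell
  linarith

theorem ell_pos {t : ℝ} (h0 : 0 ≤ t) (h1 : t < 1) : 0 < ell t :=
  one_pos.trans_le (one_le_ell h0 h1)

theorem ell_le_ell {x t : ℝ} (hxt : x ≤ t) (h1 : t < 1) : ell x ≤ ell t := by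
  have := Real.log_le_log (by linarith : 0 < 1 - t) (by linarith : 1 - t ≤ 1 - x)
  unfold ell
  linarith

theorem continuousOn_ell : ContinuousOn ell (Iio 1) := by
  unfold ell
  refine continuousOn_const.sub (ContinuousOn.log (by fun_prop) fun x hx => ?_)
  have : x < 1 := hx
  linarith

/-- The growth allowed for iterated integrals as functions of the upper end point. -/
def ampBound (n : ℕ) (t : ℝ) : ℝ := t ^ (1 / 2 : ℝ) * ell t ^ n

/-- The growth allowed for densities. -/
def densBound (n : ℕ) (x : ℝ) : ℝ := x ^ (-(1 / 2) : ℝ) * (1 - x)⁻¹ * ell x ^ n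

theorem ampBound_nonneg (n : ℕ) {t : ℝ} (h0 : 0 ≤ t) (h1 : t < 1) : 0 ≤ ampBound n t :=
  mul_nonneg (Real.rpow_nonneg h0 _) (pow_nonneg (ell_pos h0 h1).le _)

theorem densBound_nonneg (n : ℕ) {t : ℝ} (h0 : 0 ≤ t) (h1 : t < 1) : 0 ≤ densBound n t :=
  mul_nonneg (mul_nonneg (Real.rpow_nonneg h0 _) (inv_nonneg.2 (by linarith)))
    (pow_nonneg (ell_pos h0 h1).le _)

theorem ampBound_mul_le (n m : ℕ) {t : ℝ} (h0 : 0 ≤ t) (h1 : t < 1) :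
    ampBound n t * ampBound m t ≤ ampBound (n + m) t := by
  have h2 : t ^ (1 / 2 : ℝ) ≤ 1 := Real.rpow_le_one h0 h1.le (by norm_num)
  have h3 : 0 ≤ t ^ (1 / 2 : ℝ) := Real.rpow_nonneg h0 _
  have h4 : 0 ≤ ell t ^ n * ell t ^ m :=
    mul_nonneg (pow_nonneg (ell_pos h0 h1).le _) (pow_nonneg (ell_pos h0 h1).le _)
  unfold ampBound
  rw [pow_add]
  nlinarith [mul_nonneg (mul_nonneg h3 h4) (sub_nonneg.2 h2)]

theorem densBound_mul_ampBound_le (n m : ℕ) {t : ℝ} (h0 : 0 ≤ t) (h1 : t < 1) :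
    densBound n t * ampBound m t ≤ densBound (n + m) t := by
  have h2 : t ^ (1 / 2 : ℝ) ≤ 1 := Real.rpow_le_one h0 h1.le (by norm_num)
  have h4 : 0 ≤ densBound (n + m) t := densBound_nonneg _ h0 h1
  have : densBound n t * ampBound m t = densBound (n + m) t * t ^ (1 / 2 : ℝ) := by
    unfold ampBound densBound
    rw [pow_add]
    ring
  rw [this]
  exact mul_le_of_le_one_right h4 h2

theorem inv_mul_ampBound (n : ℕ) {t : ℝ} (h0 : 0 < t) :
    t⁻¹ * ampBound n t = t ^ (-(1 / 2) : ℝ) * ell t ^ n := by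
  unfold ampBound
  rw [← mul_assoc, ← Real.rpow_neg_one, ← Real.rpow_add h0]
  norm_num

theorem inv_one_sub_le_densBound {t : ℝ} (h0 : 0 < t) (h1 : t < 1) :
    (1 - t)⁻¹ ≤ densBound 0 t := by
  unfold densBound
  rw [pow_zero, mul_one]
  exact le_mul_of_one_le_left (inv_nonneg.2 (by linarith))
    (Real.one_le_rpow_of_pos_of_le_one_of_nonpos h0 h1.le (by norm_num))

/-- The integrand is dominated by the derivative of `4 x^(1/4) ell x`, which vanishes at `0`; the
logarithm in `ell` accounts for the pole at `1`. -/
theorem integrableOn_rpow_mul_inv {t : ℝ} (h0 : 0 < t) (h1 : t < 1) :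
    IntegrableOn (fun x : ℝ => x ^ (-(3 / 4) : ℝ) * (1 - x)⁻¹) (Ioc 0 t) ∧
      ∫ x in Ioc 0 t, x ^ (-(3 / 4) : ℝ) * (1 - x)⁻¹ ≤ 4 * t ^ (1 / 4 : ℝ) * ell t := by
  set Ψ : ℝ → ℝ := fun x => 4 * x ^ (1 / 4 : ℝ) * ell x with hΨ
  set Ψ' : ℝ → ℝ := fun x => x ^ (-(3 / 4) : ℝ) * ell x + 4 * x ^ (1 / 4 : ℝ) * (1 - x)⁻¹ with hΨ'
  have hcont : ContinuousOn Ψ (Icc 0 t) := by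
    refine ContinuousOn.mul ?_ (continuousOn_ell.mono fun x hx => lt_of_le_of_lt hx.2 h1)
    exact continuousOn_const.mul (continuousOn_id.rpow_const fun x _ => Or.inr (by norm_num))
  have hderiv : ∀ x ∈ Ioo 0 t, HasDerivAt Ψ (Ψ' x) x := by
    intro x hx
    have hx1 : (1 : ℝ) - x ≠ 0 := by linarith [hx.2]
    have e1 : HasDerivAt (fun x : ℝ => 4 * x ^ (1 / 4 : ℝ))
        (4 * ((1 / 4 : ℝ) * x ^ ((1 / 4 : ℝ) - 1))) x :=
      (Real.hasDerivAt_rpow_const (Or.inl hx.1.ne')).const_mul 4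
    have e2 : HasDerivAt ell (-(-1 / (1 - x))) x :=
      (((hasDerivAt_id x).const_sub 1).log hx1).const_sub 1
    refine (e1.mul e2).congr_deriv ?_
    rw [hΨ']
    simp only
    norm_num
    ring
  have hpos : ∀ x ∈ Ioo 0 t, x ^ (-(3 / 4) : ℝ) * (1 - x)⁻¹ ≤ Ψ' x := by
    intro x hx
    have hx1 : (0 : ℝ) < 1 - x := by linarith [hx.2]
    have e1 : x ^ (1 / 4 : ℝ) = x ^ (-(3 / 4) : ℝ) * x := by
      nth_rewrite 3 [← Real.rpow_one x]
      rw [← Real.rpow_add hx.1]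
      norm_num
    have e2 := one_le_ell hx.1.le (hx.2.trans h1)
    have e3 : 0 ≤ x ^ (-(3 / 4) : ℝ) := Real.rpow_nonneg hx.1.le _
    -- This splits the pole at `1` off as `x^(1/4) (1 - x)⁻¹`, which the second term of `Ψ'`
    -- dominates; what is left, `x^(-3/4)`, is below the first term because `ell ≥ 1`.
    have e4 : (1 - x)⁻¹ = 1 + x * (1 - x)⁻¹ := by
      field_simp
      ring
    have e5 : 0 ≤ x ^ (-(3 / 4) : ℝ) * (x * (1 - x)⁻¹) :=
      mul_nonneg e3 (mul_nonneg hx.1.le (inv_nonneg.2 hx1.le))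
    rw [hΨ']
    simp only
    rw [e1]
    nth_rewrite 1 [e4]
    nlinarith [mul_nonneg e3 (sub_nonneg.2 e2)]
  have hnn : ∀ x ∈ Ioo 0 t, 0 ≤ x ^ (-(3 / 4) : ℝ) * (1 - x)⁻¹ := by
    intro x hx
    exact mul_nonneg (Real.rpow_nonneg hx.1.le _) (inv_nonneg.2 (by linarith [hx.2]))
  -- A non-negative derivative of a function continuous on the closed interval is integrable, so no
  -- separate estimate at `0` is needed.
  have hint : IntegrableOn Ψ' (Ioc 0 t) :=
    intervalIntegral.integrableOn_deriv_of_nonneg hcont hderiv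
      fun x hx => (hnn x hx).trans (hpos x hx)
  have hint2 : IntegrableOn (fun x : ℝ => x ^ (-(3 / 4) : ℝ) * (1 - x)⁻¹) (Ioc 0 t) := by
    rw [integrableOn_Ioc_iff_integrableOn_Ioo] at hint ⊢
    refine Integrable.mono' hint ?_ ?_
    · refine Measurable.aestronglyMeasurable ?_
      fun_prop
    · refine (ae_restrict_iff' measurableSet_Ioo).2 (Eventually.of_forall fun x hx => ?_)
      rw [Real.norm_of_nonneg (hnn x hx)]
      exact hpos x hx
  refine ⟨hint2, ?_⟩
  have hval : ∫ x in (0 : ℝ)..t, Ψ' x = Ψ t - Ψ 0 :=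
    intervalIntegral.integral_eq_sub_of_hasDerivAt_of_le h0.le hcont hderiv
      ((intervalIntegrable_iff_integrableOn_Ioc_of_le h0.le).2 hint)
  have hΨ0 : Ψ 0 = 0 := by
    rw [hΨ]
    simp only
    rw [Real.zero_rpow (by norm_num)]
    ring
  rw [intervalIntegral.integral_of_le h0.le, hΨ0, sub_zero] at hval
  rw [show 4 * t ^ (1 / 4 : ℝ) * ell t = Ψ t from rfl, ← hval,
    integral_Ioc_eq_integral_Ioo, integral_Ioc_eq_integral_Ioo]
  rw [integrableOn_Ioc_iff_integrableOn_Ioo] at hint hint2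
  exact setIntegral_mono_on hint2 hint measurableSet_Ioo hpos

/-- The bound for the integrand of a convolution with a power of a logarithm. -/
def convBound (k n : ℕ) (t x : ℝ) : ℝ := (t / x) ^ (1 / 4 : ℝ) * ell t ^ k * densBound n x

theorem convBound_nonneg (k n : ℕ) {t x : ℝ} (h0 : 0 < x) (hxt : x ≤ t) (h1 : t < 1) :
    0 ≤ convBound k n t x :=
  mul_nonneg (mul_nonneg (Real.rpow_nonneg (div_nonneg (h0.le.trans hxt) h0.le) _)
    (pow_nonneg (ell_pos (h0.le.trans hxt) h1).le _)) (densBound_nonneg n h0.le (hxt.trans_lt h1))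

theorem densBound_le_convBound (n : ℕ) {t x : ℝ} (h0 : 0 < x) (hxt : x ≤ t) (h1 : t < 1) :
    densBound n x ≤ convBound 0 n t x := by
  unfold convBound
  rw [pow_zero, mul_one]
  exact le_mul_of_one_le_left (densBound_nonneg n h0.le (hxt.trans_lt h1))
    (Real.one_le_rpow ((one_le_div h0).2 hxt) (by norm_num))

/-- The factor `(t / x)^(1/4)` worsens the singularity at `0` from `x^(-1/2)` to `x^(-3/4)`, which
is still integrable. -/
theorem convBound_le (k n : ℕ) {t x : ℝ} (h0 : 0 < x) (hxt : x ≤ t) (h1 : t < 1) :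
    convBound k n t x ≤
      t ^ (1 / 4 : ℝ) * ell t ^ (n + k) * (x ^ (-(3 / 4) : ℝ) * (1 - x)⁻¹) := by
  have ht : 0 < t := h0.trans_le hxt
  have e1 : (t / x) ^ (1 / 4 : ℝ) * x ^ (-(1 / 2) : ℝ) = t ^ (1 / 4 : ℝ) * x ^ (-(3 / 4) : ℝ) := by
    rw [div_eq_mul_inv, Real.mul_rpow ht.le (inv_nonneg.2 h0.le), Real.inv_rpow h0.le,
      ← Real.rpow_neg h0.le, mul_assoc, ← Real.rpow_add h0]
    norm_num
  have e2 : convBound k n t x =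
      t ^ (1 / 4 : ℝ) * (ell x ^ n * ell t ^ k) * (x ^ (-(3 / 4) : ℝ) * (1 - x)⁻¹) := by
    unfold convBound densBound
    linear_combination (ell t ^ k * (1 - x)⁻¹ * ell x ^ n) * e1
  rw [e2, pow_add]
  have h2 : ell x ^ n ≤ ell t ^ n :=
    pow_le_pow_left₀ (ell_pos h0.le (hxt.trans_lt h1)).le (ell_le_ell hxt h1) _
  have h3 : 0 ≤ ell t ^ k := pow_nonneg (ell_pos ht.le h1).le _
  have h4 : 0 ≤ x ^ (-(3 / 4) : ℝ) * (1 - x)⁻¹ :=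
    mul_nonneg (Real.rpow_nonneg h0.le _) (inv_nonneg.2 (by linarith))
  have h5 : 0 ≤ t ^ (1 / 4 : ℝ) := Real.rpow_nonneg ht.le _
  gcongr

/-- The exponents close up: `t^(1/4)` comes from `(t / x)^(1/4)` and another `t^(1/4)` from
integrating `x^(-3/4)`, which restores the `t^(1/2)` of an amplitude. Hence densities are sent to
amplitudes, at the cost of a higher power of `ell`. -/
theorem integrableOn_convBound (k n : ℕ) {t : ℝ} (h0 : 0 < t) (h1 : t < 1) :
    IntegrableOn (convBound k n t) (Ioc 0 t) ∧
      ∫ x in Ioc 0 t, convBound k n t x ≤ 4 * ampBound (n + k + 1) t := by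
  obtain ⟨hi, hle⟩ := integrableOn_rpow_mul_inv h0 h1
  have hi' := hi.const_mul (t ^ (1 / 4 : ℝ) * ell t ^ (n + k))
  have hint : IntegrableOn (convBound k n t) (Ioc 0 t) := by
    refine Integrable.mono' hi' ?_ ?_
    · refine Measurable.aestronglyMeasurable ?_
      unfold convBound densBound ell
      fun_prop
    · refine (ae_restrict_iff' measurableSet_Ioc).2 (Eventually.of_forall fun x hx => ?_)
      rw [Real.norm_of_nonneg (convBound_nonneg k n hx.1 hx.2 h1)]
      exact convBound_le k n hx.1 hx.2 h1
  refine ⟨hint, ?_⟩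
  calc ∫ x in Ioc 0 t, convBound k n t x
      ≤ ∫ x in Ioc 0 t, t ^ (1 / 4 : ℝ) * ell t ^ (n + k) * (x ^ (-(3 / 4) : ℝ) * (1 - x)⁻¹) :=
        setIntegral_mono_on hint hi' measurableSet_Ioc fun x hx => convBound_le k n hx.1 hx.2 h1
    _ = t ^ (1 / 4 : ℝ) * ell t ^ (n + k) *
        ∫ x in Ioc 0 t, x ^ (-(3 / 4) : ℝ) * (1 - x)⁻¹ := integral_const_mul _ _
    _ ≤ t ^ (1 / 4 : ℝ) * ell t ^ (n + k) * (4 * t ^ (1 / 4 : ℝ) * ell t) :=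
        mul_le_mul_of_nonneg_left hle
          (mul_nonneg (Real.rpow_nonneg h0.le _) (pow_nonneg (ell_pos h0.le h1).le _))
    _ = 4 * ampBound (n + k + 1) t := by
        unfold ampBound
        rw [show (1 / 2 : ℝ) = 1 / 4 + 1 / 4 by norm_num, Real.rpow_add h0, pow_succ]
        ring

/-- Powers of `log (t / x)` are traded for the small power `(t / x)^(1/4)`, so that all growth at
`0` is measured by powers of `x` and all growth at `1` by `ell`. -/
theorem log_div_add_ell_pow_le (k : ℕ) {t x : ℝ} (h0 : 0 < x) (hxt : x ≤ t) (h1 : t < 1) :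
    (Real.log (t / x) + ell t) ^ k ≤
      (k.factorial * 4 ^ k * Real.exp (1 / 4)) * ((t / x) ^ (1 / 4 : ℝ) * ell t ^ k) := by
  have hlog : 0 ≤ Real.log (t / x) := Real.log_nonneg ((one_le_div h0).2 hxt)
  have hell := one_le_ell (h0.le.trans hxt) h1
  have htx : 0 < t / x := div_pos (h0.trans_le hxt) h0
  have e1 : Real.log (t / x) + ell t ≤ (1 + Real.log (t / x)) * ell t := by
    nlinarith
  have e2 : (1 + Real.log (t / x)) ^ k ≤
      k.factorial * 4 ^ k * Real.exp (1 / 4) * (t / x) ^ (1 / 4 : ℝ) := by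
    -- The bound `y^k / k! ≤ exp y` at `y = (1 + log (t / x)) / 4`, where `exp y = exp (1/4) (t /
    -- x)^(1/4)`.
    have := Real.pow_div_factorial_le_exp (x := (1 + Real.log (t / x)) / 4) (by positivity) k
    rw [Real.rpow_def_of_pos htx, mul_assoc (_ * _), ← Real.exp_add]
    rw [div_pow, div_le_iff₀ (by positivity), div_le_iff₀ (by positivity)] at this
    calc _ ≤ _ := this
      _ = _ := by ring_nf
  calc (Real.log (t / x) + ell t) ^ k ≤ ((1 + Real.log (t / x)) * ell t) ^ k :=
        pow_le_pow_left₀ (by linarith) e1 _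
    _ = (1 + Real.log (t / x)) ^ k * ell t ^ k := mul_pow _ _ _
    _ ≤ _ := by
        rw [← mul_assoc]
        exact mul_le_mul_of_nonneg_right e2 (pow_nonneg (by linarith) _)

/-- This is the size of the integrand at the root, where the form has no pole at `1`. There the
powers of `ell` cost only `(1 - x)^(-1/2)`. -/
theorem integrableOn_rpow_mul_ell_pow (n : ℕ) :
    IntegrableOn (fun x : ℝ => x ^ (-(1 / 2) : ℝ) * ell x ^ n) (Ioo 0 1) := by
  set Ψ : ℝ → ℝ := fun x => 2 * x ^ (1 / 2 : ℝ) - 2 * (1 - x) ^ (1 / 2 : ℝ) with hΨ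
  set Ψ' : ℝ → ℝ := fun x => x ^ (-(1 / 2) : ℝ) + (1 - x) ^ (-(1 / 2) : ℝ) with hΨ'
  have hcont : ContinuousOn Ψ (Icc 0 1) := by
    refine ContinuousOn.sub ?_ ?_
    · exact continuousOn_const.mul (continuousOn_id.rpow_const fun x _ => Or.inr (by norm_num))
    · refine continuousOn_const.mul (ContinuousOn.rpow_const (by fun_prop) fun x _ =>
        Or.inr (by norm_num))
  have hderiv : ∀ x ∈ Ioo (0 : ℝ) 1, HasDerivAt Ψ (Ψ' x) x := by
    intro x hx
    have hx1 : (1 : ℝ) - x ≠ 0 := by linarith [hx.2]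
    have e1 : HasDerivAt (fun x : ℝ => 2 * x ^ (1 / 2 : ℝ))
        (2 * ((1 / 2 : ℝ) * x ^ ((1 / 2 : ℝ) - 1))) x :=
      (Real.hasDerivAt_rpow_const (Or.inl hx.1.ne')).const_mul 2
    have e2 : HasDerivAt (fun x : ℝ => 2 * (1 - x) ^ (1 / 2 : ℝ))
        (2 * (-1 * (1 / 2 : ℝ) * (1 - x) ^ ((1 / 2 : ℝ) - 1))) x :=
      (((hasDerivAt_id x).const_sub 1).rpow_const (Or.inl hx1)).const_mul 2
    refine (e1.sub e2).congr_deriv ?_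
    rw [hΨ']
    simp only
    norm_num
    ring
  have hint : IntegrableOn Ψ' (Ioo 0 1) := by
    rw [← integrableOn_Ioc_iff_integrableOn_Ioo]
    refine intervalIntegral.integrableOn_deriv_of_nonneg hcont hderiv fun x hx => ?_
    exact add_nonneg (Real.rpow_nonneg hx.1.le _) (Real.rpow_nonneg (by linarith [hx.2]) _)
  refine Integrable.mono' (hint.const_mul (2 * (n.factorial * 2 ^ n * Real.exp (1 / 2)))) ?_ ?_
  · refine Measurable.aestronglyMeasurable ?_
    unfold ell
    fun_prop
  · refine (ae_restrict_iff' measurableSet_Ioo).2 (Eventually.of_forall fun x hx => ?_)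
    have hx1 : (0 : ℝ) < 1 - x := by linarith [hx.2]
    have hell := ell_pos hx.1.le hx.2
    have e0 : 0 ≤ x ^ (-(1 / 2) : ℝ) := Real.rpow_nonneg hx.1.le _
    have e0' : 0 ≤ (1 - x) ^ (-(1 / 2) : ℝ) := Real.rpow_nonneg hx1.le _
    rw [Real.norm_of_nonneg (mul_nonneg e0 (pow_nonneg hell.le _))]
    have e1 : ell x ^ n ≤ n.factorial * 2 ^ n * Real.exp (1 / 2) * (1 - x) ^ (-(1 / 2) : ℝ) := by
      -- The bound `y^n / n! ≤ exp y` at `y = ell x / 2`, where `exp y = exp (1/2) (1 - x)^(-1/2)`.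
      have := Real.pow_div_factorial_le_exp (x := ell x / 2) (by positivity) n
      rw [Real.rpow_def_of_pos hx1, mul_assoc (_ * _), ← Real.exp_add]
      rw [div_pow, div_le_iff₀ (by positivity), div_le_iff₀ (by positivity)] at this
      refine this.trans (le_of_eq ?_)
      unfold ell
      ring_nf
    -- On each half of the interval one of the two factors is at most `2`, and the other is one of
    -- the summands of `Ψ'`.
    have e2 : x ^ (-(1 / 2) : ℝ) * (1 - x) ^ (-(1 / 2) : ℝ) ≤ 2 * Ψ' x := by
      have h2 : ∀ y : ℝ, 1 / 2 ≤ y → y ^ (-(1 / 2) : ℝ) ≤ 2 := by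
        intro y hy
        calc y ^ (-(1 / 2) : ℝ) ≤ (1 / 2 : ℝ) ^ (-(1 / 2) : ℝ) :=
              Real.rpow_le_rpow_of_nonpos (by norm_num) hy (by norm_num)
          _ = 2 ^ (1 / 2 : ℝ) := by
              rw [one_div, Real.inv_rpow (by norm_num), ← Real.rpow_neg (by norm_num), neg_neg]
          _ ≤ 2 ^ (1 : ℝ) := Real.rpow_le_rpow_of_exponent_le (by norm_num) (by norm_num)
          _ = 2 := Real.rpow_one 2
      rw [hΨ']
      simp only
      rcases le_total (1 / 2) x with h | h
      · nlinarith [h2 x h]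
      · nlinarith [h2 (1 - x) (by linarith)]
    calc x ^ (-(1 / 2) : ℝ) * ell x ^ n
        ≤ x ^ (-(1 / 2) : ℝ) *
          (n.factorial * 2 ^ n * Real.exp (1 / 2) * (1 - x) ^ (-(1 / 2) : ℝ)) :=
          mul_le_mul_of_nonneg_left e1 e0
      _ = (n.factorial * 2 ^ n * Real.exp (1 / 2)) *
          (x ^ (-(1 / 2) : ℝ) * (1 - x) ^ (-(1 / 2) : ℝ)) := by ring
      _ ≤ (n.factorial * 2 ^ n * Real.exp (1 / 2)) * (2 * Ψ' x) :=
          mul_le_mul_of_nonneg_left e2 (by positivity)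
      _ = _ := by ring

/-! ### Differential forms along a path -/

/-- The density of `d γ(t) / (γ(t) - a)`. -/
def form (γ : ℝ → ℂ) (a : ℂ) (t : ℝ) : ℂ := deriv γ t / (γ t - a)

/-- The properties of a path on `ℂ \ D` that are used for the integration: `γ` is continuously
differentiable outside `S`, and the forms `dγ / (γ - a)` have at most simple poles at the end
points. -/
structure TamePath (γ : ℝ → ℂ) (D : Finset ℂ) (S : Set ℝ) : Prop where
  finite : S.Finite
  hasDerivAt : ∀ t ∈ Ioo (0 : ℝ) 1, t ∉ S → HasDerivAt γ (deriv γ t) t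
  continuousAt_deriv : ∀ t ∈ Ioo (0 : ℝ) 1, t ∉ S → ContinuousAt (deriv γ) t
  continuousOn : ContinuousOn γ (Ioo 0 1)
  ne : ∀ a ∈ D, ∀ t ∈ Ioo (0 : ℝ) 1, γ t ≠ a
  bound : ∀ a ∈ D, ∃ K, 0 ≤ K ∧ ∀ t ∈ Ioo (0 : ℝ) 1, ‖form γ a t‖ ≤ K * (t⁻¹ * (1 - t)⁻¹)
  bound_source : ∀ a ∈ D, a ≠ γ 0 →
    ∃ K, 0 ≤ K ∧ ∀ t ∈ Ioo (0 : ℝ) 1, ‖form γ a t‖ ≤ K * (1 - t)⁻¹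
  bound_target : ∀ a ∈ D, a ≠ γ 1 → ∃ K, 0 ≤ K ∧ ∀ t ∈ Ioo (0 : ℝ) 1, ‖form γ a t‖ ≤ K * t⁻¹

/-! ### From a path between tangential base points to a tame path -/

theorem exists_bound_of_local_bound {E : Type*} [Norm E] (f : ℝ → E)
    (h : ∀ t₀ ∈ Icc (0 : ℝ) 1, ∃ M, ∀ᶠ t in 𝓝[Ioo 0 1] t₀, ‖f t‖ ≤ M) :
    ∃ M, 0 ≤ M ∧ ∀ t ∈ Ioo (0 : ℝ) 1, ‖f t‖ ≤ M := by
  have := isCompact_Icc.induction_on (s := Icc (0 : ℝ) 1)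
    (p := fun s => ∃ M, ∀ t ∈ s ∩ Ioo (0 : ℝ) 1, ‖f t‖ ≤ M)
    ⟨0, by simp⟩
    (fun s t hst ⟨M, hM⟩ => ⟨M, fun x hx => hM x ⟨hst hx.1, hx.2⟩⟩)
    (fun s t ⟨M, hM⟩ ⟨M', hM'⟩ => ⟨max M M', fun x hx => by
      rcases hx.1 with h1 | h1
      · exact (hM x ⟨h1, hx.2⟩).trans (le_max_left _ _)
      · exact (hM' x ⟨h1, hx.2⟩).trans (le_max_right _ _)⟩)
    (fun t₀ ht₀ => by
      obtain ⟨M, hM⟩ := h t₀ ht₀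
      rw [eventually_nhdsWithin_iff] at hM
      exact ⟨_, mem_nhdsWithin_of_mem_nhds hM, M, fun t ht => ht.1 ht.2⟩)
  obtain ⟨M, hM⟩ := this
  exact ⟨max M 0, le_max_right _ _, fun t ht =>
    (hM t ⟨Ioo_subset_Icc_self ht, ht⟩).trans (le_max_left _ _)⟩

theorem exists_bound_of_tendsto {f : ℝ → ℂ} {l : Filter ℝ} {c : ℂ} (h : Tendsto f l (𝓝 c)) :
    ∃ M, ∀ᶠ t in l, ‖f t‖ ≤ M :=
  ⟨‖c‖ + 1, (h.norm.eventually_lt_const (lt_add_one _)).mono fun _ => le_of_lt⟩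

theorem exists_gap_right (S : Finset ℝ) (t₀ : ℝ) {b : ℝ} (h : t₀ < b) :
    ∃ c, t₀ < c ∧ c ≤ b ∧ ∀ s ∈ S, s ∉ Ioo t₀ c := by
  have : ∀ᶠ c in 𝓝[>] t₀, ∀ s ∈ S, s ∉ Ioo t₀ c := by
    rw [eventually_all_finset]
    intro s _
    by_cases hs : t₀ < s
    · filter_upwards [Ioo_mem_nhdsGT hs] with c hc hc'
      exact absurd hc'.2 (not_lt.2 hc.2.le)
    · exact Eventually.of_forall fun c hc => hs hc.1
  obtain ⟨c, hc1, hc2⟩ := (this.and (Ioc_mem_nhdsGT h)).exists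
  exact ⟨c, hc2.1, hc2.2, hc1⟩

theorem exists_gap_left (S : Finset ℝ) (t₀ : ℝ) {a : ℝ} (h : a < t₀) :
    ∃ c, a ≤ c ∧ c < t₀ ∧ ∀ s ∈ S, s ∉ Ioo c t₀ := by
  have : ∀ᶠ c in 𝓝[<] t₀, ∀ s ∈ S, s ∉ Ioo c t₀ := by
    rw [eventually_all_finset]
    intro s _
    by_cases hs : s < t₀
    · filter_upwards [Ioo_mem_nhdsLT hs] with c hc hc'
      exact absurd hc'.1 (not_lt.2 hc.1.le)
    · exact Eventually.of_forall fun c hc => hs hc.2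
  obtain ⟨c, hc1, hc2⟩ := (this.and (Ico_mem_nhdsLT h)).exists
  exact ⟨c, hc2.1, hc2.2, hc1⟩

theorem exists_bound_deriv_Ioo {γ : ℝ → ℂ} {a b : ℝ} (hab : a < b)
    (h : ContDiffOn ℝ ∞ γ (Icc a b)) : ∃ M, ∀ t ∈ Ioo a b, ‖deriv γ t‖ ≤ M := by
  have hc : ContinuousOn (derivWithin γ (Icc a b)) (Icc a b) :=
    h.continuousOn_derivWithin (uniqueDiffOn_Icc hab) (by simp)
  obtain ⟨M, hM⟩ := isCompact_Icc.exists_bound_of_continuousOn hc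
  refine ⟨M, fun t ht => ?_⟩
  rw [← derivWithin_of_mem_nhds (Icc_mem_nhds ht.1 ht.2)]
  exact hM t (Ioo_subset_Icc_self ht)

theorem PiecewiseSmooth.exists_bound_deriv {γ : ℝ → ℂ} (h : PiecewiseSmooth γ) :
    ∃ M, 0 ≤ M ∧ ∀ t ∈ Ioo (0 : ℝ) 1, ‖deriv γ t‖ ≤ M := by
  obtain ⟨-, S, hS⟩ := h
  refine exists_bound_of_local_bound _ fun t₀ ht₀ => ?_
  have hr : ∃ M, ∀ᶠ t in 𝓝 t₀, t₀ < t → t ∈ Ioo (0 : ℝ) 1 → ‖deriv γ t‖ ≤ M := by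
    rcases ht₀.2.lt_or_eq with h1 | h1
    · obtain ⟨c, hc1, hc2, hc3⟩ := exists_gap_right S t₀ h1
      obtain ⟨M, hM⟩ := exists_bound_deriv_Ioo hc1 (hS t₀ c ht₀.1 hc1 hc2 hc3)
      exact ⟨M, (eventually_lt_nhds hc1).mono fun t ht ht' _ => hM t ⟨ht', ht⟩⟩
    · exact ⟨0, Eventually.of_forall fun t ht ht' => absurd ht'.2 (by linarith)⟩
  have hl : ∃ M, ∀ᶠ t in 𝓝 t₀, t < t₀ → t ∈ Ioo (0 : ℝ) 1 → ‖deriv γ t‖ ≤ M := by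
    rcases ht₀.1.lt_or_eq with h1 | h1
    · obtain ⟨c, hc1, hc2, hc3⟩ := exists_gap_left S t₀ h1
      obtain ⟨M, hM⟩ := exists_bound_deriv_Ioo hc2 (hS c t₀ hc1 hc2 ht₀.2 hc3)
      exact ⟨M, (eventually_gt_nhds hc2).mono fun t ht ht' _ => hM t ⟨ht, ht'⟩⟩
    · exact ⟨0, Eventually.of_forall fun t ht ht' => absurd ht'.1 (by linarith)⟩
  obtain ⟨M, hM⟩ := hr
  obtain ⟨M', hM'⟩ := hl
  -- The one-sided bounds leave out `t₀` itself, which may be a break point; the value of `deriv`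
  -- there is included by hand.
  refine ⟨max ‖deriv γ t₀‖ (max M M'), ?_⟩
  rw [eventually_nhdsWithin_iff]
  filter_upwards [hM, hM'] with t h1 h2 ht
  rcases lt_trichotomy t t₀ with h3 | h3 | h3
  · exact (h2 h3 ht).trans ((le_max_right _ _).trans (le_max_right _ _))
  · rw [h3]
    exact le_max_left _ _
  · exact (h1 h3 ht).trans ((le_max_left _ _).trans (le_max_right _ _))

section

variable {γ : ℝ → ℂ} {p q : TangentialBasePoint} {D : Finset ℂ}

theorem tendsto_div_sub_source (hγ : IsPathOn γ p q ((D : Set ℂ)ᶜ)) :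
    Tendsto (fun t : ℝ => (t : ℂ) / (γ t - γ 0)) (𝓝[>] 0) (𝓝 p.vec⁻¹) := by
  have := hγ.tangent_source.inv₀ p.vec_ne_zero
  rw [← hγ.source] at this
  simpa only [inv_div] using this

theorem tendsto_div_sub_target (hγ : IsPathOn γ p q ((D : Set ℂ)ᶜ)) :
    Tendsto (fun t : ℝ => ((t : ℂ) - 1) / (γ t - γ 1)) (𝓝[<] 1) (𝓝 (-q.vec)⁻¹) := by
  have := hγ.tangent_target.inv₀ (neg_ne_zero.2 q.vec_ne_zero)
  rw [← hγ.target] at this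
  simpa only [inv_div] using this

open Classical in
-- The weight vanishes to first order at exactly those end points where `γ` takes the value `a`.
-- There the quotient has a finite limit, because the tangent vector is non-zero; elsewhere `γ - a`
-- does not vanish.
theorem exists_bound_weight_div (hγ : IsPathOn γ p q ((D : Set ℂ)ᶜ)) {a : ℂ} (ha : a ∈ D) :
    ∃ M, 0 ≤ M ∧ ∀ t ∈ Ioo (0 : ℝ) 1,
      ‖((if a = γ 0 then (t : ℂ) else 1) * (if a = γ 1 then (t : ℂ) - 1 else 1)) / (γ t - a)‖ ≤
        M := by
  have hcont : ContinuousOn γ (Icc 0 1) := hγ.piecewiseSmooth.1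
  refine exists_bound_of_local_bound _ fun t₀ ht₀ => ?_
  have hw0 : Continuous fun t : ℝ => if a = γ 0 then (t : ℂ) else 1 := by
    split_ifs <;> fun_prop
  have hw1 : Continuous fun t : ℝ => if a = γ 1 then (t : ℂ) - 1 else 1 := by
    split_ifs <;> fun_prop
  have hγt : Tendsto γ (𝓝[Ioo 0 1] t₀) (𝓝 (γ t₀)) :=
    (hcont t₀ ht₀).mono_left (nhdsWithin_mono _ Ioo_subset_Icc_self)
  by_cases hne : γ t₀ = a
  · have h01 : t₀ = 0 ∨ t₀ = 1 := by
      by_contra hcon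
      push Not at hcon
      have : γ t₀ ∈ (D : Set ℂ)ᶜ :=
        hγ.mapsTo t₀ ⟨lt_of_le_of_ne ht₀.1 hcon.1.symm, lt_of_le_of_ne ht₀.2 hcon.2⟩
      rw [hne] at this
      exact this ha
    rcases h01 with rfl | rfl
    · have h2 := (tendsto_div_sub_source hγ).mono_left
        (nhdsWithin_mono (0 : ℝ) fun (x : ℝ) (hx : x ∈ Ioo (0 : ℝ) 1) => hx.1)
      have h3 := h2.mul (hw1.continuousWithinAt (s := Ioo 0 1) (x := 0)).tendsto
      refine exists_bound_of_tendsto (h3.congr fun t => ?_)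
      rw [if_pos hne.symm, hne]
      ring
    · have h2 := (tendsto_div_sub_target hγ).mono_left
        (nhdsWithin_mono (1 : ℝ) fun (x : ℝ) (hx : x ∈ Ioo (0 : ℝ) 1) => hx.2)
      have h3 := h2.mul (hw0.continuousWithinAt (s := Ioo 0 1) (x := 1)).tendsto
      refine exists_bound_of_tendsto (h3.congr fun t => ?_)
      rw [if_pos hne.symm, hne]
      ring
  · have h2 := (((hw0.mul hw1).continuousWithinAt (s := Ioo 0 1) (x := t₀)).tendsto).div
      (hγt.sub_const a) (sub_ne_zero.2 hne)
    exact exists_bound_of_tendsto h2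

theorem IsPathOn.exists_tamePath (hγ : IsPathOn γ p q ((D : Set ℂ)ᶜ)) :
    ∃ S, TamePath γ D S := by
  obtain ⟨hcont, S, hS⟩ := id hγ.piecewiseSmooth
  obtain ⟨M, hM0, hM⟩ := hγ.piecewiseSmooth.exists_bound_deriv
  have hdiff : ∀ t ∈ Ioo (0 : ℝ) 1, t ∉ (S : Set ℝ) → ContDiffAt ℝ ∞ γ t := by
    intro t ht htS
    obtain ⟨b, hb1, hb2, hb3⟩ := exists_gap_right S t ht.2
    obtain ⟨a, ha1, ha2, ha3⟩ := exists_gap_left S t ht.1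
    refine (hS a b ha1 (ha2.trans hb1) hb2 fun s hs hs' => ?_).contDiffAt (Icc_mem_nhds ha2 hb1)
    rcases lt_trichotomy s t with h | h | h
    · exact ha3 s hs ⟨hs'.1, h⟩
    · exact htS (h ▸ hs)
    · exact hb3 s hs ⟨h, hs'.2⟩
  -- A bound `M` for `deriv γ` and a bound `N` for weight over `γ - a` give `‖form γ a t‖ ≤ M N / w
  -- t` for any `w` below the weight. The three bounds of a tame path are the choices `t (1 - t)`,
  -- `1 - t` and `t`.
  have key : ∀ a ∈ D, ∀ w : ℝ → ℝ, (∀ t ∈ Ioo (0 : ℝ) 1, 0 < w t) →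
      (∀ t ∈ Ioo (0 : ℝ) 1, w t ≤
        (if a = γ 0 then t else 1) * (if a = γ 1 then 1 - t else 1)) →
      ∃ K, 0 ≤ K ∧ ∀ t ∈ Ioo (0 : ℝ) 1, ‖form γ a t‖ ≤ K * (w t)⁻¹ := by
    intro a ha w hw hle
    obtain ⟨N, hN0, hN⟩ := exists_bound_weight_div hγ ha
    refine ⟨M * N, mul_nonneg hM0 hN0, fun t ht => ?_⟩
    have h1 := hN t ht
    have h2 : ‖((if a = γ 0 then (t : ℂ) else 1) * (if a = γ 1 then (t : ℂ) - 1 else 1))‖ =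
        (if a = γ 0 then t else 1) * (if a = γ 1 then 1 - t else 1) := by
      have e1 : ‖(t : ℂ)‖ = t := by simp [abs_of_pos ht.1]
      have e2 : ‖(t : ℂ) - 1‖ = 1 - t := by
        rw [norm_sub_rev, ← Complex.ofReal_one, ← Complex.ofReal_sub, Complex.norm_real,
          Real.norm_of_nonneg (by linarith [ht.2])]
      rw [norm_mul]
      congr 1
      · split_ifs
        · exact e1
        · simp
      · split_ifs
        · exact e2
        · simp
    rw [norm_div, h2] at h1
    have hpos : 0 < ‖γ t - a‖ := norm_pos_iff.2 (sub_ne_zero.2 fun h => by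
      have := hγ.mapsTo t ht
      rw [h] at this
      exact this ha)
    rw [div_le_iff₀ hpos] at h1
    have h3 : w t ≤ N * ‖γ t - a‖ := (hle t ht).trans h1
    rw [form, norm_div, div_le_iff₀ hpos]
    have h4 : 1 ≤ (w t)⁻¹ * (N * ‖γ t - a‖) := by
      rw [← inv_mul_cancel₀ (hw t ht).ne']
      exact mul_le_mul_of_nonneg_left h3 (inv_nonneg.2 (hw t ht).le)
    calc ‖deriv γ t‖ ≤ M * 1 := by rw [mul_one]; exact hM t ht
      _ ≤ M * ((w t)⁻¹ * (N * ‖γ t - a‖)) := mul_le_mul_of_nonneg_left h4 hM0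
      _ = _ := by ring
  refine ⟨S, S.finite_toSet, fun t ht htS => ?_, fun t ht htS => ?_,
    hcont.mono Ioo_subset_Icc_self, fun a ha t ht h => ?_, fun a ha => ?_, fun a ha hne => ?_,
    fun a ha hne => ?_⟩
  · exact ((hdiff t ht htS).differentiableAt (by simp)).hasDerivAt
  · exact ((hdiff t ht htS).derivWithin (m := 0) (by simp)).continuousAt
  · have := hγ.mapsTo t ht
    rw [h] at this
    exact this ha
  · obtain ⟨K, hK0, hK⟩ := key a ha (fun t => t * (1 - t))
      (fun t ht => mul_pos ht.1 (by linarith [ht.2])) (fun t ht => by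
        have h1 := ht.1
        have h2 := ht.2
        split_ifs <;> nlinarith)
    refine ⟨K, hK0, fun t ht => ?_⟩
    rw [← mul_inv]
    exact hK t ht
  · refine key a ha (fun t => 1 - t) (fun t ht => by linarith [ht.2]) (fun t ht => ?_)
    have h1 := ht.1
    have h2 := ht.2
    rw [if_neg hne]
    split_ifs <;> linarith
  · refine key a ha (fun t => t) (fun t ht => ht.1) (fun t ht => ?_)
    have h1 := ht.1
    have h2 := ht.2
    rw [if_neg hne]
    split_ifs <;> linarith

end

/-! ### The logarithm along a tame path -/

namespace TamePath

variable {γ : ℝ → ℂ} {D : Finset ℂ} {S : Set ℝ} (hT : TamePath γ D S)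
include hT

theorem continuousAt {t : ℝ} (ht : t ∈ Ioo (0 : ℝ) 1) : ContinuousAt γ t :=
  hT.continuousOn.continuousAt (Ioo_mem_nhds ht.1 ht.2)

theorem continuousAt_form {a : ℂ} (ha : a ∈ D) {t : ℝ} (ht : t ∈ Ioo (0 : ℝ) 1) (htS : t ∉ S) :
    ContinuousAt (form γ a) t :=
  (hT.continuousAt_deriv t ht htS).div ((hT.continuousAt ht).sub_const a)
    (sub_ne_zero.2 (hT.ne a ha t ht))

/-- Any continuous branch of the logarithm is a primitive of `dγ / γ`. -/
theorem hasDerivAt_log {L : ℝ → ℂ} (hL : IsLogAlong γ L) (h0 : (0 : ℂ) ∈ D) {t : ℝ}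
    (ht : t ∈ Ioo (0 : ℝ) 1) (htS : t ∉ S) : HasDerivAt L (form γ 0 t) t := by
  have hγt : γ t ≠ 0 := hT.ne 0 h0 t ht
  have hLc : ContinuousAt L t := hL.1.continuousAt (Ioo_mem_nhds ht.1 ht.2)
  have h1 : HasDerivAt (fun s => Complex.log (γ s / γ t)) (deriv γ t / γ t / (γ t / γ t)) t := by
    refine ((hT.hasDerivAt t ht htS).div_const (γ t)).clog_real ?_
    rw [div_self hγt]
    exact Complex.one_mem_slitPlane
  -- As long as `L s` is within `π` of `L t`, the principal logarithm of `γ s / γ t = exp (L s - L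
  -- t)` is `L s - L t`.
  have h2 : (fun s => L t + Complex.log (γ s / γ t)) =ᶠ[𝓝 t] L := by
    have h3 : ∀ᶠ s in 𝓝 t, ‖L s - L t‖ < Real.pi := by
      have : Tendsto (fun s => ‖L s - L t‖) (𝓝 t) (𝓝 ‖L t - L t‖) :=
        (hLc.tendsto.sub_const (L t)).norm
      rw [sub_self, norm_zero] at this
      exact this.eventually_lt_const Real.pi_pos
    filter_upwards [h3, Ioo_mem_nhds ht.1 ht.2] with s hs hs'
    have h4 : γ s / γ t = Complex.exp (L s - L t) := by
      rw [Complex.exp_sub, hL.2 s hs', hL.2 t ht]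
    have h5 : |(L s - L t).im| < Real.pi := (Complex.abs_im_le_norm _).trans_lt hs
    rw [abs_lt] at h5
    rw [h4, Complex.log_exp h5.1 h5.2.le]
    ring
  have h6 := (h1.const_add (L t)).congr_of_eventuallyEq h2.symm
  refine h6.congr_deriv ?_
  rw [form, sub_zero, div_self hγt, div_one]

theorem aestronglyMeasurable_form (a : ℂ) :
    AEStronglyMeasurable (form γ a) (volume.restrict (Ioo 0 1)) := by
  refine AEMeasurable.aestronglyMeasurable ?_
  exact (measurable_deriv γ).aemeasurable.div
    ((hT.continuousOn.aemeasurable measurableSet_Ioo).sub aemeasurable_const)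

theorem intervalIntegrable_form {a : ℂ} (ha : a ∈ D) {x t : ℝ} (hx : x ∈ Ioo (0 : ℝ) 1)
    (ht : t ∈ Ioo (0 : ℝ) 1) : IntervalIntegrable (form γ a) volume x t := by
  have hsub : uIcc x t ⊆ Ioo 0 1 := (convex_Ioo (0 : ℝ) 1).ordConnected.uIcc_subset hx ht
  obtain ⟨K, hK0, hK⟩ := hT.bound a ha
  have hb : ContinuousOn (fun s : ℝ => K * (s⁻¹ * (1 - s)⁻¹)) (uIcc x t) := by
    refine continuousOn_const.mul (ContinuousOn.mul ?_ ?_)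
    · exact continuousOn_id.inv₀ fun s hs => (hsub hs).1.ne'
    · exact ContinuousOn.inv₀ (by fun_prop) fun s hs => by
        have := (hsub hs).2
        simp only [ne_eq]
        linarith
  refine hb.intervalIntegrable.mono_fun' ?_ ?_
  · exact (hT.aestronglyMeasurable_form a).mono_measure
      (Measure.restrict_mono (uIoc_subset_uIcc.trans hsub) le_rfl)
  · refine (ae_restrict_iff' measurableSet_uIoc).2 (Eventually.of_forall fun s hs => ?_)
    exact hK s (hsub (uIoc_subset_uIcc hs))

/-- The branch is a primitive of `dγ / γ`, normalized at the interior point `1 / 2`, since the form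
may have poles at both end points. -/
theorem exists_isLogAlong (h0 : (0 : ℂ) ∈ D) : ∃ L, IsLogAlong γ L := by
  have hhalf : (1 / 2 : ℝ) ∈ Ioo (0 : ℝ) 1 := by norm_num
  have hc : γ (1 / 2) ≠ 0 := hT.ne 0 h0 _ hhalf
  set L : ℝ → ℂ := fun t => Complex.log (γ (1 / 2)) + ∫ s in (1 / 2)..t, form γ 0 s with hLdef
  have hcont : ContinuousOn L (Ioo 0 1) := by
    refine continuousOn_const.add fun t ht => ContinuousAt.continuousWithinAt ?_
    obtain ⟨a, ha1, ha2⟩ := exists_between (lt_min ht.1 hhalf.1)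
    obtain ⟨b, hb1, hb2⟩ := exists_between (max_lt ht.2 hhalf.2)
    have ha : a ∈ Ioo (0 : ℝ) 1 := ⟨ha1, ha2.trans (min_lt_iff.2 (Or.inl ht.2))⟩
    have hb : b ∈ Ioo (0 : ℝ) 1 := ⟨lt_of_lt_of_le ht.1 ((le_max_left _ _).trans hb1.le), hb2⟩
    have hab : a ≤ b := (ha2.le.trans (min_le_left _ _)).trans ((le_max_left _ _).trans hb1.le)
    have hI := hT.intervalIntegrable_form h0 ha hb
    have := intervalIntegral.continuousOn_primitive_interval' hI
      (a := 1 / 2) ⟨by rw [min_eq_left hab]; exact ha2.le.trans (min_le_right _ _),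
        by rw [max_eq_right hab]; exact (le_max_right _ _).trans hb1.le⟩
    rw [uIcc_of_le hab] at this
    exact this.continuousAt (Icc_mem_nhds (ha2.trans_le (min_le_left _ _))
      ((le_max_left _ _).trans_lt hb1))
  have hderiv : ∀ t ∈ Ioo (0 : ℝ) 1, t ∉ S → HasDerivAt L (form γ 0 t) t := by
    intro t ht htS
    refine (intervalIntegral.integral_hasDerivAt_right (hT.intervalIntegrable_form h0 hhalf ht) ?_
      (hT.continuousAt_form h0 ht htS)).const_add _
    exact ⟨Ioo 0 1, Ioo_mem_nhds ht.1 ht.2, hT.aestronglyMeasurable_form 0⟩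
  refine ⟨L, hcont, fun t ht => ?_⟩
  have hsub : uIcc (1 / 2) t ⊆ Ioo 0 1 :=
    (convex_Ioo (0 : ℝ) 1).ordConnected.uIcc_subset hhalf ht
  -- The product `exp (-L) γ` is continuous with derivative `0` off the finite set `S`, so it keeps
  -- the value `1` that it has at `1 / 2`.
  have key := MeasureTheory.integral_eq_of_hasDerivAt_off_countable
    (fun s => Complex.exp (-L s) * γ s) (fun _ => 0) hT.finite.countable
    (a := 1 / 2) (b := t)
    (((hcont.neg.mono hsub).cexp).mul (hT.continuousOn.mono hsub)) (fun s hs => by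
      have hs1 : s ∈ Ioo (0 : ℝ) 1 := hsub ⟨hs.1.1.le, hs.1.2.le⟩
      have e1 := ((hderiv s hs1 hs.2).neg.cexp).mul (hT.hasDerivAt s hs1 hs.2)
      refine e1.congr_deriv ?_
      have hs0 := hT.ne 0 h0 s hs1
      simp only [form, sub_zero]
      field_simp
      ring) (by simp)
  simp only [intervalIntegral.integral_zero] at key
  have e1 : L (1 / 2) = Complex.log (γ (1 / 2)) := by simp [hLdef]
  rw [e1, Complex.exp_neg, Complex.exp_neg, Complex.exp_log hc, inv_mul_cancel₀ hc] at key
  have e2 := sub_eq_zero.1 key.symm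
  have e3 := Complex.exp_ne_zero (L t)
  field_simp at e2
  exact e2.symm

theorem isLogAlong_logAlong (h0 : (0 : ℂ) ∈ D) : IsLogAlong γ (logAlong γ) := by
  have h := hT.exists_isLogAlong h0
  rw [logAlong, dif_pos h]
  exact h.choose_spec

/-- The difference is the integral of `dγ / γ` from `x` to `t`, and the bound `K / (s (1 - s))` has
the primitive `K (log s - log (1 - s))`. -/
theorem exists_norm_log_sub_le (h0 : (0 : ℂ) ∈ D) :
    ∃ K, 0 ≤ K ∧ ∀ x t : ℝ, 0 < x → x ≤ t → t < 1 →
      ‖logAlong γ t - logAlong γ x‖ ≤ K * (Real.log (t / x) + ell t) := by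
  have hL := hT.isLogAlong_logAlong h0
  obtain ⟨K, hK0, hK⟩ := hT.bound 0 h0
  refine ⟨K, hK0, fun x t hx hxt ht => ?_⟩
  have hsub : Icc x t ⊆ Ioo 0 1 := fun s hs => ⟨hx.trans_le hs.1, hs.2.trans_lt ht⟩
  have hI := hT.intervalIntegrable_form h0 (hsub ⟨le_rfl, hxt⟩) (hsub ⟨hxt, le_rfl⟩)
  have h1 := MeasureTheory.integral_eq_of_hasDerivAt_off_countable_of_le
    (logAlong γ) (form γ 0) hxt hT.finite.countable (hL.1.mono hsub)
    (fun s hs => hT.hasDerivAt_log hL h0 (hsub ⟨hs.1.1.le, hs.1.2.le⟩) hs.2) hI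
  have hb : ContinuousOn (fun s : ℝ => K * (s⁻¹ * (1 - s)⁻¹)) (Icc x t) := by
    refine continuousOn_const.mul (ContinuousOn.mul ?_ ?_)
    · exact continuousOn_id.inv₀ fun s hs => (hsub hs).1.ne'
    · exact ContinuousOn.inv₀ (by fun_prop) fun s hs => by
        have := (hsub hs).2
        simp only [ne_eq]
        linarith
  have hbi : IntervalIntegrable (fun s : ℝ => K * (s⁻¹ * (1 - s)⁻¹)) volume x t := by
    rw [← uIcc_of_le hxt] at hb
    exact hb.intervalIntegrable
  have h2 := intervalIntegral.norm_integral_le_of_norm_le hxt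
    (Eventually.of_forall fun s hs => hK s (hsub ⟨hs.1.le, hs.2⟩)) hbi
  have h3 : ∫ s in x..t, K * (s⁻¹ * (1 - s)⁻¹) =
      K * (Real.log t - Real.log (1 - t)) - K * (Real.log x - Real.log (1 - x)) := by
    refine intervalIntegral.integral_eq_sub_of_hasDerivAt
      (f := fun s => K * (Real.log s - Real.log (1 - s))) (fun s hs => ?_) hbi
    rw [uIcc_of_le hxt] at hs
    have hs1 := hsub hs
    have hs2 : (1 : ℝ) - s ≠ 0 := by linarith [hs1.2]
    have hs3 : s ≠ 0 := hs1.1.ne'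
    refine (((Real.hasDerivAt_log hs3).sub
      (((hasDerivAt_id s).const_sub 1).log hs2)).const_mul K).congr_deriv ?_
    simp only [id]
    field_simp
    ring
  rw [h1, h3] at h2
  refine h2.trans ?_
  rw [← mul_sub, Real.log_div (hx.trans_le hxt).ne' hx.ne']
  refine mul_le_mul_of_nonneg_left ?_ hK0
  have h4 : Real.log (1 - x) ≤ 0 := Real.log_nonpos (by linarith) (by linarith)
  unfold ell
  linarith

theorem exists_norm_log_sub_pow_le (h0 : (0 : ℂ) ∈ D) (k : ℕ) :
    ∃ K, 0 ≤ K ∧ ∀ x t : ℝ, 0 < x → x ≤ t → t < 1 →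
      ‖(logAlong γ t - logAlong γ x) ^ k‖ ≤ K * ((t / x) ^ (1 / 4 : ℝ) * ell t ^ k) := by
  obtain ⟨K, hK0, hK⟩ := hT.exists_norm_log_sub_le h0
  refine ⟨K ^ k * (k.factorial * 4 ^ k * Real.exp (1 / 4)), by positivity,
    fun x t hx hxt ht => ?_⟩
  rw [norm_pow]
  calc ‖logAlong γ t - logAlong γ x‖ ^ k ≤ (K * (Real.log (t / x) + ell t)) ^ k :=
        pow_le_pow_left₀ (norm_nonneg _) (hK x t hx hxt ht) _
    _ = K ^ k * (Real.log (t / x) + ell t) ^ k := mul_pow _ _ _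
    _ ≤ K ^ k * ((k.factorial * 4 ^ k * Real.exp (1 / 4)) *
        ((t / x) ^ (1 / 4 : ℝ) * ell t ^ k)) :=
        mul_le_mul_of_nonneg_left (log_div_add_ell_pow_le k hx hxt ht) (pow_nonneg hK0 _)
    _ = _ := by ring

end TamePath

/-! ### Primitives of densities on the open unit interval -/

/-- A density on `(0,1)`: continuous outside `S`, with an integrable singularity at `0` and at most
logarithmic growth of its primitive at `1`. -/
structure Dens (S : Set ℝ) (φ : ℝ → ℂ) : Prop where
  bound : ∃ (C : ℝ) (n : ℕ), 0 ≤ C ∧ ∀ x ∈ Ioo (0 : ℝ) 1, ‖φ x‖ ≤ C * densBound n x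
  continuousAt : ∀ x ∈ Ioo (0 : ℝ) 1, x ∉ S → ContinuousAt φ x

/-- A continuous function on `(0,1)` that vanishes at `0` and grows at most logarithmically at
`1`. -/
structure Amp (f : ℝ → ℂ) : Prop where
  bound : ∃ (C : ℝ) (n : ℕ), 0 ≤ C ∧ ∀ x ∈ Ioo (0 : ℝ) 1, ‖f x‖ ≤ C * ampBound n x
  continuousOn : ContinuousOn f (Ioo 0 1)
  zero : f 0 = 0

/-- The primitive of `φ` that vanishes at `0`. -/
def prim (φ : ℝ → ℂ) (t : ℝ) : ℂ := ∫ x in (0 : ℝ)..t, φ x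

theorem prim_zero (φ : ℝ → ℂ) : prim φ 0 = 0 := by simp [prim]

theorem prim_congr {φ ψ : ℝ → ℂ} {t : ℝ} (ht : t ∈ Ioo (0 : ℝ) 1)
    (h : ∀ x ∈ Ioo (0 : ℝ) 1, φ x = ψ x) : prim φ t = prim ψ t := by
  refine intervalIntegral.integral_congr_ae (Eventually.of_forall fun x hx => ?_)
  rw [uIoc_of_le ht.1.le] at hx
  exact h x ⟨hx.1, hx.2.trans_lt ht.2⟩

theorem ampBound_le_ampBound {n m : ℕ} (hnm : n ≤ m) {t : ℝ} (h0 : 0 ≤ t) (h1 : t < 1) :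
    ampBound n t ≤ ampBound m t :=
  mul_le_mul_of_nonneg_left (pow_le_pow_right₀ (one_le_ell h0 h1) hnm) (Real.rpow_nonneg h0 _)

theorem inv_mul_inv_mul_ampBound (n : ℕ) {t : ℝ} (h0 : 0 < t) :
    t⁻¹ * (1 - t)⁻¹ * ampBound n t = densBound n t := by
  have := inv_mul_ampBound n h0
  unfold densBound
  linear_combination (1 - t)⁻¹ * this

theorem ampBound_le_rpow (n : ℕ) {x t : ℝ} (h0 : 0 < x) (hxt : x ≤ t) (h1 : t < 1) :
    ampBound n x ≤ ell t ^ n * x ^ (1 / 4 : ℝ) := by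
  have h2 : x ^ (1 / 2 : ℝ) ≤ x ^ (1 / 4 : ℝ) :=
    Real.rpow_le_rpow_of_exponent_ge h0 (hxt.trans h1.le) (by norm_num)
  have h3 : ell x ^ n ≤ ell t ^ n :=
    pow_le_pow_left₀ (ell_pos h0.le (hxt.trans_lt h1)).le (ell_le_ell hxt h1) _
  unfold ampBound
  rw [mul_comm]
  exact mul_le_mul h3 h2 (Real.rpow_nonneg h0.le _) (pow_nonneg (ell_pos (h0.le.trans hxt) h1).le _)

theorem aestronglyMeasurable_of_continuousAt {S : Set ℝ} (hS : S.Finite) {φ : ℝ → ℂ}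
    (h : ∀ x ∈ Ioo (0 : ℝ) 1, x ∉ S → ContinuousAt φ x) :
    AEStronglyMeasurable φ (volume.restrict (Ioo 0 1)) := by
  have h1 : AEStronglyMeasurable φ (volume.restrict (Ioo (0 : ℝ) 1 \ S)) :=
    ContinuousOn.aestronglyMeasurable
      (fun x hx => (h x hx.1 hx.2).continuousWithinAt) (measurableSet_Ioo.diff hS.measurableSet)
  have h2 : volume.restrict (Ioo (0 : ℝ) 1 \ S) = volume.restrict (Ioo (0 : ℝ) 1) :=
    Measure.restrict_congr_set (sdiff_null_ae_eq_self (hS.measure_zero volume))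
  rwa [h2] at h1

theorem integrableOn_of_norm_le_convBound {φ : ℝ → ℂ} {t C : ℝ} {k n : ℕ}
    (hm : AEStronglyMeasurable φ (volume.restrict (Ioo 0 1))) (ht : t ∈ Ioo (0 : ℝ) 1)
    (hb : ∀ x ∈ Ioc 0 t, ‖φ x‖ ≤ C * convBound k n t x) :
    IntervalIntegrable φ volume 0 t := by
  rw [intervalIntegrable_iff_integrableOn_Ioc_of_le ht.1.le]
  refine Integrable.mono' ((integrableOn_convBound k n ht.1 ht.2).1.const_mul C) ?_
    ((ae_restrict_iff' measurableSet_Ioc).2 (Eventually.of_forall hb))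
  have hsub : Ioc 0 t ⊆ Ioo 0 1 := fun x hx => ⟨hx.1, hx.2.trans_lt ht.2⟩
  exact hm.mono_measure (Measure.restrict_mono hsub le_rfl)

/-! ### Algebra of amplitudes and densities -/

namespace Amp

variable {f g : ℝ → ℂ}

theorem mul (hf : Amp f) (hg : Amp g) : Amp fun x => f x * g x := by
  obtain ⟨C, n, hC, hf'⟩ := hf.bound
  obtain ⟨C', m, hC', hg'⟩ := hg.bound
  refine ⟨⟨C * C', n + m, mul_nonneg hC hC', fun x hx => ?_⟩,
    hf.continuousOn.mul hg.continuousOn, by rw [hf.zero, zero_mul]⟩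
  rw [norm_mul]
  have h1 := ampBound_nonneg n hx.1.le hx.2
  calc ‖f x‖ * ‖g x‖ ≤ (C * ampBound n x) * (C' * ampBound m x) :=
        mul_le_mul (hf' x hx) (hg' x hx) (norm_nonneg _) (mul_nonneg hC h1)
    _ = C * C' * (ampBound n x * ampBound m x) := by ring
    _ ≤ C * C' * ampBound (n + m) x :=
        mul_le_mul_of_nonneg_left (ampBound_mul_le n m hx.1.le hx.2) (mul_nonneg hC hC')

theorem add (hf : Amp f) (hg : Amp g) : Amp fun x => f x + g x := by
  obtain ⟨C, n, hC, hf'⟩ := hf.bound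
  obtain ⟨C', m, hC', hg'⟩ := hg.bound
  refine ⟨⟨C + C', max n m, add_nonneg hC hC', fun x hx => ?_⟩,
    hf.continuousOn.add hg.continuousOn, by rw [hf.zero, hg.zero, add_zero]⟩
  refine (norm_add_le _ _).trans ?_
  rw [add_mul]
  exact add_le_add
    ((hf' x hx).trans (mul_le_mul_of_nonneg_left
      (ampBound_le_ampBound (le_max_left _ _) hx.1.le hx.2) hC))
    ((hg' x hx).trans (mul_le_mul_of_nonneg_left
      (ampBound_le_ampBound (le_max_right _ _) hx.1.le hx.2) hC'))

theorem const_mul (hf : Amp f) (c : ℂ) : Amp fun x => c * f x := by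
  obtain ⟨C, n, hC, hf'⟩ := hf.bound
  refine ⟨⟨‖c‖ * C, n, by positivity, fun x hx => ?_⟩,
    continuousOn_const.mul hf.continuousOn, by rw [hf.zero, mul_zero]⟩
  rw [norm_mul, mul_assoc]
  exact mul_le_mul_of_nonneg_left (hf' x hx) (norm_nonneg _)

theorem continuousAt (hf : Amp f) {x : ℝ} (hx : x ∈ Ioo (0 : ℝ) 1) : ContinuousAt f x :=
  hf.continuousOn.continuousAt (Ioo_mem_nhds hx.1 hx.2)

end Amp

namespace Dens

variable {S : Set ℝ} {φ ψ : ℝ → ℂ}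

theorem mul_amp (hφ : Dens S φ) {f : ℝ → ℂ} (hf : Amp f) : Dens S fun x => φ x * f x := by
  obtain ⟨C, n, hC, hφ'⟩ := hφ.bound
  obtain ⟨C', m, hC', hf'⟩ := hf.bound
  refine ⟨⟨C * C', n + m, mul_nonneg hC hC', fun x hx => ?_⟩,
    fun x hx hxS => (hφ.continuousAt x hx hxS).mul (hf.continuousAt hx)⟩
  rw [norm_mul]
  have h1 := densBound_nonneg n hx.1.le hx.2
  calc ‖φ x‖ * ‖f x‖ ≤ (C * densBound n x) * (C' * ampBound m x) :=
        mul_le_mul (hφ' x hx) (hf' x hx) (norm_nonneg _) (mul_nonneg hC h1)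
    _ = C * C' * (densBound n x * ampBound m x) := by ring
    _ ≤ C * C' * densBound (n + m) x :=
        mul_le_mul_of_nonneg_left (densBound_mul_ampBound_le n m hx.1.le hx.2) (mul_nonneg hC hC')

theorem aestronglyMeasurable (hS : S.Finite) (hφ : Dens S φ) :
    AEStronglyMeasurable φ (volume.restrict (Ioo 0 1)) :=
  aestronglyMeasurable_of_continuousAt hS hφ.continuousAt

theorem intervalIntegrable (hS : S.Finite) (hφ : Dens S φ) {t : ℝ} (ht : t ∈ Ioo (0 : ℝ) 1) :
    IntervalIntegrable φ volume 0 t := by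
  obtain ⟨C, n, hC, hφ'⟩ := hφ.bound
  refine integrableOn_of_norm_le_convBound (C := C) (k := 0) (n := n)
    (hφ.aestronglyMeasurable hS) ht fun x hx => ?_
  exact (hφ' x ⟨hx.1, hx.2.trans_lt ht.2⟩).trans
    (mul_le_mul_of_nonneg_left (densBound_le_convBound n hx.1 hx.2 ht.2) hC)

theorem hasDerivAt_prim (hS : S.Finite) (hφ : Dens S φ) {t : ℝ} (ht : t ∈ Ioo (0 : ℝ) 1)
    (htS : t ∉ S) : HasDerivAt (prim φ) (φ t) t :=
  intervalIntegral.integral_hasDerivAt_right (hφ.intervalIntegrable hS ht)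
    ⟨Ioo 0 1, Ioo_mem_nhds ht.1 ht.2, hφ.aestronglyMeasurable hS⟩ (hφ.continuousAt t ht htS)

/-- A density is bounded by the convolution bound with `k = 0`, whose integral has the size of an
amplitude. -/
theorem amp_prim (hS : S.Finite) (hφ : Dens S φ) : Amp (prim φ) := by
  refine ⟨?_, fun t ht => ContinuousAt.continuousWithinAt ?_, prim_zero φ⟩
  · obtain ⟨C, n, hC, hφ'⟩ := hφ.bound
    refine ⟨C * 4, n + 0 + 1, by positivity, fun t ht => ?_⟩
    obtain ⟨hi, hle⟩ := integrableOn_convBound 0 n ht.1 ht.2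
    have h1 := intervalIntegral.norm_integral_le_of_norm_le ht.1.le (f := φ) (μ := volume)
      (g := fun x => C * convBound 0 n t x)
      (Eventually.of_forall fun x hx => (hφ' x ⟨hx.1, hx.2.trans_lt ht.2⟩).trans
        (mul_le_mul_of_nonneg_left (densBound_le_convBound n hx.1 hx.2 ht.2) hC))
      ((intervalIntegrable_iff_integrableOn_Ioc_of_le ht.1.le).2 (hi.const_mul C))
    rw [intervalIntegral.integral_const_mul,
      intervalIntegral.integral_of_le ht.1.le (f := convBound 0 n t)] at h1
    refine h1.trans ?_
    rw [mul_assoc]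
    exact mul_le_mul_of_nonneg_left hle hC
  · obtain ⟨b, hb1, hb2⟩ := exists_between ht.2
    have hb : b ∈ Ioo (0 : ℝ) 1 := ⟨ht.1.trans hb1, hb2⟩
    have := intervalIntegral.continuousOn_primitive_interval' (hφ.intervalIntegrable hS hb)
      left_mem_uIcc
    rw [uIcc_of_le hb.1.le] at this
    exact this.continuousAt (Icc_mem_nhds ht.1 hb1)

theorem prim_add (hS : S.Finite) (hφ : Dens S φ) (hψ : Dens S ψ) {t : ℝ}
    (ht : t ∈ Ioo (0 : ℝ) 1) : prim (fun x => φ x + ψ x) t = prim φ t + prim ψ t :=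
  intervalIntegral.integral_add (hφ.intervalIntegrable hS ht) (hψ.intervalIntegrable hS ht)

end Dens

/-- The bound by `x^(1/4)` supplies continuity at `0`, and finitely many points without a derivative
are harmless to the fundamental theorem of calculus for a continuous function. -/
theorem prim_eq_of_hasDerivAt {S : Set ℝ} (hS : S.Finite) {g g' : ℝ → ℂ} {t C : ℝ} (ht : 0 < t)
    (hc : ContinuousOn g (Ioc 0 t)) (h0 : g 0 = 0)
    (hb : ∀ x ∈ Ioc 0 t, ‖g x‖ ≤ C * x ^ (1 / 4 : ℝ))
    (hd : ∀ x ∈ Ioo 0 t, x ∉ S → HasDerivAt g (g' x) x) (hi : IntervalIntegrable g' volume 0 t) :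
    prim g' t = g t := by
  have hc0 : ContinuousOn g (Icc 0 t) := by
    intro x hx
    rcases hx.1.eq_or_lt with h | h
    · subst h
      have hlim : Tendsto (fun x : ℝ => C * x ^ (1 / 4 : ℝ)) (𝓝[Icc 0 t] 0) (𝓝 0) := by
        have : Continuous fun x : ℝ => C * x ^ (1 / 4 : ℝ) :=
          continuous_const.mul (Real.continuous_rpow_const (by norm_num))
        have h2 := this.tendsto 0
        rw [Real.zero_rpow (by norm_num), mul_zero] at h2
        exact h2.mono_left nhdsWithin_le_nhds
      have : Tendsto g (𝓝[Icc 0 t] 0) (𝓝 0) := by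
        refine squeeze_zero_norm' ?_ hlim
        filter_upwards [self_mem_nhdsWithin] with y hy
        rcases hy.1.eq_or_lt with h3 | h3
        · rw [← h3, h0, Real.zero_rpow (by norm_num)]
          simp
        · exact hb y ⟨h3, hy.2⟩
      rw [ContinuousWithinAt, h0]
      exact this
    · have h1 := hc x ⟨h, hx.2⟩
      refine (continuousWithinAt_inter (Ioi_mem_nhds h)).1 (h1.mono ?_)
      rintro y ⟨hy, hy'⟩
      exact ⟨hy', hy.2⟩
  have := MeasureTheory.integral_eq_of_hasDerivAt_off_countable_of_le g g' ht.le hS.countable hc0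
    (fun x hx => hd x hx.1 hx.2) hi
  rw [prim, this, h0, sub_zero]

/-- The product of two primitives is the primitive of the sum of the two partial products. -/
theorem prim_mul_prim {S : Set ℝ} (hS : S.Finite) {φ ψ : ℝ → ℂ} (hφ : Dens S φ) (hψ : Dens S ψ)
    {t : ℝ} (ht : t ∈ Ioo (0 : ℝ) 1) :
    prim φ t * prim ψ t =
      prim (fun x => φ x * prim ψ x) t + prim (fun x => ψ x * prim φ x) t := by
  have hf := hφ.amp_prim hS
  have hg := hψ.amp_prim hS
  have h1 := hφ.mul_amp hg
  have h2 := hψ.mul_amp hf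
  rw [← h1.prim_add hS h2 ht]
  obtain ⟨C, n, hC, hb⟩ := (hf.mul hg).bound
  refine (prim_eq_of_hasDerivAt hS (g := fun x => prim φ x * prim ψ x) (C := C * ell t ^ n) ht.1
    ((hf.mul hg).continuousOn.mono fun x hx => ⟨hx.1, hx.2.trans_lt ht.2⟩) (hf.mul hg).zero
    (fun x hx => ?_) (fun x hx hxS => ?_)
    ((h1.intervalIntegrable hS ht).add (h2.intervalIntegrable hS ht))).symm
  · rw [mul_assoc]
    exact (hb x ⟨hx.1, hx.2.trans_lt ht.2⟩).trans
      (mul_le_mul_of_nonneg_left (ampBound_le_rpow n hx.1 hx.2 ht.2) hC)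
  · have hx1 : x ∈ Ioo (0 : ℝ) 1 := ⟨hx.1, hx.2.trans ht.2⟩
    refine ((hφ.hasDerivAt_prim hS hx1 hxS).mul (hψ.hasDerivAt_prim hS hx1 hxS)).congr_deriv ?_
    ring

/-! ### Convolution with powers of the logarithm -/

namespace TamePath

variable {γ : ℝ → ℂ} {D : Finset ℂ} {S : Set ℝ}

theorem dens_form (hT : TamePath γ D S) {a : ℂ} (ha : a ∈ D) (hne : a ≠ γ 0) :
    Dens S (form γ a) := by
  obtain ⟨K, hK0, hK⟩ := hT.bound_source a ha hne
  exact ⟨⟨K, 0, hK0, fun x hx => (hK x hx).trans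
    (mul_le_mul_of_nonneg_left (inv_one_sub_le_densBound hx.1 hx.2) hK0)⟩,
    fun x hx hxS => hT.continuousAt_form ha hx hxS⟩

/-- No condition on `a` at `γ 0` is needed: the `x^(1/2)` of the amplitude reduces a simple pole at
`0` to `x^(-1/2)`. -/
theorem dens_form_mul (hT : TamePath γ D S) {a : ℂ} (ha : a ∈ D) {f : ℝ → ℂ} (hf : Amp f) :
    Dens S fun x => form γ a x * f x := by
  obtain ⟨K, hK0, hK⟩ := hT.bound a ha
  obtain ⟨C, n, hC, hb⟩ := hf.bound
  refine ⟨⟨K * C, n, mul_nonneg hK0 hC, fun x hx => ?_⟩,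
    fun x hx hxS => (hT.continuousAt_form ha hx hxS).mul (hf.continuousAt hx)⟩
  have h1 : 0 ≤ x⁻¹ * (1 - x)⁻¹ :=
    mul_nonneg (inv_nonneg.2 hx.1.le) (inv_nonneg.2 (by linarith [hx.2]))
  rw [norm_mul]
  calc ‖form γ a x‖ * ‖f x‖ ≤ (K * (x⁻¹ * (1 - x)⁻¹)) * (C * ampBound n x) :=
        mul_le_mul (hK x hx) (hb x hx) (norm_nonneg _) (mul_nonneg hK0 h1)
    _ = K * C * (x⁻¹ * (1 - x)⁻¹ * ampBound n x) := by ring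
    _ = K * C * densBound n x := by rw [inv_mul_inv_mul_ampBound n hx.1]

theorem norm_log_pow_mul_le (hT : TamePath γ D S) (h0 : (0 : ℂ) ∈ D) {φ : ℝ → ℂ} (hφ : Dens S φ)
    (k : ℕ) : ∃ (C : ℝ) (n : ℕ), 0 ≤ C ∧ ∀ x t : ℝ, 0 < x → x ≤ t → t < 1 →
      ‖(logAlong γ t - logAlong γ x) ^ k / (k.factorial : ℂ) * φ x‖ ≤ C * convBound k n t x := by
  obtain ⟨K, hK0, hK⟩ := hT.exists_norm_log_sub_pow_le h0 k
  obtain ⟨C, n, hC, hb⟩ := hφ.bound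
  refine ⟨K * C, n, mul_nonneg hK0 hC, fun x t hx hxt ht => ?_⟩
  have hfac : (1 : ℝ) ≤ k.factorial := by exact_mod_cast Nat.one_le_iff_ne_zero.2 k.factorial_ne_zero
  have h1 : 0 ≤ (t / x) ^ (1 / 4 : ℝ) * ell t ^ k :=
    mul_nonneg (Real.rpow_nonneg (div_nonneg (hx.le.trans hxt) hx.le) _)
      (pow_nonneg (ell_pos (hx.le.trans hxt) ht).le _)
  rw [norm_mul, norm_div, Complex.norm_natCast]
  calc ‖(logAlong γ t - logAlong γ x) ^ k‖ / k.factorial * ‖φ x‖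
      ≤ (K * ((t / x) ^ (1 / 4 : ℝ) * ell t ^ k)) * (C * densBound n x) := by
        refine mul_le_mul ?_ (hb x ⟨hx, hxt.trans_lt ht⟩) (norm_nonneg _) (mul_nonneg hK0 h1)
        exact (div_le_self (norm_nonneg _) hfac).trans (hK x t hx hxt ht)
    _ = K * C * convBound k n t x := by
        unfold convBound
        ring

theorem intervalIntegrable_log_pow_mul (hT : TamePath γ D S) (h0 : (0 : ℂ) ∈ D) {φ : ℝ → ℂ}
    (hφ : Dens S φ) (k : ℕ) {t : ℝ} (ht : t ∈ Ioo (0 : ℝ) 1) :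
    IntervalIntegrable
      (fun x => (logAlong γ t - logAlong γ x) ^ k / (k.factorial : ℂ) * φ x) volume 0 t := by
  obtain ⟨C, n, hC, hb⟩ := hT.norm_log_pow_mul_le h0 hφ k
  refine integrableOn_of_norm_le_convBound (C := C) (k := k) (n := n) ?_ ht
    fun x hx => hb x t hx.1 hx.2 ht.2
  have hL := (hT.isLogAlong_logAlong h0).1
  refine AEStronglyMeasurable.mul ?_ (hφ.aestronglyMeasurable hT.finite)
  exact (((continuousOn_const.sub hL).pow k).div_const _).aestronglyMeasurable measurableSet_Ioo

/-- Integration by parts against a power of the logarithm. -/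
theorem integral_log_pow_succ (hT : TamePath γ D S) (h0 : (0 : ℂ) ∈ D) {φ : ℝ → ℂ}
    (hφ : Dens S φ) (k : ℕ) {t : ℝ} (ht : t ∈ Ioo (0 : ℝ) 1) :
    prim (fun x => (logAlong γ t - logAlong γ x) ^ (k + 1) / ((k + 1).factorial : ℂ) * φ x) t =
      prim (fun x => (logAlong γ t - logAlong γ x) ^ k / (k.factorial : ℂ) *
        (form γ 0 x * prim φ x)) t := by
  have hL := hT.isLogAlong_logAlong h0
  have hΦ := hφ.amp_prim hT.finite
  have hi1 := hT.intervalIntegrable_log_pow_mul h0 hφ (k + 1) ht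
  have hi2 := hT.intervalIntegrable_log_pow_mul h0 (hT.dens_form_mul h0 hΦ) k ht
  have hsub : Ioc 0 t ⊆ Ioo 0 1 := fun x hx => ⟨hx.1, hx.2.trans_lt ht.2⟩
  obtain ⟨K, hK0, hK⟩ := hT.exists_norm_log_sub_pow_le h0 (k + 1)
  obtain ⟨C, n, hC, hb⟩ := hΦ.bound
  -- No boundary term survives. At `x = t` the power of the logarithm vanishes; at `x = 0` the
  -- primitive is of size `x^(1/2)` and the power of the logarithm at most of size `x^(-1/4)`, so
  -- their product is of size `x^(1/4)`.
  have key := prim_eq_of_hasDerivAt hT.finite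
    (g := fun x => (logAlong γ t - logAlong γ x) ^ (k + 1) / ((k + 1).factorial : ℂ) * prim φ x)
    (C := K * (t ^ (1 / 4 : ℝ) * ell t ^ (k + 1)) * (C * ell t ^ n)) ht.1
    ((((continuousOn_const.sub (hL.1.mono hsub)).pow (k + 1)).div_const _).mul
      (hΦ.continuousOn.mono hsub))
    (by simp only [prim_zero, mul_zero]) (fun x hx => ?_) (fun x hx hxS => ?_) (hi1.sub hi2)
  · simp only [sub_self, ne_eq, Nat.add_eq_zero_iff, one_ne_zero, and_false, not_false_eq_true,
      zero_pow, zero_div, zero_mul] at key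
    rw [prim, intervalIntegral.integral_sub hi1 hi2] at key
    exact sub_eq_zero.1 key
  · have hfac : (1 : ℝ) ≤ (k + 1).factorial := by
      exact_mod_cast Nat.one_le_iff_ne_zero.2 (k + 1).factorial_ne_zero
    have hx1 := hsub hx
    have htx : 0 ≤ t / x := div_nonneg ht.1.le hx.1.le
    have hell : 0 ≤ ell t := (ell_pos ht.1.le ht.2).le
    rw [norm_mul, norm_div, Complex.norm_natCast]
    calc ‖(logAlong γ t - logAlong γ x) ^ (k + 1)‖ / (k + 1).factorial * ‖prim φ x‖
        ≤ (K * ((t / x) ^ (1 / 4 : ℝ) * ell t ^ (k + 1))) * (C * ampBound n x) := by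
          refine mul_le_mul ?_ (hb x hx1) (norm_nonneg _) (by positivity)
          exact (div_le_self (norm_nonneg _) hfac).trans (hK x t hx.1 hx.2 ht.2)
      _ ≤ (K * ((t / x) ^ (1 / 4 : ℝ) * ell t ^ (k + 1))) *
          (C * (ell t ^ n * x ^ (1 / 2 : ℝ))) := by
          refine mul_le_mul_of_nonneg_left (mul_le_mul_of_nonneg_left ?_ hC) (by positivity)
          unfold ampBound
          rw [mul_comm]
          exact mul_le_mul_of_nonneg_right (pow_le_pow_left₀ (ell_pos hx1.1.le hx1.2).le
            (ell_le_ell hx.2 ht.2) _) (Real.rpow_nonneg hx.1.le _)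
      _ = _ := by
          rw [Real.div_rpow ht.1.le hx.1.le, show (1 / 2 : ℝ) = 1 / 4 + 1 / 4 by norm_num,
            Real.rpow_add hx.1]
          have : x ^ (1 / 4 : ℝ) ≠ 0 := (Real.rpow_pos_of_pos hx.1 _).ne'
          field_simp
  · have hx1 : x ∈ Ioo (0 : ℝ) 1 := ⟨hx.1, hx.2.trans ht.2⟩
    have e1 := (((hT.hasDerivAt_log hL h0 hx1 hxS).const_sub (logAlong γ t)).pow
      (k + 1)).div_const ((k + 1).factorial : ℂ)
    refine (e1.mul (hφ.hasDerivAt_prim hT.finite hx1 hxS)).congr_deriv ?_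
    have hk1 : ((k : ℂ) + 1) ≠ 0 := by exact_mod_cast Nat.succ_ne_zero k
    have hk2 : (k.factorial : ℂ) ≠ 0 := by exact_mod_cast k.factorial_ne_zero
    rw [Nat.factorial_succ]
    push_cast
    simp only [Pi.pow_apply]
    field_simp
    ring

/-- The density `φ ↦ (dγ / γ) ∫ φ`. -/
def logStep (γ : ℝ → ℂ) (φ : ℝ → ℂ) : ℝ → ℂ := fun x => form γ 0 x * prim φ x

/-- A convolution with a power of the logarithm is an iterated integral. -/
theorem integral_log_pow (hT : TamePath γ D S) (h0 : (0 : ℂ) ∈ D) {φ : ℝ → ℂ}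
    (hφ : Dens S φ) (k : ℕ) {t : ℝ} (ht : t ∈ Ioo (0 : ℝ) 1) :
    prim (fun x => (logAlong γ t - logAlong γ x) ^ k / (k.factorial : ℂ) * φ x) t =
      prim ((logStep γ)^[k] φ) t := by
  induction k generalizing φ with
  | zero => simp
  | succ k ih =>
    rw [hT.integral_log_pow_succ h0 hφ k ht, Function.iterate_succ_apply]
    exact ih (hT.dens_form_mul h0 (hφ.amp_prim hT.finite))

end TamePath

/-! ### Absolute convergence for a decorated rooted system -/

open Classical in
/-- The factor of the integrand at the index `v`, cut off to `0 < x < t < 1` (to `0 < x < 1` at the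
root). -/
def kernel {ι : Type*} (γ : ℝ → ℂ) (R : RootedSystem ι) (κ : ι → ℕ) (c : ι → ℂ) (v : ι)
    (x t : ℝ) : ℂ :=
  if 0 < x ∧ x < 1 ∧ (v ≠ R.root → x < t ∧ t < 1) then
    (logAlong γ t - logAlong γ x) ^ κ v / ((κ v).factorial : ℂ) * form γ (c v) x
  else 0

section

variable {ι : Type*} {γ : ℝ → ℂ} {D : Finset ℂ} {S : Set ℝ} {R : RootedSystem ι} {κ : ι → ℕ}
  {c : ι → ℂ}

theorem measurable_indicator_Ioo {f : ℝ → ℂ} (h : ContinuousOn f (Ioo 0 1)) :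
    Measurable ((Ioo (0 : ℝ) 1).indicator f) := by
  classical
  rw [← piecewise_eq_indicator]
  exact h.measurable_piecewise continuousOn_const measurableSet_Ioo

/-- Nothing is known about `γ` and `logAlong γ` outside `(0,1)`, so both are replaced by indicators.
At the root `t` is unrestricted, but the logarithm there has exponent `0`. -/
theorem TamePath.measurable_kernel (hT : TamePath γ D S) (h0 : (0 : ℂ) ∈ D)
    (hκ : κ R.root = 0) (v : ι) :
    Measurable fun z : ℝ × ℝ => kernel γ R κ c v z.1 z.2 := by
  classical
  have hL := measurable_indicator_Ioo (hT.isLogAlong_logAlong h0).1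
  have hγ := measurable_indicator_Ioo hT.continuousOn
  have hset : MeasurableSet
      {z : ℝ × ℝ | 0 < z.1 ∧ z.1 < 1 ∧ (v ≠ R.root → z.1 < z.2 ∧ z.2 < 1)} := by
    refine (measurableSet_lt measurable_const measurable_fst).inter
      ((measurableSet_lt measurable_fst measurable_const).inter ?_)
    by_cases hv : v = R.root
    · simp only [hv, ne_eq, not_true_eq_false, false_imp_iff]
      exact MeasurableSet.univ
    · simp only [ne_eq, hv, not_false_eq_true, forall_const]
      exact (measurableSet_lt measurable_fst measurable_snd).inter
        (measurableSet_lt measurable_snd measurable_const)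
  have hmeas : Measurable fun z : ℝ × ℝ =>
      if 0 < z.1 ∧ z.1 < 1 ∧ (v ≠ R.root → z.1 < z.2 ∧ z.2 < 1) then
        ((Ioo (0 : ℝ) 1).indicator (logAlong γ) z.2 -
          (Ioo (0 : ℝ) 1).indicator (logAlong γ) z.1) ^ κ v / ((κ v).factorial : ℂ) *
          (deriv γ z.1 / ((Ioo (0 : ℝ) 1).indicator γ z.1 - c v)) else 0 := by
    refine Measurable.ite hset ?_ measurable_const
    have hd := measurable_deriv γ
    refine (((hL.comp measurable_snd).sub (hL.comp measurable_fst)).pow_const _ |>.div_const _).mul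
      ((hd.comp measurable_fst).div ((hγ.comp measurable_fst).sub_const _))
  convert hmeas using 2 with z
  rw [kernel]
  split_ifs with h
  · have h1 : z.1 ∈ Ioo (0 : ℝ) 1 := ⟨h.1, h.2.1⟩
    rw [form, indicator_of_mem h1, indicator_of_mem h1]
    by_cases hv : v = R.root
    · rw [hv, hκ]
      simp
    · rw [indicator_of_mem (show z.2 ∈ Ioo (0 : ℝ) 1 from ⟨h.1.trans (h.2.2 hv).1, (h.2.2 hv).2⟩)]
  · rfl

theorem kernel_root (hκ : κ R.root = 0) (x t : ℝ) : kernel γ R κ c R.root x t =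
    (Ioo (0 : ℝ) 1).indicator (form γ (c R.root)) x := by
  classical
  rw [kernel, hκ, indicator_apply]
  simp

theorem kernel_of_ne {v : ι} (hv : v ≠ R.root) {t : ℝ} (ht : t ∈ Ioo (0 : ℝ) 1) (x : ℝ) :
    kernel γ R κ c v x t = (Ioo 0 t).indicator (fun x =>
      (logAlong γ t - logAlong γ x) ^ κ v / ((κ v).factorial : ℂ) * form γ (c v) x) x := by
  classical
  rw [kernel, indicator_apply]
  refine if_congr ?_ rfl rfl
  simp only [ne_eq, hv, not_false_eq_true, forall_const, mem_Ioo]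
  exact ⟨fun h => ⟨h.1, h.2.2.1⟩, fun h => ⟨h.1, h.2.trans ht.2, h.2, ht.2⟩⟩

theorem kernel_of_notMem {v : ι} (hv : v ≠ R.root) {t : ℝ} (ht : t ∉ Ioo (0 : ℝ) 1) (x : ℝ) :
    kernel γ R κ c v x t = 0 := by
  rw [kernel, if_neg]
  rintro ⟨h1, h2, h3⟩
  exact ht ⟨h1.trans (h3 hv).1, (h3 hv).2⟩

theorem exists_prod_le_ampBound (s : Finset ι) (hs : s.Nonempty) (A : ι → ℝ → ENNReal)
    (hA : ∀ u ∈ s, ∃ (C : ℝ) (n : ℕ), 0 ≤ C ∧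
      ∀ t ∈ Ioo (0 : ℝ) 1, A u t ≤ ENNReal.ofReal (C * ampBound n t)) :
    ∃ (C : ℝ) (n : ℕ), 0 ≤ C ∧
      ∀ t ∈ Ioo (0 : ℝ) 1, ∏ u ∈ s, A u t ≤ ENNReal.ofReal (C * ampBound n t) := by
  classical
  induction hs using Finset.Nonempty.cons_induction with
  | singleton a => simpa using hA a (by simp)
  | cons a s ha hs ih =>
    obtain ⟨C, n, hC, h1⟩ := hA a (by simp)
    obtain ⟨C', m, hC', h2⟩ := ih fun u hu => hA u (by simp [hu])
    refine ⟨C * C', n + m, mul_nonneg hC hC', fun t ht => ?_⟩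
    rw [Finset.prod_cons]
    refine (mul_le_mul' (h1 t ht) (h2 t ht)).trans ?_
    rw [← ENNReal.ofReal_mul (mul_nonneg hC (ampBound_nonneg n ht.1.le ht.2))]
    refine ENNReal.ofReal_le_ofReal ?_
    calc C * ampBound n t * (C' * ampBound m t)
        = C * C' * (ampBound n t * ampBound m t) := by ring
      _ ≤ C * C' * ampBound (n + m) t :=
        mul_le_mul_of_nonneg_left (ampBound_mul_le n m ht.1.le ht.2) (mul_nonneg hC hC')

theorem enorm_mul_le_ofReal {z : ℂ} {a : ENNReal} {r s : ℝ} (hz : ‖z‖ ≤ r)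
    (ha : a ≤ ENNReal.ofReal s) : ‖z‖ₑ * a ≤ ENNReal.ofReal (r * s) := by
  rw [ENNReal.ofReal_mul ((norm_nonneg z).trans hz), ← ofReal_norm]
  exact mul_le_mul' (ENNReal.ofReal_le_ofReal hz) ha

/-- With at least one factor in the product, its amplitude bound absorbs a possible pole at `0`;
with none, the form itself must have no pole there. -/
theorem TamePath.exists_form_mul_prod_le [Fintype ι] [DecidableEq ι] (hT : TamePath γ D S)
    {a : ℂ} (ha : a ∈ D) (s : Finset ι) (hs : s = ∅ → a ≠ γ 0) (A : ι → ℝ → ENNReal)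
    (hA : ∀ u ∈ s, ∃ (C : ℝ) (n : ℕ), 0 ≤ C ∧
      ∀ t ∈ Ioo (0 : ℝ) 1, A u t ≤ ENNReal.ofReal (C * ampBound n t)) :
    ∃ (C : ℝ) (n : ℕ), 0 ≤ C ∧
      ∀ x ∈ Ioo (0 : ℝ) 1, ‖form γ a x‖ₑ * ∏ u ∈ s, A u x ≤
        ENNReal.ofReal (C * densBound n x) := by
  rcases s.eq_empty_or_nonempty with rfl | hne
  · obtain ⟨C, n, hC, hb⟩ := (hT.dens_form ha (hs rfl)).bound
    refine ⟨C, n, hC, fun x hx => ?_⟩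
    rw [Finset.prod_empty, mul_one, ← ofReal_norm]
    exact ENNReal.ofReal_le_ofReal (hb x hx)
  · obtain ⟨K, hK0, hK⟩ := hT.bound a ha
    obtain ⟨C, n, hC, hb⟩ := exists_prod_le_ampBound s hne A hA
    refine ⟨K * C, n, mul_nonneg hK0 hC, fun x hx => ?_⟩
    refine (enorm_mul_le_ofReal (hK x hx) (hb x hx)).trans (le_of_eq ?_)
    rw [← inv_mul_inv_mul_ampBound n hx.1]
    ring_nf

/-- Without a pole at `1` the factor `(1 - x)⁻¹` disappears, which makes the bound integrable up to
`1`. For an empty product the form is bounded at both ends, and each half of the interval uses one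
of the two bounds. -/
theorem TamePath.exists_form_mul_prod_le_root [Fintype ι] [DecidableEq ι] (hT : TamePath γ D S)
    {a : ℂ} (ha : a ∈ D) (ha1 : a ≠ γ 1) (s : Finset ι) (hs : s = ∅ → a ≠ γ 0)
    (A : ι → ℝ → ENNReal)
    (hA : ∀ u ∈ s, ∃ (C : ℝ) (n : ℕ), 0 ≤ C ∧
      ∀ t ∈ Ioo (0 : ℝ) 1, A u t ≤ ENNReal.ofReal (C * ampBound n t)) :
    ∃ (C : ℝ) (n : ℕ),
      ∀ x ∈ Ioo (0 : ℝ) 1, ‖form γ a x‖ₑ * ∏ u ∈ s, A u x ≤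
        ENNReal.ofReal (C * (x ^ (-(1 / 2) : ℝ) * ell x ^ n)) := by
  obtain ⟨K, hK0, hK⟩ := hT.bound_target a ha ha1
  rcases s.eq_empty_or_nonempty with rfl | hne
  · obtain ⟨K', hK0', hK'⟩ := hT.bound_source a ha (hs rfl)
    refine ⟨2 * K + 2 * K', 0, fun x hx => ?_⟩
    rw [Finset.prod_empty, mul_one, ← ofReal_norm, pow_zero, mul_one]
    refine ENNReal.ofReal_le_ofReal (le_trans ?_ (le_mul_of_one_le_right (by positivity)
      (Real.one_le_rpow_of_pos_of_le_one_of_nonpos hx.1 hx.2.le (by norm_num))))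
    rcases le_total (1 / 2) x with h | h
    · have h1 : x⁻¹ ≤ 2 := by
        rw [inv_le_comm₀ hx.1 (by norm_num)]
        linarith
      nlinarith [hK x hx, mul_le_mul_of_nonneg_left h1 hK0]
    · have h1 : (1 - x)⁻¹ ≤ 2 := by
        rw [inv_le_comm₀ (by linarith) (by norm_num)]
        linarith
      nlinarith [hK' x hx, mul_le_mul_of_nonneg_left h1 hK0']
  · obtain ⟨C, n, hC, hb⟩ := exists_prod_le_ampBound s hne A hA
    refine ⟨K * C, n, fun x hx => ?_⟩
    refine (enorm_mul_le_ofReal (hK x hx) (hb x hx)).trans (le_of_eq ?_)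
    rw [← inv_mul_ampBound n hx.1]
    ring_nf

theorem TamePath.exists_lintegral_kernel_le [Fintype ι] [DecidableEq ι] (hT : TamePath γ D S)
    (h0 : (0 : ℂ) ∈ D) (hc : ∀ v, c v ∈ D) (hleaf : ∀ v, R.ch v = ∅ → c v ≠ γ 0)
    (A : ι → ℝ → ENNReal) {v : ι} (hv : v ≠ R.root)
    (hA : ∀ u ∈ R.ch v, ∃ (C : ℝ) (n : ℕ), 0 ≤ C ∧
      ∀ t ∈ Ioo (0 : ℝ) 1, A u t ≤ ENNReal.ofReal (C * ampBound n t)) :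
    ∃ (C : ℝ) (n : ℕ), 0 ≤ C ∧ ∀ t ∈ Ioo (0 : ℝ) 1,
      ∫⁻ x, ‖kernel γ R κ c v x t‖ₑ * ∏ u ∈ R.ch v, A u x ≤
        ENNReal.ofReal (C * ampBound n t) := by
  obtain ⟨C, n, hC, hb⟩ := hT.exists_form_mul_prod_le (hc v) (R.ch v) (hleaf v) A hA
  obtain ⟨K, hK0, hK⟩ := hT.exists_norm_log_sub_pow_le h0 (κ v)
  refine ⟨K * C * 4, n + κ v + 1, by positivity, fun t ht => ?_⟩
  have hfac : (1 : ℝ) ≤ (κ v).factorial := by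
    exact_mod_cast Nat.one_le_iff_ne_zero.2 (κ v).factorial_ne_zero
  have hpt : ∀ x, ‖kernel γ R κ c v x t‖ₑ * ∏ u ∈ R.ch v, A u x ≤
      (Ioc 0 t).indicator (fun x => ENNReal.ofReal (K * C * convBound (κ v) n t x)) x := by
    intro x
    rw [kernel_of_ne hv ht]
    by_cases hx : x ∈ Ioo 0 t
    · rw [indicator_of_mem hx, indicator_of_mem (Ioo_subset_Ioc_self hx), enorm_mul, mul_assoc]
      refine (enorm_mul_le_ofReal (r := K * ((t / x) ^ (1 / 4 : ℝ) * ell t ^ κ v)) ?_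
        (hb x ⟨hx.1, hx.2.trans ht.2⟩)).trans (le_of_eq ?_)
      · rw [norm_div, Complex.norm_natCast]
        exact (div_le_self (norm_nonneg _) hfac).trans (hK x t hx.1 hx.2.le ht.2)
      · unfold convBound
        ring_nf
    · rw [indicator_of_notMem hx]
      simp
  refine (lintegral_mono hpt).trans ?_
  rw [lintegral_indicator measurableSet_Ioc]
  obtain ⟨hi, hle⟩ := integrableOn_convBound (κ v) n ht.1 ht.2
  rw [← ofReal_integral_eq_lintegral_ofReal (hi.const_mul _)
    ((ae_restrict_iff' measurableSet_Ioc).2 (Eventually.of_forall fun x hx =>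
      mul_nonneg (mul_nonneg hK0 hC) (convBound_nonneg _ _ hx.1 hx.2 ht.2))), integral_const_mul]
  refine ENNReal.ofReal_le_ofReal ?_
  rw [mul_assoc (K * C)]
  exact mul_le_mul_of_nonneg_left hle (mul_nonneg hK0 hC)

/-- Tonelli reduces the integral of the norms to a recursion from the leaves. By induction each
function in it, away from the root, has the size of an amplitude, and the final integral at the root
is then finite. -/
theorem TamePath.integrable_prod_kernel [Fintype ι] [DecidableEq ι] (hT : TamePath γ D S)
    (h0 : (0 : ℂ) ∈ D) (hc : ∀ v, c v ∈ D) (hκ : κ R.root = 0)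
    (hleaf : ∀ v, R.ch v = ∅ → c v ≠ γ 0) (hroot : c R.root ≠ γ 1) :
    Integrable fun s : ι → ℝ => ∏ v, kernel γ R κ c v (s v) (s (R.par v)) := by
  -- `A v t` is the integral of the absolute values over `v` and everything below it, with upper
  -- limit `t`.
  obtain ⟨A, hA⟩ := R.exists_recursive (α := ℝ → ENNReal)
    (fun v A t => ∫⁻ x, ‖kernel γ R κ c v x t‖ₑ * ∏ u ∈ R.ch v, A u x) (fun v A A' h => by
      funext t
      refine lintegral_congr fun x => ?_
      congr 1
      exact Finset.prod_congr rfl fun u hu => by rw [h u hu])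
  have hbound : ∀ v, v ≠ R.root → ∃ (C : ℝ) (n : ℕ), 0 ≤ C ∧
      ∀ t ∈ Ioo (0 : ℝ) 1, A v t ≤ ENNReal.ofReal (C * ampBound n t) := by
    intro v
    induction v using R.induction_ch with
    | h v ih =>
      intro hv
      obtain ⟨C, n, hC, hb⟩ := hT.exists_lintegral_kernel_le (κ := κ) h0 hc hleaf A hv
        fun u hu => ih u hu (R.mem_ch.1 hu).1
      refine ⟨C, n, hC, fun t ht => ?_⟩
      rw [hA v]
      exact hb t ht
  have hmeas := fun v => hT.measurable_kernel (R := R) (κ := κ) (c := c) h0 hκ v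
  have htot := R.lintegral_prod_eq (fun v x t => ‖kernel γ R κ c v x t‖ₑ) A
    (fun v => (hmeas v).enorm) (fun x t t' => by simp only [kernel_root hκ])
    (fun v t => congrFun (hA v) t) 0
  refine ⟨?_, ?_⟩
  · refine Measurable.aestronglyMeasurable (Finset.measurable_prod _ fun v _ => ?_)
    exact (hmeas v).comp (by fun_prop : Measurable fun s : ι → ℝ => (s v, s (R.par v)))
  · rw [hasFiniteIntegral_iff_enorm]
    have he : ∀ s : ι → ℝ, ‖∏ v, kernel γ R κ c v (s v) (s (R.par v))‖ₑ =
        ∏ v, ‖kernel γ R κ c v (s v) (s (R.par v))‖ₑ := fun s => by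
      simp only [← ofReal_norm, norm_prod]
      exact ENNReal.ofReal_prod_of_nonneg fun _ _ => norm_nonneg _
    simp only [he]
    rw [htot, hA]
    obtain ⟨C, n, hb⟩ := hT.exists_form_mul_prod_le_root (hc R.root) hroot (R.ch R.root)
      (hleaf R.root) A fun u hu => hbound u (R.mem_ch.1 hu).1
    have hpt : ∀ x, ‖kernel γ R κ c R.root x 0‖ₑ * ∏ u ∈ R.ch R.root, A u x ≤
        (Ioo 0 1).indicator
          (fun x => ENNReal.ofReal (C * (x ^ (-(1 / 2) : ℝ) * ell x ^ n))) x := by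
      intro x
      rw [kernel_root hκ]
      by_cases hx : x ∈ Ioo (0 : ℝ) 1
      · rw [indicator_of_mem hx, indicator_of_mem hx]
        exact hb x hx
      · rw [indicator_of_notMem hx]
        simp
    refine (lintegral_mono hpt).trans_lt ?_
    rw [lintegral_indicator measurableSet_Ioo]
    exact ((integrableOn_rpow_mul_ell_pow n).const_mul C).lintegral_lt_top

end

/-! ### Iterated integrals of words -/

/-- The iterated integral from `0` to `t` of the word with the given letters, read from the last
letter to the first. -/
def iter (γ : ℝ → ℂ) : List ℂ → ℝ → ℂ
  | [] => fun _ => 1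
  | a :: l => prim fun x => form γ a x * iter γ l x

/-- The words, read from the last letter to the first, with letters in `D` and with a first letter
different from `γ 0`. -/
def AdmRev (γ : ℝ → ℂ) (D : Finset ℂ) : List ℂ → Prop
  | [] => True
  | a :: l => a ∈ D ∧ AdmRev γ D l ∧ (l = [] → a ≠ γ 0)

/-- The word with the given letters, read from the last letter to the first. -/
def wordRev (l : List ℂ) : WordAlg := MonoidAlgebra.of ℚ (FreeMonoid ℂ) (FreeMonoid.ofList l.reverse)

theorem wordRev_cons (a : ℂ) (l : List ℂ) : wordRev (a :: l) = wordRev l * e a := by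
  rw [wordRev, wordRev, e, ← map_mul, List.reverse_cons, FreeMonoid.ofList_append,
    FreeMonoid.ofList_singleton]

theorem wordRev_nil : wordRev [] = 1 := map_one _

theorem wordRev_singleton (a : ℂ) : wordRev [a] = e a := by
  rw [wordRev_cons, wordRev_nil, one_mul]

theorem shuffle_wordRev (l l' : List ℂ) : shuffle (wordRev l) (wordRev l') = shuffleRev l l' := by
  have h : ∀ l : List ℂ, wordRev l =
      MonoidAlgebra.basis (FreeMonoid ℂ) ℚ (FreeMonoid.ofList l.reverse) := fun l => by
    rw [wordRev, MonoidAlgebra.basis_apply, MonoidAlgebra.of_apply]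
  rw [h l, h l', shuffle, Module.Basis.constr_basis, Module.Basis.constr_basis]
  simp

theorem shuffleRev_nil_left (l : List ℂ) : shuffleRev [] l = wordRev l := by
  rw [shuffleRev, wordRev]

theorem shuffleRev_nil_right (l : List ℂ) : shuffleRev l [] = wordRev l := by
  cases l <;> rw [shuffleRev, wordRev]

/-- The iterated integral from `0` to `t` as a linear map. -/
def iterLin (γ : ℝ → ℂ) (t : ℝ) : WordAlg →ₗ[ℚ] ℂ :=
  (MonoidAlgebra.basis (FreeMonoid ℂ) ℚ).constr ℚ fun u => iter γ u.toList.reverse t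

theorem iterLin_wordRev (γ : ℝ → ℂ) (t : ℝ) (l : List ℂ) :
    iterLin γ t (wordRev l) = iter γ l t := by
  rw [wordRev, MonoidAlgebra.of_apply, ← MonoidAlgebra.basis_apply, iterLin,
    Module.Basis.constr_basis]
  simp

theorem iterLin_one (γ : ℝ → ℂ) (t : ℝ) : iterLin γ t 1 = 1 := by
  rw [← wordRev_nil, iterLin_wordRev, iter]

/-- The span of the non-empty words with letters in `D` whose first letter is not `γ 0`. -/
def admWords (γ : ℝ → ℂ) (D : Finset ℂ) : Submodule ℚ WordAlg :=
  Submodule.span ℚ {w | ∃ l, l ≠ [] ∧ AdmRev γ D l ∧ wordRev l = w}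

theorem wordRev_mem {γ : ℝ → ℂ} {D : Finset ℂ} {l : List ℂ} (hl : l ≠ []) (h : AdmRev γ D l) :
    wordRev l ∈ admWords γ D :=
  Submodule.subset_span ⟨l, hl, h, rfl⟩

theorem mul_e_mem {γ : ℝ → ℂ} {D : Finset ℂ} {x : WordAlg} (hx : x ∈ admWords γ D) {a : ℂ}
    (ha : a ∈ D) : x * e a ∈ admWords γ D := by
  induction hx using Submodule.span_induction with
  | mem x h =>
    obtain ⟨l, hl, hl', rfl⟩ := h
    rw [← wordRev_cons]
    exact wordRev_mem (by simp) ⟨ha, hl', fun h => absurd h hl⟩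
  | zero => simp
  | add x y _ _ hx hy =>
    rw [add_mul]
    exact add_mem hx hy
  | smul c x _ hx =>
    rw [smul_mul_assoc]
    exact Submodule.smul_mem _ _ hx

section

variable {γ : ℝ → ℂ} {D : Finset ℂ} {S : Set ℝ}

theorem amp_zero : Amp fun _ => 0 :=
  ⟨⟨0, 0, le_rfl, fun x _ => by simp⟩, continuousOn_const, rfl⟩

/-- The innermost integration is the only one with no amplitude to absorb a pole at `0`; this is why
only the first letter of the word is restricted. -/
theorem TamePath.dens_form_mul_iter (hT : TamePath γ D S) {a : ℂ} {l : List ℂ}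
    (h : AdmRev γ D (a :: l)) : Dens S fun x => form γ a x * iter γ l x := by
  induction l generalizing a with
  | nil => simpa only [iter, mul_one] using hT.dens_form h.1 (h.2.2 rfl)
  | cons b l ih => exact hT.dens_form_mul h.1 ((ih h.2.1).amp_prim hT.finite)

theorem TamePath.amp_iter (hT : TamePath γ D S) {l : List ℂ} (hl : l ≠ []) (h : AdmRev γ D l) :
    Amp (iter γ l) := by
  cases l with
  | nil => exact absurd rfl hl
  | cons a l => exact (hT.dens_form_mul_iter h).amp_prim hT.finite

theorem TamePath.amp_iterLin (hT : TamePath γ D S) {x : WordAlg} (hx : x ∈ admWords γ D) :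
    Amp fun t => iterLin γ t x := by
  induction hx using Submodule.span_induction with
  | mem x h =>
    obtain ⟨l, hl, hl', rfl⟩ := h
    simpa only [iterLin_wordRev] using hT.amp_iter hl hl'
  | zero => simpa only [map_zero] using amp_zero
  | add x y _ _ hx hy => simpa only [map_add] using hx.add hy
  | smul c x _ hx =>
    simp only [map_smul]
    simpa only [Algebra.smul_def] using hx.const_mul (algebraMap ℚ ℂ c)

/-- Appending a letter to a combination of words, for any upper limit for which the relevant
integrals converge. -/
theorem iterLin_mul_e_of_integrable {x : WordAlg} (hx : x ∈ admWords γ D) (a : ℂ) (t : ℝ)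
    (hi : ∀ y ∈ admWords γ D, IntervalIntegrable (fun s => form γ a s * iterLin γ s y) volume 0 t) :
    iterLin γ t (x * e a) = prim (fun s => form γ a s * iterLin γ s x) t := by
  induction hx using Submodule.span_induction with
  | mem x h =>
    obtain ⟨l, hl, hl', rfl⟩ := h
    rw [← wordRev_cons, iterLin_wordRev, iter]
    simp only [iterLin_wordRev]
  | zero => simp [prim]
  | add x y hx hy ihx ihy =>
    rw [add_mul, map_add, ihx, ihy, prim, prim, prim,
      ← intervalIntegral.integral_add (hi x hx) (hi y hy)]
    simp only [map_add, mul_add]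
  | smul c x _ ih =>
    rw [smul_mul_assoc, map_smul, ih, prim, prim, ← intervalIntegral.integral_smul]
    simp only [map_smul, mul_smul_comm]

theorem TamePath.iterLin_mul_e (hT : TamePath γ D S) {x : WordAlg} (hx : x ∈ admWords γ D) {a : ℂ}
    (ha : a ∈ D) {t : ℝ} (ht : t ∈ Ioo (0 : ℝ) 1) :
    iterLin γ t (x * e a) = prim (fun s => form γ a s * iterLin γ s x) t :=
  iterLin_mul_e_of_integrable hx a t fun _ hy =>
    (hT.dens_form_mul ha (hT.amp_iterLin hy)).intervalIntegrable hT.finite ht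

/-- The recursion defining the shuffle product is the product rule for two primitives, split
according to which of the two outermost variables is larger. Non-emptiness is tracked because the
empty word gives the constant `1`, which is not an amplitude. -/
theorem TamePath.shuffleRev_spec (hT : TamePath γ D S) (l l' : List ℂ) (hl : AdmRev γ D l)
    (hl' : AdmRev γ D l') : (l ≠ [] ∨ l' ≠ [] → shuffleRev l l' ∈ admWords γ D) ∧
      ∀ t ∈ Ioo (0 : ℝ) 1, iterLin γ t (shuffleRev l l') = iter γ l t * iter γ l' t := by
  match l, l', hl, hl' with
  | [], l', _, hl' =>
    rw [shuffleRev_nil_left]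
    exact ⟨fun h => wordRev_mem (by simpa using h) hl', fun t _ => by
      rw [iterLin_wordRev, iter, one_mul]⟩
  | a :: l, [], hl, _ =>
    rw [shuffleRev_nil_right]
    exact ⟨fun h => wordRev_mem (by simp) hl, fun t _ => by
      rw [iterLin_wordRev, iter, iter, mul_one]⟩
  | a :: l, b :: l', hl, hl' =>
    obtain ⟨m1, i1⟩ := hT.shuffleRev_spec (a :: l) l' hl hl'.2.1
    obtain ⟨m2, i2⟩ := hT.shuffleRev_spec l (b :: l') hl.2.1 hl'
    have m1' := m1 (by simp)
    have m2' := m2 (by simp)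
    rw [shuffleRev]
    refine ⟨fun _ => add_mem (mul_e_mem m1' hl'.1) (mul_e_mem m2' hl.1), fun t ht => ?_⟩
    rw [map_add, hT.iterLin_mul_e m1' hl'.1 ht, hT.iterLin_mul_e m2' hl.1 ht, iter, iter,
      prim_mul_prim hT.finite (hT.dens_form_mul_iter hl) (hT.dens_form_mul_iter hl') ht, add_comm]
    congr 1
    · refine prim_congr ht fun x hx => ?_
      rw [i2 x hx, mul_assoc, iter]
    · refine prim_congr ht fun x hx => ?_
      rw [i1 x hx, iter]
      ring
termination_by l.length + l'.length

theorem TamePath.shuffle_mem (hT : TamePath γ D S) {x y : WordAlg} (hx : x ∈ admWords γ D)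
    (hy : y ∈ admWords γ D) : shuffle x y ∈ admWords γ D := by
  induction hx, hy using Submodule.span_induction₂ with
  | mem_mem x y h h' =>
    obtain ⟨l, hl, hl', rfl⟩ := h
    obtain ⟨m, hm, hm', rfl⟩ := h'
    rw [shuffle_wordRev]
    exact (hT.shuffleRev_spec l m hl' hm').1 (Or.inl hl)
  | zero_left y _ => simp
  | zero_right x _ => simp
  | add_left x y z _ _ _ h1 h2 =>
    rw [map_add, LinearMap.add_apply]
    exact add_mem h1 h2
  | add_right x y z _ _ _ h1 h2 =>
    rw [map_add]
    exact add_mem h1 h2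
  | smul_left r x y _ _ h =>
    rw [map_smul, LinearMap.smul_apply]
    exact Submodule.smul_mem _ _ h
  | smul_right r x y _ _ h =>
    rw [map_smul]
    exact Submodule.smul_mem _ _ h

/-- Iterated integrals turn shuffle products into products. -/
theorem TamePath.iterLin_shuffle (hT : TamePath γ D S) {x y : WordAlg} (hx : x ∈ admWords γ D)
    (hy : y ∈ admWords γ D) {t : ℝ} (ht : t ∈ Ioo (0 : ℝ) 1) :
    iterLin γ t (shuffle x y) = iterLin γ t x * iterLin γ t y := by
  induction hx, hy using Submodule.span_induction₂ with
  | mem_mem x y h h' =>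
    obtain ⟨l, hl, hl', rfl⟩ := h
    obtain ⟨m, hm, hm', rfl⟩ := h'
    rw [shuffle_wordRev, iterLin_wordRev, iterLin_wordRev]
    exact (hT.shuffleRev_spec l m hl' hm').2 t ht
  | zero_left y _ => simp
  | zero_right x _ => simp
  | add_left x y z _ _ _ h1 h2 =>
    rw [map_add, LinearMap.add_apply, map_add, h1, h2, map_add, add_mul]
  | add_right x y z _ _ _ h1 h2 => rw [map_add, map_add, h1, h2, map_add, mul_add]
  | smul_left r x y _ _ h =>
    rw [map_smul, LinearMap.smul_apply, map_smul, h, map_smul, smul_mul_assoc]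
  | smul_right r x y _ _ h => rw [map_smul, map_smul, h, map_smul, mul_smul_comm]

theorem shuffle_one {x : WordAlg} (hx : x ∈ admWords γ D) : shuffle x 1 = x := by
  induction hx using Submodule.span_induction with
  | mem x h =>
    obtain ⟨l, hl, hl', rfl⟩ := h
    rw [← wordRev_nil, shuffle_wordRev, shuffleRev_nil_right]
  | zero => simp
  | add x y _ _ hx hy => rw [map_add, LinearMap.add_apply, hx, hy]
  | smul c x _ hx => rw [map_smul, LinearMap.smul_apply, hx]

theorem TamePath.shuffleList_mem (hT : TamePath γ D S) {l : List WordAlg} (hl : l ≠ [])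
    (h : ∀ x ∈ l, x ∈ admWords γ D) : shuffleList l ∈ admWords γ D := by
  induction l with
  | nil => exact absurd rfl hl
  | cons x l ih =>
    have hx := h x (by simp)
    rw [shuffleList, List.foldr_cons]
    rcases l.eq_nil_or_concat with rfl | ⟨l', y, rfl⟩
    · rw [List.foldr_nil, shuffle_one hx]
      exact hx
    · exact hT.shuffle_mem hx (ih (by simp) fun y hy => h y (List.mem_cons_of_mem _ hy))

theorem TamePath.iterLin_shuffleList (hT : TamePath γ D S) {l : List WordAlg}
    (h : ∀ x ∈ l, x ∈ admWords γ D) {t : ℝ} (ht : t ∈ Ioo (0 : ℝ) 1) :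
    iterLin γ t (shuffleList l) = (l.map (iterLin γ t)).prod := by
  induction l with
  | nil => rw [shuffleList, List.foldr_nil, iterLin_one, List.map_nil, List.prod_nil]
  | cons x l ih =>
    have hx := h x (by simp)
    have h' : ∀ y ∈ l, y ∈ admWords γ D := fun y hy => h y (List.mem_cons_of_mem _ hy)
    rw [List.map_cons, List.prod_cons, ← ih h']
    rcases eq_or_ne l [] with rfl | hl
    · rw [shuffleList, List.foldr_cons, shuffleList, List.foldr_nil, shuffle_one hx, iterLin_one,
        mul_one]
    · exact hT.iterLin_shuffle hx (hT.shuffleList_mem hl h') ht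

theorem mul_pow_mem (h0 : (0 : ℂ) ∈ D) {y : WordAlg} (hy : y ∈ admWords γ D) (k : ℕ) :
    y * e 0 ^ k ∈ admWords γ D := by
  induction k with
  | zero => simpa using hy
  | succ k ih =>
    rw [pow_succ, ← mul_assoc]
    exact mul_e_mem ih h0

/-- The iterated integral of `y e_0 ^ k` as a convolution with a power of the logarithm. -/
theorem TamePath.iterLin_mul_pow (hT : TamePath γ D S) (h0 : (0 : ℂ) ∈ D) {y : WordAlg}
    (hy : y ∈ admWords γ D) {φ : ℝ → ℂ} (hφ : Dens S φ)
    (hyφ : ∀ t ∈ Ioo (0 : ℝ) 1, iterLin γ t y = prim φ t) (k : ℕ) {t : ℝ}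
    (ht : t ∈ Ioo (0 : ℝ) 1) :
    iterLin γ t (y * e 0 ^ k) =
      prim (fun x => (logAlong γ t - logAlong γ x) ^ k / (k.factorial : ℂ) * φ x) t := by
  rw [hT.integral_log_pow h0 hφ k ht]
  induction k generalizing t with
  | zero => simpa using hyφ t ht
  | succ k ih =>
    rw [pow_succ, ← mul_assoc, hT.iterLin_mul_e (mul_pow_mem h0 hy k) h0 ht,
      Function.iterate_succ_apply']
    refine prim_congr ht fun x hx => ?_
    rw [ih hx, TamePath.logStep]

end

/-! ### The cut-off integral of a convergent word -/

/-- The indices `0, …, n - 1`, each with its successor as parent. -/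
def chain (n : ℕ) (hn : 0 < n) : RootedSystem (Fin n) where
  root := ⟨n - 1, by omega⟩
  par i := if h : i.1 + 1 < n then ⟨i.1 + 1, h⟩ else i
  depth i := n - i.1
  par_root := by
    rw [dif_neg]
    simp only
    omega
  depth_par i hi := by
    have h : i.1 + 1 < n := by
      by_contra h
      exact hi (Fin.ext (by simp only; omega))
    rw [dif_pos h]
    simp only
    omega

theorem chain_ne_root_iff {n : ℕ} (hn : 0 < n) (i : Fin n) :
    i ≠ (chain n hn).root ↔ i.1 + 1 < n := by
  rw [ne_eq, Fin.ext_iff]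
  simp only [chain]
  omega

theorem chain_par {n : ℕ} (hn : 0 < n) {i : Fin n} (h : i.1 + 1 < n) :
    (chain n hn).par i = ⟨i.1 + 1, h⟩ := by
  simp only [chain]
  rw [dif_pos h]

theorem chain_mem_ch {n : ℕ} (hn : 0 < n) (i j : Fin n) :
    j ∈ (chain n hn).ch i ↔ j.1 + 1 = i.1 := by
  rw [RootedSystem.mem_ch, chain_ne_root_iff]
  constructor
  · rintro ⟨h1, h2⟩
    rw [chain_par hn h1] at h2
    exact congrArg Fin.val h2
  · intro h
    have h1 : j.1 + 1 < n := by omega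
    exact ⟨h1, by rw [chain_par hn h1]; exact Fin.ext h⟩

theorem strictMono_of_lt_succ {n : ℕ} (s : Fin n → ℝ)
    (h : ∀ (i : ℕ) (hi : i + 1 < n), s ⟨i, by omega⟩ < s ⟨i + 1, hi⟩) : StrictMono s := by
  cases n with
  | zero => exact fun i => i.elim0
  | succ n => exact Fin.strictMono_iff_lt_succ.2 fun i => h i.1 (by omega)

section

variable {γ : ℝ → ℂ} {D : Finset ℂ} {S : Set ℝ}

theorem AdmRev.mem {l : List ℂ} (h : AdmRev γ D l) {a : ℂ} (ha : a ∈ l) : a ∈ D := by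
  induction l with
  | nil => simp at ha
  | cons b l ih =>
    rcases List.mem_cons.1 ha with rfl | ha
    · exact h.1
    · exact ih h.2.1 ha

theorem AdmRev.getLast_ne {l : List ℂ} (h : AdmRev γ D l) (hl : l ≠ []) : l.getLast hl ≠ γ 0 := by
  induction l with
  | nil => exact absurd rfl hl
  | cons b l ih =>
    rcases eq_or_ne l [] with rfl | hl'
    · exact h.2.2 rfl
    · rw [List.getLast_cons hl']
      exact ih h.2.1 hl'

open Classical in
-- A non-zero product forces the cut-off condition at every index, and along a chain these
-- conditions together say that the coordinates increase inside `(0,1)`.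
theorem prod_kernel_chain {a : List ℂ} (hn : 0 < a.length) (s : Fin a.length → ℝ) :
    ∏ i, kernel γ (chain a.length hn) (fun _ => 0) a.get i (s i) (s ((chain a.length hn).par i)) =
      if StrictMono s ∧ ∀ i, s i ∈ Ioo (0 : ℝ) 1 then ∏ i, form γ (a.get i) (s i) else 0 := by
  split_ifs with h
  · refine Finset.prod_congr rfl fun i _ => ?_
    rw [kernel, if_pos]
    · simp
    · refine ⟨(h.2 i).1, (h.2 i).2, fun hi => ?_⟩
      rw [chain_ne_root_iff] at hi
      rw [chain_par hn hi]
      exact ⟨h.1 (Fin.mk_lt_mk.2 (Nat.lt_succ_self _)), (h.2 _).2⟩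
  · by_contra hne
    have hne' : ∀ i, kernel γ (chain a.length hn) (fun _ => 0) a.get i (s i)
        (s ((chain a.length hn).par i)) ≠ 0 := fun i => by
      have := Finset.prod_ne_zero_iff.1 hne i (Finset.mem_univ i)
      exact this
    have hcond : ∀ i, 0 < s i ∧ s i < 1 ∧ (i ≠ (chain a.length hn).root →
        s i < s ((chain a.length hn).par i) ∧ s ((chain a.length hn).par i) < 1) := by
      intro i
      by_contra hcon
      exact hne' i (by rw [kernel, if_neg hcon])
    refine h ⟨strictMono_of_lt_succ s fun i hi => ?_, fun i => ⟨(hcond i).1, (hcond i).2.1⟩⟩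
    have h1 := ((hcond ⟨i, by omega⟩).2.2 ((chain_ne_root_iff hn _).2 hi)).1
    rwa [chain_par hn (i := ⟨i, by omega⟩) hi] at h1

theorem take_succ_reverse {a : List ℂ} (i : Fin a.length) :
    (a.take (i.1 + 1)).reverse = a.get i :: (a.take i.1).reverse := by
  rw [List.take_succ_eq_append_getElem i.2, List.reverse_append]
  rfl

/-- The only childless index of the chain is `0`, the first letter of the word, and its root is the
last letter. So admissibility and `hlast` are what the convergence of a rooted system asks for. -/
theorem integrable_chain (hT : TamePath γ D S) (h0 : (0 : ℂ) ∈ D) {a : List ℂ}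
    (hn : 0 < a.length) (hadm : AdmRev γ D a.reverse)
    (hlast : a.get ⟨a.length - 1, by omega⟩ ≠ γ 1) :
    Integrable fun s : Fin a.length → ℝ =>
      ∏ i, kernel γ (chain a.length hn) (fun _ => 0) a.get i (s i)
        (s ((chain a.length hn).par i)) := by
  refine hT.integrable_prod_kernel h0 (fun v => hadm.mem (by simp)) rfl (fun v hv => ?_) hlast
  have hv0 : v.1 = 0 := by
    by_contra hne
    have : (⟨v.1 - 1, by omega⟩ : Fin a.length) ∈ (chain a.length hn).ch v := by
      rw [chain_mem_ch]
      simp only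
      omega
    rw [hv] at this
    simp at this
  have hne : a.reverse ≠ [] := by
    intro h
    simp only [List.reverse_eq_nil_iff] at h
    simp [h] at hn
  have h1 := hadm.getLast_ne hne
  have h2 : v = ⟨0, hn⟩ := Fin.ext hv0
  rw [List.getLast_reverse, List.head_eq_getElem] at h1
  rw [h2]
  exact h1

theorem integral_chain (hT : TamePath γ D S) (h0 : (0 : ℂ) ∈ D) {a : List ℂ}
    (hn : 0 < a.length) (hadm : AdmRev γ D a.reverse)
    (hlast : a.get ⟨a.length - 1, by omega⟩ ≠ γ 1) :
    ∫ s : Fin a.length → ℝ, ∏ i, kernel γ (chain a.length hn) (fun _ => 0) a.get i (s i)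
      (s ((chain a.length hn).par i)) = iter γ a.reverse 1 := by
  classical
  set R := chain a.length hn with hR
  -- Each index carries the iterated integral of the initial segment ending there. It is set to `0`
  -- outside `(0,1)`, where the kernel vanishes; at the root the upper limit is `1` for every `t`.
  set F : Fin a.length → ℝ → ℂ := fun i t =>
    if i = R.root then iter γ a.reverse 1
    else (Ioo (0 : ℝ) 1).indicator (iter γ (a.take (i.1 + 1)).reverse) t with hF
  have hprod : ∀ (i : Fin a.length), ∀ x ∈ Ioo (0 : ℝ) 1,
      ∏ u ∈ R.ch i, F u x = iter γ (a.take i.1).reverse x := by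
    intro i x hx
    rcases Nat.eq_zero_or_pos i.1 with hi | hi
    · have : R.ch i = ∅ := by
        ext j
        rw [hR, chain_mem_ch, hi]
        simp
      rw [this, hi]
      simp [iter]
    · have : R.ch i = {⟨i.1 - 1, by omega⟩} := by
        ext j
        rw [hR, chain_mem_ch, Finset.mem_singleton, Fin.ext_iff]
        simp only
        omega
      rw [this, Finset.prod_singleton]
      simp only [hF]
      rw [if_neg ((chain_ne_root_iff hn _).2 (by simp only; omega)), indicator_of_mem hx]
      congr 3
      omega
  have := R.integral_prod_eq (kernel γ R (fun _ => 0) a.get) F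
    (integrable_chain hT h0 hn hadm hlast) (fun x t t' => by simp only [kernel_root]) ?_ 0
  · rw [this]
    simp only [hF, if_true]
  · intro i t
    by_cases hi : i = R.root
    · rw [show F i t = iter γ a.reverse 1 by simp only [hF]; rw [if_pos hi], hi]
      have hlen : a.reverse = a.get R.root :: (a.take R.root.1).reverse := by
        rw [← take_succ_reverse, List.take_of_length_le]
        simp only [hR, chain]
        omega
      rw [hlen, iter, prim, intervalIntegral.integral_of_le zero_le_one,
        integral_Ioc_eq_integral_Ioo, ← integral_indicator measurableSet_Ioo]
      refine integral_congr_ae (Eventually.of_forall fun x => ?_)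
      simp only
      rw [kernel_root rfl]
      by_cases hx : x ∈ Ioo (0 : ℝ) 1
      · rw [indicator_of_mem hx, indicator_of_mem hx]
        congr 1
        exact (hprod _ x hx).symm
      · rw [indicator_of_notMem hx, indicator_of_notMem hx, zero_mul]
    · by_cases ht : t ∈ Ioo (0 : ℝ) 1
      · simp only [kernel_of_ne hi ht]
        rw [show F i t = iter γ (a.take (i.1 + 1)).reverse t by
          simp only [hF]; rw [if_neg hi, indicator_of_mem ht]]
        rw [take_succ_reverse, iter, prim, intervalIntegral.integral_of_le ht.1.le,
          integral_Ioc_eq_integral_Ioo, ← integral_indicator measurableSet_Ioo]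
        refine integral_congr_ae (Eventually.of_forall fun x => ?_)
        simp only
        by_cases hx : x ∈ Ioo 0 t
        · rw [indicator_of_mem hx, indicator_of_mem hx, hprod i x ⟨hx.1, hx.2.trans ht.2⟩]
          simp
        · rw [indicator_of_notMem hx, indicator_of_notMem hx, zero_mul]
      · simp only [kernel_of_notMem hi ht, zero_mul, integral_zero]
        simp only [hF]
        rw [if_neg hi, indicator_of_notMem ht]

theorem measurableSet_strictMono (n : ℕ) : MeasurableSet {s : Fin n → ℝ | StrictMono s} := by
  have : {s : Fin n → ℝ | StrictMono s} = ⋂ (i) (j) (_ : i < j), {s | s i < s j} := by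
    ext s
    simp only [mem_ofPred_eq, mem_iInter]
    exact Iff.rfl
  rw [this]
  exact MeasurableSet.iInter fun i => MeasurableSet.iInter fun j => MeasurableSet.iInter fun _ =>
    measurableSet_lt (measurable_pi_apply i) (measurable_pi_apply j)

/-- The cut-off integral of a convergent word tends to its iterated integral. -/
theorem tendsto_cutoffIntegral (hT : TamePath γ D S) (h0 : (0 : ℂ) ∈ D) {a : List ℂ}
    (hn : 0 < a.length) (hadm : AdmRev γ D a.reverse)
    (hlast : a.get ⟨a.length - 1, by omega⟩ ≠ γ 1) :
    Tendsto (cutoffIntegral γ a) (𝓝[>] 0) (𝓝 (iter γ a.reverse 1)) := by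
  classical
  have hint := integrable_chain hT h0 hn hadm hlast
  rw [← integral_chain hT h0 hn hadm hlast]
  set G : (Fin a.length → ℝ) → ℂ := fun s => ∏ i, kernel γ (chain a.length hn) (fun _ => 0) a.get i
    (s i) (s ((chain a.length hn).par i)) with hG
  have hGdef : ∀ s, G s = if StrictMono s ∧ ∀ i, s i ∈ Ioo (0 : ℝ) 1
      then ∏ i, form γ (a.get i) (s i) else 0 := fun s => prod_kernel_chain hn s
  set cut : ℝ → Set (Fin a.length → ℝ) :=
    fun z => {t | StrictMono t ∧ ∀ i, t i ∈ Ioo z (1 - z)} with hcut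
  have hmeas : ∀ z, MeasurableSet (cut z) := by
    intro z
    have : {t : Fin a.length → ℝ | ∀ i, t i ∈ Ioo z (1 - z)} =
        ⋂ i, {t | t i ∈ Ioo z (1 - z)} := by
      ext t
      simp
    refine (measurableSet_strictMono _).inter (s₂ := {t | ∀ i, t i ∈ Ioo z (1 - z)}) ?_
    rw [this]
    exact MeasurableSet.iInter fun i => measurable_pi_apply i measurableSet_Ioo
  have hcutG : ∀ z, 0 < z → cutoffIntegral γ a z = ∫ s, (cut z).indicator G s := by
    intro z hz
    rw [integral_indicator (hmeas z)]
    refine setIntegral_congr_fun (hmeas z) fun s hs => ?_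
    rw [hGdef, if_pos ⟨hs.1, fun i => ⟨hz.trans (hs.2 i).1, (hs.2 i).2.trans (by linarith)⟩⟩]
    rfl
  have hlim : Tendsto (fun z => ∫ s, (cut z).indicator G s) (𝓝[>] 0) (𝓝 (∫ s, G s)) := by
    -- The function `‖G‖` dominates, and a point of the open simplex lies in the cut-off domain for
    -- all sufficiently small `z`.
    refine tendsto_integral_filter_of_dominated_convergence (fun s => ‖G s‖) ?_ ?_ hint.norm ?_
    · exact Eventually.of_forall fun z => hint.aestronglyMeasurable.indicator (hmeas z)
    · exact Eventually.of_forall fun z => Eventually.of_forall fun s => norm_indicator_le_norm_self _ _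
    · refine Eventually.of_forall fun s => ?_
      by_cases hs : StrictMono s ∧ ∀ i, s i ∈ Ioo (0 : ℝ) 1
      · have hev : ∀ᶠ z in 𝓝[>] (0 : ℝ), ∀ i, s i ∈ Ioo z (1 - z) := by
          rw [eventually_all]
          intro i
          have h1 : (0 : ℝ) < min (s i) (1 - s i) :=
            lt_min (hs.2 i).1 (by linarith [(hs.2 i).2])
          filter_upwards [Ioo_mem_nhdsGT h1] with z hz
          have h2 := hz.2.trans_le (min_le_left _ _)
          have h3 := hz.2.trans_le (min_le_right _ _)
          exact ⟨h2, by linarith⟩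
        refine tendsto_const_nhds.congr' ?_
        filter_upwards [hev] with z hz
        rw [indicator_of_mem (show s ∈ cut z from ⟨hs.1, hz⟩)]
      · have : G s = 0 := by rw [hGdef, if_neg hs]
        rw [this]
        refine tendsto_const_nhds.congr fun z => ?_
        by_cases h : s ∈ cut z
        · rw [indicator_of_mem h, this]
        · rw [indicator_of_notMem h]
  refine hlim.congr' ?_
  filter_upwards [self_mem_nhdsWithin] with z hz
  exact (hcutG z hz).symm

/-- The constant term of an asymptotic expansion is unique. -/
theorem HasRegularizedIntegral.unique {a : List ℂ} {c c' : ℂ} (h : HasRegularizedIntegral γ a c)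
    (h' : HasRegularizedIntegral γ a c') : c = c' := by
  obtain ⟨P, hP, rfl⟩ := h
  obtain ⟨Q, hQ, rfl⟩ := h'
  have h1 : Tendsto (fun z : ℝ => (P - Q).eval (Real.log z : ℂ)) (𝓝[>] 0) (𝓝 0) := by
    have := hQ.sub hP
    rw [sub_zero] at this
    refine this.congr fun z => ?_
    rw [Polynomial.eval_sub]
    ring
  have hlog : Tendsto (fun z : ℝ => ‖(Real.log z : ℂ)‖) (𝓝[>] 0) atTop := by
    simp only [Complex.norm_real]
    exact tendsto_abs_atBot_atTop.comp Real.tendsto_log_nhdsGT_zero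
  -- A non-constant polynomial in `log z` would be unbounded as `z → +0`.
  have hdeg : ¬ 0 < (P - Q).degree := by
    intro hd
    have h2 := (P - Q).tendsto_norm_atTop hd hlog
    exact not_tendsto_nhds_of_tendsto_atTop h2 _ h1.norm
  rw [Polynomial.eq_C_of_degree_le_zero (not_lt.1 hdeg)] at h1
  simp only [Polynomial.eval_C] at h1
  have h3 := tendsto_nhds_unique h1 tendsto_const_nhds
  rw [Polynomial.coeff_sub] at h3
  exact (sub_eq_zero.1 h3.symm)

theorem regularizedWord_eq {a : List ℂ} {c : ℂ} (h : HasRegularizedIntegral γ a c) :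
    regularizedWord γ a = c := by
  have hex : ∃ c, HasRegularizedIntegral γ a c := ⟨c, h⟩
  rw [regularizedWord, dif_pos hex]
  exact hex.choose_spec.unique h

/-- The cut-off integral has a limit, so the polynomial in `log z` is the constant limit. -/
theorem hasRegularizedIntegral_of_adm (hT : TamePath γ D S) (h0 : (0 : ℂ) ∈ D) {c : ℂ}
    {l : List ℂ} (hadm : AdmRev γ D (c :: l)) (hc : c ≠ γ 1) :
    HasRegularizedIntegral γ (c :: l).reverse (iter γ (c :: l) 1) := by
  refine ⟨Polynomial.C (iter γ (c :: l) 1), ?_, Polynomial.coeff_C_zero⟩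
  have h := tendsto_cutoffIntegral hT h0 (a := (c :: l).reverse) (by simp)
    (by rwa [List.reverse_reverse]) (by simpa using hc)
  rw [List.reverse_reverse] at h
  have := h.sub_const (iter γ (c :: l) 1)
  rw [sub_self] at this
  simpa only [Polynomial.eval_C] using this

/-- The coefficients and the regularized integral of a combination of convergent words. -/
theorem regularizedIntegral_mul_e (hT : TamePath γ D S) (h0 : (0 : ℂ) ∈ D) {x : WordAlg}
    (hx : x ∈ admWords γ D) {c : ℂ} (hcD : c ∈ D) (hc : c ≠ γ 1) :
    (∀ u ∈ (x * e c).coeff.support, ∃ r, HasRegularizedIntegral γ u.toList r) ∧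
      regularizedIntegral γ (x * e c) = iterLin γ 1 (x * e c) := by
  induction hx using Submodule.span_induction with
  | mem x h =>
    obtain ⟨l, hl, hl', rfl⟩ := h
    have hreg := hasRegularizedIntegral_of_adm hT h0 (c := c) (l := l)
      ⟨hcD, hl', fun h => absurd h hl⟩ hc
    rw [← wordRev_cons, iterLin_wordRev]
    constructor
    · intro u hu
      rw [wordRev, MonoidAlgebra.of_apply, MonoidAlgebra.coeff_single] at hu
      have := Finsupp.support_single_subset hu
      rw [Finset.mem_singleton] at this
      rw [this]
      exact ⟨_, hreg⟩
    · rw [wordRev, MonoidAlgebra.of_apply, ← MonoidAlgebra.basis_apply, regularizedIntegral,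
        Module.Basis.constr_basis]
      exact regularizedWord_eq hreg
  | zero => simp
  | add x y _ _ ihx ihy =>
    classical
    rw [add_mul]
    refine ⟨fun u hu => ?_, by rw [map_add, map_add, ihx.2, ihy.2]⟩
    rw [MonoidAlgebra.coeff_add] at hu
    rcases Finset.mem_union.1 (Finsupp.support_add hu) with h | h
    · exact ihx.1 u h
    · exact ihy.1 u h
  | smul r x _ ih =>
    rw [smul_mul_assoc]
    refine ⟨fun u hu => ?_, by rw [map_smul, map_smul, ih.2]⟩
    rw [MonoidAlgebra.coeff_smul] at hu
    exact ih.1 u (Finsupp.support_smul hu)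

end

section

variable {γ : ℝ → ℂ} {D : Finset ℂ} {S : Set ℝ}

/-- This is the last integration, with upper limit `1`; it is the only place where a density need
not suffice and the letter must differ from `γ 1`. -/
theorem TamePath.intervalIntegrable_form_mul_one (hT : TamePath γ D S) {a : ℂ} (ha : a ∈ D)
    (ha1 : a ≠ γ 1) {f : ℝ → ℂ} (hf : Amp f) :
    IntervalIntegrable (fun x => form γ a x * f x) volume 0 1 := by
  obtain ⟨K, hK0, hK⟩ := hT.bound_target a ha ha1
  obtain ⟨C, n, hC, hb⟩ := hf.bound
  rw [intervalIntegrable_iff_integrableOn_Ioc_of_le zero_le_one,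
    integrableOn_Ioc_iff_integrableOn_Ioo]
  refine Integrable.mono' ((integrableOn_rpow_mul_ell_pow n).const_mul (K * C))
    ((hT.dens_form_mul ha hf).aestronglyMeasurable hT.finite)
    ((ae_restrict_iff' measurableSet_Ioo).2 (Eventually.of_forall fun x hx => ?_))
  rw [norm_mul]
  calc ‖form γ a x‖ * ‖f x‖ ≤ (K * x⁻¹) * (C * ampBound n x) :=
        mul_le_mul (hK x hx) (hb x hx) (norm_nonneg _) (mul_nonneg hK0 (inv_nonneg.2 hx.1.le))
    _ = K * C * (x⁻¹ * ampBound n x) := by ring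
    _ = K * C * (x ^ (-(1 / 2) : ℝ) * ell x ^ n) := by rw [inv_mul_ampBound n hx.1]

/-- Appending a letter to a combination of words, which may also be the empty word. -/
theorem TamePath.append_letter (hT : TamePath γ D S) {x : WordAlg} {a : ℂ} (ha : a ∈ D)
    (hx : x ∈ admWords γ D ∨ x = 1 ∧ a ≠ γ 0) :
    x * e a ∈ admWords γ D ∧ Dens S (fun s => form γ a s * iterLin γ s x) ∧
      ∀ t ∈ Ioo (0 : ℝ) 1, iterLin γ t (x * e a) = prim (fun s => form γ a s * iterLin γ s x) t := by
  rcases hx with hx | ⟨rfl, hne⟩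
  · exact ⟨mul_e_mem hx ha, hT.dens_form_mul ha (hT.amp_iterLin hx),
      fun t ht => hT.iterLin_mul_e hx ha ht⟩
  · have hadm : AdmRev γ D [a] := ⟨ha, trivial, fun _ => hne⟩
    rw [one_mul, ← wordRev_singleton]
    refine ⟨wordRev_mem (by simp) hadm, ?_, fun t _ => ?_⟩
    · simpa only [iterLin_one, mul_one] using hT.dens_form ha hne
    · rw [iterLin_wordRev, iter]
      simp only [iterLin_one, iter]

end

/-! ### Rooted trees -/

namespace ColoredTree

variable {D : Set ℂ} {V : Type*} (X : ColoredTree D V)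

theorem parent_root : X.parent X.root = X.root := by
  rw [parent, dif_neg (by simp)]

theorem idx_root (k : X.Index) : X.idx k X.root = 1 := by
  rw [idx, dif_neg (by simp)]

/-- Geodesics from the root to `v` and to the chosen parent of `w` both extend to geodesics ending
at `w`. These are paths, hence equal in a tree, and so are their last but one vertices. -/
theorem parent_eq_of_adj {v w : V} (h : X.graph.Adj v w)
    (hd : X.graph.dist X.root w = X.graph.dist X.root v + 1) :
    w ≠ X.root ∧ X.parent w = v := by
  have hw : w ≠ X.root := by
    rintro rfl
    simp at hd
  refine ⟨hw, ?_⟩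
  have hpath : ∀ u, X.graph.dist X.root w = X.graph.dist X.root u + 1 → ∀ hu : X.graph.Adj u w,
      ∃ p : X.graph.Walk X.root w, p.IsPath ∧ p.penultimate = u := by
    intro u hu huw
    obtain ⟨p, hp⟩ := X.isTree.connected.exists_walk_length_eq_dist X.root u
    refine ⟨p.concat huw, ?_, p.penultimate_concat huw⟩
    refine SimpleGraph.Walk.isPath_of_length_eq_dist _ ?_
    rw [SimpleGraph.Walk.length_concat, hp, hu]
  obtain ⟨p, hp, hp'⟩ := hpath v hd h
  obtain ⟨q, hq, hq'⟩ := hpath (X.parent w) (X.dist_parent hw).symm (X.adj_parent hw).symm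
  have hpq : (⟨p, hp⟩ : X.graph.Path X.root w) = ⟨q, hq⟩ :=
    (X.isTree.isAcyclic.subsingleton_path X.root w).elim _ _
  have hpq' : p = q := congrArg Subtype.val hpq
  rw [← hp', ← hq', hpq']

theorem eq_parent_or_of_adj {v w : V} (h : X.graph.Adj v w) :
    (v ≠ X.root ∧ w = X.parent v) ∨ (w ≠ X.root ∧ X.parent w = v) := by
  rcases X.isTree.dist_eq_dist_add_one_of_adj X.root h with hd | hd
  · have := X.parent_eq_of_adj h.symm hd
    exact Or.inl ⟨this.1, this.2.symm⟩
  · exact Or.inr (X.parent_eq_of_adj h hd)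

section

variable [Fintype V]

theorem mem_children {u v : V} : u ∈ X.children v ↔ u ≠ X.root ∧ X.parent u = v := by
  simp [children]

theorem deg_eq_one_of_children_eq_empty {v : V} (hv : v ≠ X.root) (h : X.children v = ∅) :
    X.deg v = 1 := by
  have : X.graph.neighborSet v = {X.parent v} := by
    ext w
    rw [SimpleGraph.mem_neighborSet, mem_singleton_iff]
    constructor
    · intro hw
      rcases X.eq_parent_or_of_adj hw with h1 | h1
      · exact h1.2
      · have := X.mem_children.2 h1
        rw [h] at this
        simp at this
    · rintro rfl
      exact X.adj_parent hv
  rw [deg, this, ncard_singleton]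

theorem children_root_nonempty (h : X.deg X.root = 1) : (X.children X.root).Nonempty := by
  obtain ⟨w, hw⟩ := ncard_eq_one.1 h
  have hadj : X.graph.Adj X.root w := by
    rw [← SimpleGraph.mem_neighborSet, hw]
    exact mem_singleton w
  rcases X.eq_parent_or_of_adj hadj with h1 | h1
  · exact absurd rfl h1.1
  · exact ⟨w, X.mem_children.2 h1⟩

/-- The tree as a rooted system. -/
def toSystem : RootedSystem V where
  root := X.root
  par := X.parent
  depth := X.graph.dist X.root
  par_root := X.parent_root
  depth_par v hv := by
    have := X.dist_parent hv
    omega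

theorem toSystem_ch [DecidableEq V] (v : V) : X.toSystem.ch v = X.children v := by
  ext u
  rw [RootedSystem.mem_ch, mem_children]
  rfl

end

section

variable (k : X.Index)

theorem rep_of_pos {v : V} (h : 0 < X.idx k v) : X.rep k v = ⟨v, h⟩ := by
  rw [rep, dif_pos h]

theorem rep_of_eq_zero {v : V} (h : ¬ 0 < X.idx k v) : X.rep k v = X.rep k (X.parent v) := by
  rw [rep, dif_neg h]

theorem dist_rep_le (v : V) :
    X.graph.dist X.root (X.rep k v : V) ≤ X.graph.dist X.root v := by
  obtain ⟨n, hn⟩ : ∃ n, X.graph.dist X.root v = n := ⟨_, rfl⟩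
  induction n using Nat.strong_induction_on generalizing v with
  | _ n ih =>
    by_cases h : 0 < X.idx k v
    · rw [X.rep_of_pos k h]
    · have h1 := X.dist_parent (X.ne_root_of_idx_eq_zero h)
      rw [X.rep_of_eq_zero k h]
      have h2 := ih _ (by omega) (X.parent v) rfl
      omega

/-- The vertices that carry integration variables, as a rooted system. -/
def freeSystem : RootedSystem (X.Free k) where
  root := ⟨X.root, by rw [X.idx_root]; exact one_pos⟩
  par v := X.rep k (X.parent v)
  depth v := X.graph.dist X.root v
  par_root := by
    simp only
    rw [X.parent_root]
    exact X.rep_of_pos k _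
  depth_par v hv := by
    have h1 := X.dist_parent (v := v.1) fun h => hv (Subtype.ext h)
    have h2 := X.dist_rep_le k (X.parent v)
    omega

theorem freeSystem_ne_root {v : X.Free k} : v ≠ (X.freeSystem k).root ↔ v.1 ≠ X.root := by
  rw [ne_eq, Subtype.ext_iff]
  rfl

end

/-! ### Words and iterated integrals at the vertices of a harvestable tree -/

section Harvest

variable {γ : ℝ → ℂ} {k : X.Index}

/-- The consequences of harvestability used in the proof. -/
structure Pruned [Fintype V] (γ : ℝ → ℂ) (k : X.Index) : Prop where
  color_ne_source : ∀ v, X.children v = ∅ → X.color v ≠ γ 0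
  color_root_ne_target : X.color X.root ≠ γ 1
  deg_root : X.deg X.root = 1
  color_of_two_lt_deg : ∀ v, 2 < X.deg v → X.color v = 0
  color_of_not_free : ∀ v, ¬ 0 < X.idx k v → X.color v = 0
  deg_of_not_free : ∀ v, ¬ 0 < X.idx k v → 2 < X.deg v
  children_of_not_free : ∀ v, ¬ 0 < X.idx k v → (X.children v).Nonempty
  free_of_parent_not_free : ∀ v, v ≠ X.root → ¬ 0 < X.idx k (X.parent v) → 0 < X.idx k v

theorem Harvestable.pruned [Fintype V] {X : ColoredTree D V} {k : X.Index}
    (hX : X.Harvestable γ k) (hk : ∀ v, X.deg v = 1 → 0 < X.idx k v) : X.Pruned γ k where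
  color_ne_source v hv := by
    by_cases h : v = X.root
    · rw [h]
      exact hX.admissible.2.1
    · intro hc
      have h1 := hX.admissible.1 v hc
      rw [X.deg_eq_one_of_children_eq_empty h hv] at h1
      omega
  color_root_ne_target := hX.admissible.2.2
  deg_root := hX.deg_root
  color_of_two_lt_deg v hv := by
    by_contra h
    have := hX.deg_of_color_ne_zero v h
    omega
  color_of_not_free v hv := (hX.of_idx_eq_zero v (by omega)).1
  deg_of_not_free v hv := by
    -- Color `0` excludes degree `2`, the positivity of the index at vertices of degree `1` excludes
    -- `1`, and the edge to the parent excludes `0`.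
    have h1 := hX.deg_of_color_eq_zero v (hX.of_idx_eq_zero v (by omega)).1
    have h2 : X.deg v ≠ 1 := fun h => hv (hk v h)
    have h3 : 0 < X.deg v :=
      (ncard_pos (toFinite _)).2 ⟨_, X.adj_parent (X.ne_root_of_idx_eq_zero hv)⟩
    omega
  children_of_not_free v hv := by
    rw [Finset.nonempty_iff_ne_empty]
    intro h
    exact hv (hk v (X.deg_eq_one_of_children_eq_empty (X.ne_root_of_idx_eq_zero hv) h))
  free_of_parent_not_free v hv hp := by
    by_contra h
    -- Two consecutive vertices of index `0` would give the parent a color that is both non-zero and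
    -- `0`.
    exact (hX.of_idx_eq_zero v (by omega)).2 (hX.of_idx_eq_zero _ (by omega)).1

variable [Fintype V]

/-- This hides the enumeration of the children: only the members of the list and products over it
matter later. -/
theorem subword_eq (v : V) : ∃ l : List WordAlg,
    (∀ x, x ∈ l ↔ ∃ u ∈ X.children v, X.subword k u = x) ∧
    (∀ f : WordAlg → ℂ, (l.map f).prod = ∏ u ∈ X.children v, f (X.subword k u)) ∧
    X.subword k v = shuffleList l *
      (if 2 < X.deg v then e 0 ^ X.idx k v else e (X.color v) * e 0 ^ (X.idx k v - 1)) := by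
  refine ⟨(X.children v).attach.toList.map fun u => X.subword k u.1, fun x => ?_, fun f => ?_, ?_⟩
  · simp
  · rw [List.map_map]
    have := Finset.prod_map_toList (X.children v).attach fun u => f (X.subword k u.1)
    rw [Function.comp_def, this]
    exact Finset.prod_attach (X.children v) fun u => f (X.subword k u)
  · rw [subword]

/-- The word and the iterated integrals at a vertex, in terms of those of its children: `x` is the
shuffle product of the words of the children. -/
theorem subword_spec (hP : X.Pruned γ k) {E : Finset ℂ} {S : Set ℝ} (hT : TamePath γ E S)
    (v : V) (hch : ∀ u ∈ X.children v, X.subword k u ∈ admWords γ E) :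
    ∃ x : WordAlg, ((X.children v).Nonempty → x ∈ admWords γ E) ∧
      (X.children v = ∅ → x = 1) ∧
      (∀ t ∈ Ioo (0 : ℝ) 1, iterLin γ t x = ∏ u ∈ X.children v, iterLin γ t (X.subword k u)) ∧
      (0 < X.idx k v → X.subword k v = x * e (X.color v) * e 0 ^ (X.idx k v - 1)) ∧
      (¬ 0 < X.idx k v → X.subword k v = x) := by
  obtain ⟨l, hl, hprod, hw⟩ := X.subword_eq (k := k) v
  have hmem : ∀ x ∈ l, x ∈ admWords γ E := by
    intro x hx
    obtain ⟨u, hu, rfl⟩ := (hl x).1 hx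
    exact hch u hu
  refine ⟨shuffleList l, fun ⟨u, hu⟩ => ?_, fun hempty => ?_, fun t ht => ?_, fun hfree => ?_,
    fun hfree => ?_⟩
  · exact hT.shuffleList_mem (List.ne_nil_of_mem ((hl _).2 ⟨u, hu, rfl⟩)) hmem
  · have : l = [] := by
      rw [List.eq_nil_iff_forall_not_mem]
      intro x hx
      obtain ⟨u, hu, -⟩ := (hl x).1 hx
      rw [hempty] at hu
      simp at hu
    rw [this, shuffleList, List.foldr_nil]
  · rw [hT.iterLin_shuffleList hmem ht, hprod]
  · rw [hw, mul_assoc]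
    congr 1
    split_ifs with hd
    -- A branched vertex has color `0`, so its `e_0 ^ k_v` is `e_{C(v)} e_0 ^ (k_v - 1)`, the form
    -- for an unbranched vertex.
    · rw [hP.color_of_two_lt_deg v hd, ← pow_succ']
      congr 1
      omega
    · rfl
  · rw [hw, if_pos (hP.deg_of_not_free v hfree), show X.idx k v = 0 by omega, pow_zero, mul_one]

theorem subword_mem (hP : X.Pruned γ k) {E : Finset ℂ} {S : Set ℝ} (hT : TamePath γ E S)
    (h0 : (0 : ℂ) ∈ E) (hc : ∀ v, X.color v ∈ E) (v : V) : X.subword k v ∈ admWords γ E := by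
  classical
  induction v using X.toSystem.induction_ch with
  | h v ih =>
    rw [X.toSystem_ch] at ih
    obtain ⟨x, hx1, hx2, -, hx4, hx5⟩ := X.subword_spec hP hT v ih
    by_cases h : 0 < X.idx k v
    · rw [hx4 h]
      refine mul_pow_mem h0 (hT.append_letter (hc v) ?_).1 _
      rcases (X.children v).eq_empty_or_nonempty with he | hne
      · exact Or.inr ⟨hx2 he, hP.color_ne_source v he⟩
      · exact Or.inl (hx1 hne)
    · rw [hx5 h]
      exact hx1 (hP.children_of_not_free v h)

theorem iterLin_subword_of_not_free (hP : X.Pruned γ k) {E : Finset ℂ} {S : Set ℝ}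
    (hT : TamePath γ E S) (h0 : (0 : ℂ) ∈ E) (hc : ∀ v, X.color v ∈ E) {v : V}
    (hv : ¬ 0 < X.idx k v) {t : ℝ} (ht : t ∈ Ioo (0 : ℝ) 1) :
    iterLin γ t (X.subword k v) = ∏ u ∈ X.children v, iterLin γ t (X.subword k u) := by
  obtain ⟨x, -, -, hx3, -, hx5⟩ := X.subword_spec hP hT v fun u _ => X.subword_mem hP hT h0 hc u
  rw [hx5 hv, hx3 t ht]

/-- This is the recursion satisfied by the integral over the subtree at `v`: shuffling has become
the product over the children, and `e_0 ^ (k_v - 1)` the power of the logarithm. -/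
theorem iterLin_subword_of_free (hP : X.Pruned γ k) {E : Finset ℂ} {S : Set ℝ}
    (hT : TamePath γ E S) (h0 : (0 : ℂ) ∈ E) (hc : ∀ v, X.color v ∈ E) {v : V}
    (hv : 0 < X.idx k v) {t : ℝ} (ht : t ∈ Ioo (0 : ℝ) 1) :
    iterLin γ t (X.subword k v) =
      prim (fun x => (logAlong γ t - logAlong γ x) ^ (X.idx k v - 1) /
        ((X.idx k v - 1).factorial : ℂ) *
        (form γ (X.color v) x * ∏ u ∈ X.children v, iterLin γ x (X.subword k u))) t := by
  obtain ⟨x, hx1, hx2, hx3, hx4, -⟩ :=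
    X.subword_spec hP hT v fun u _ => X.subword_mem hP hT h0 hc u
  have hx : x ∈ admWords γ E ∨ x = 1 ∧ X.color v ≠ γ 0 := by
    rcases (X.children v).eq_empty_or_nonempty with he | hne
    · exact Or.inr ⟨hx2 he, hP.color_ne_source v he⟩
    · exact Or.inl (hx1 hne)
  obtain ⟨h1, h2, h3⟩ := hT.append_letter (hc v) hx
  rw [hx4 hv, hT.iterLin_mul_pow h0 h1 h2 h3 _ ht]
  refine prim_congr ht fun s hs => ?_
  rw [hx3 s hs]

/-- The root needs its own statement since its upper limit is `1`, outside the open interval. It has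
a child, so `x` involves no empty word, and its color differs from `γ 1`, so the integral converges.
-/
theorem word_spec (hP : X.Pruned γ k) {E : Finset ℂ} {S : Set ℝ}
    (hT : TamePath γ E S) (h0 : (0 : ℂ) ∈ E) (hc : ∀ v, X.color v ∈ E) :
    ∃ x ∈ admWords γ E, X.word k = x * e (X.color X.root) ∧
      iterLin γ 1 (X.word k) = prim (fun s => form γ (X.color X.root) s *
        ∏ u ∈ X.children X.root, iterLin γ s (X.subword k u)) 1 := by
  obtain ⟨x, hx1, -, hx3, hx4, -⟩ :=
    X.subword_spec hP hT X.root fun u _ => X.subword_mem hP hT h0 hc u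
  have hx := hx1 (X.children_root_nonempty hP.deg_root)
  have hw : X.word k = x * e (X.color X.root) := by
    rw [word, hx4 (by rw [X.idx_root]; exact one_pos), X.idx_root, Nat.sub_self, pow_zero, mul_one]
  refine ⟨x, hx, hw, ?_⟩
  rw [hw, iterLin_mul_e_of_integrable hx _ 1 fun y hy =>
    hT.intervalIntegrable_form_mul_one (hc _) hP.color_root_ne_target (hT.amp_iterLin hy)]
  rw [prim, prim, intervalIntegral.integral_of_le zero_le_one,
    intervalIntegral.integral_of_le zero_le_one, integral_Ioc_eq_integral_Ioo,
    integral_Ioc_eq_integral_Ioo]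
  refine setIntegral_congr_fun measurableSet_Ioo fun s hs => ?_
  rw [hx3 s hs]

/-- The product over the children in the free system is the product over the children in the
tree. -/
theorem prod_freeSystem_ch (hP : X.Pruned γ k) [Fintype (X.Free k)] [DecidableEq (X.Free k)]
    (g : V → ℂ) (hg : ∀ v, ¬ 0 < X.idx k v → g v = ∏ u ∈ X.children v, g u) (v : X.Free k) :
    ∏ u ∈ (X.freeSystem k).ch v, g u.1 = ∏ u ∈ X.children v.1, g u := by
  classical
  -- A child `u` of `v` contributes itself if it is free, and otherwise its own children, which are
  -- then free.
  set T : V → Finset V := fun u => if 0 < X.idx k u then {u} else X.children u with hTdef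
  have h1 : ∏ u ∈ X.children v.1, g u = ∏ u ∈ X.children v.1, ∏ w ∈ T u, g w := by
    refine Finset.prod_congr rfl fun u _ => ?_
    simp only [hTdef]
    split_ifs with h
    · rw [Finset.prod_singleton]
    · exact hg u h
  have hT : ∀ u w, w ∈ T u → (w = u ∧ 0 < X.idx k u) ∨
      (¬ 0 < X.idx k u ∧ w ≠ X.root ∧ X.parent w = u) := by
    intro u w hw
    simp only [hTdef] at hw
    split_ifs at hw with h
    · exact Or.inl ⟨Finset.mem_singleton.1 hw, h⟩
    · exact Or.inr ⟨h, X.mem_children.1 hw⟩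
  -- A vertex that stands for itself has the free parent `v`, while one that stands for a non-free
  -- `u` has parent `u`; the two kinds cannot meet.
  have hdisj : Set.PairwiseDisjoint (X.children v.1 : Set V) T := by
    intro u hu u' hu' hne
    rw [Function.onFun, Finset.disjoint_left]
    intro w hw hw'
    rw [Finset.mem_coe, mem_children] at hu hu'
    rcases hT u w hw with ⟨rfl, h2⟩ | ⟨h2, h3, h4⟩ <;>
      rcases hT u' w hw' with ⟨h5, h6⟩ | ⟨h5, h6, h7⟩
    · exact hne h5
    · have h8 := v.2
      rw [← hu.2, h7] at h8
      exact h5 h8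
    · have h8 := v.2
      rw [← hu'.2, ← h5, h4] at h8
      exact h2 h8
    · exact hne (h4.symm.trans h7)
  rw [h1, ← Finset.prod_biUnion hdisj]
  refine Finset.prod_bij (fun u _ => u.1) ?_ ?_ ?_ ?_
  · intro u hu
    rw [RootedSystem.mem_ch, freeSystem_ne_root] at hu
    obtain ⟨hur, hup⟩ := hu
    have hup' : X.rep k (X.parent u.1) = v := hup
    rw [Finset.mem_biUnion]
    by_cases hpf : 0 < X.idx k (X.parent u.1)
    · rw [X.rep_of_pos k hpf] at hup'
      refine ⟨u.1, X.mem_children.2 ⟨hur, congrArg Subtype.val hup'⟩, ?_⟩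
      simp only [hTdef]
      rw [if_pos u.2]
      exact Finset.mem_singleton_self _
    · have hpr := X.ne_root_of_idx_eq_zero hpf
      -- At most one vertex is skipped, because vertices of index `0` are never consecutive.
      have hppf : 0 < X.idx k (X.parent (X.parent u.1)) := by
        by_contra hcon
        exact hpf (hP.free_of_parent_not_free _ hpr hcon)
      rw [X.rep_of_eq_zero k hpf, X.rep_of_pos k hppf] at hup'
      refine ⟨X.parent u.1, X.mem_children.2 ⟨hpr, congrArg Subtype.val hup'⟩, ?_⟩
      simp only [hTdef]
      rw [if_neg hpf]
      exact X.mem_children.2 ⟨hur, rfl⟩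
  · intro a _ b _ h
    exact Subtype.ext h
  · intro w hw
    obtain ⟨u, hu, hwu⟩ := Finset.mem_biUnion.1 hw
    rw [mem_children] at hu
    rcases hT u w hwu with ⟨rfl, h2⟩ | ⟨h2, h3, h4⟩
    · refine ⟨⟨w, h2⟩, ?_, rfl⟩
      rw [RootedSystem.mem_ch, freeSystem_ne_root]
      refine ⟨hu.1, ?_⟩
      change X.rep k (X.parent w) = v
      rw [hu.2, X.rep_of_pos k v.2]
    · have hwf : 0 < X.idx k w := hP.free_of_parent_not_free w h3 (by rwa [h4])
      refine ⟨⟨w, hwf⟩, ?_, rfl⟩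
      rw [RootedSystem.mem_ch, freeSystem_ne_root]
      refine ⟨h3, ?_⟩
      change X.rep k (X.parent w) = v
      rw [h4, X.rep_of_eq_zero k h2, hu.2, X.rep_of_pos k v.2]
  · intro u _
    rfl

end Harvest

end ColoredTree

/-! ### The integral of a tree -/

namespace ColoredTree

variable {D : Set ℂ} {V : Type*} (X : ColoredTree D V) {γ : ℝ → ℂ} {k : X.Index}
  {E : Finset ℂ} {S : Set ℝ}

/-- The product of the kernels of the free system. -/
def freeKernel (γ : ℝ → ℂ) (k : X.Index) [Fintype (X.Free k)] (s : X.Free k → ℝ) : ℂ :=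
  ∏ v, kernel γ (X.freeSystem k) (fun v => X.idx k v.1 - 1) (fun v => X.color v.1) v (s v)
    (s ((X.freeSystem k).par v))

theorem mem_freeDomain_iff {s : X.Free k → ℝ} : s ∈ X.freeDomain k ↔
    (∀ v, s v ∈ Icc (0 : ℝ) 1) ∧ ∀ v : X.Free k, v.1 ≠ X.root → s v < s (X.rep k (X.parent v.1)) := by
  have hrep : ∀ v : X.Free k, X.rep k v.1 = v := fun v => X.rep_of_pos k v.2
  constructor
  · rintro ⟨h1, h2⟩
    refine ⟨fun v => ?_, fun v hv => ?_⟩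
    · have := h1 v.1
      rwa [extend, hrep] at this
    · have := (h2 v.1 hv).1 v.2
      rwa [extend, extend, hrep] at this
  · rintro ⟨h1, h2⟩
    refine ⟨fun v => h1 _, fun v hv => ⟨fun hpos => ?_, fun hzero => ?_⟩⟩
    · rw [extend, extend, X.rep_of_pos k hpos]
      exact h2 ⟨v, hpos⟩ hv
    · rw [extend, extend, X.rep_of_eq_zero k (by omega)]

theorem freeKernel_eq_zero [Fintype (X.Free k)] {s : X.Free k → ℝ} (hs : s ∉ X.freeDomain k) :
    X.freeKernel γ k s = 0 := by
  by_contra hne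
  have hcond : ∀ v : X.Free k, 0 < s v ∧ s v < 1 ∧ (v ≠ (X.freeSystem k).root →
      s v < s ((X.freeSystem k).par v) ∧ s ((X.freeSystem k).par v) < 1) := by
    intro v
    by_contra hcon
    refine Finset.prod_ne_zero_iff.1 hne v (Finset.mem_univ v) ?_
    rw [kernel, if_neg hcon]
  refine hs (X.mem_freeDomain_iff.2 ⟨fun v => ⟨(hcond v).1.le, (hcond v).2.1.le⟩, fun v hv => ?_⟩)
  exact ((hcond v).2.2 ((X.freeSystem_ne_root k).2 hv)).1

theorem measurableSet_freeDomain [Fintype (X.Free k)] : MeasurableSet (X.freeDomain k) := by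
  have : X.freeDomain k = (⋂ v, {s : X.Free k → ℝ | s v ∈ Icc (0 : ℝ) 1}) ∩
      ⋂ (v : X.Free k) (_ : v.1 ≠ X.root), {s | s v < s (X.rep k (X.parent v.1))} := by
    ext s
    rw [X.mem_freeDomain_iff, mem_inter_iff]
    simp only [mem_iInter]
    exact Iff.rfl
  rw [this]
  refine (MeasurableSet.iInter fun v => measurable_pi_apply v measurableSet_Icc).inter
    (MeasurableSet.iInter fun v => MeasurableSet.iInter fun _ => ?_)
  exact measurableSet_lt (measurable_pi_apply _) (measurable_pi_apply _)

variable [Fintype V]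

theorem integrand_eq_freeKernel (hP : X.Pruned γ k) (hT : TamePath γ E S) (h0 : (0 : ℂ) ∈ E)
    [Fintype (X.Free k)] {s : X.Free k → ℝ} (hs : s ∈ X.freeDomain k)
    (hs' : ∀ v, s v ∈ Ioo (0 : ℝ) 1) : X.integrand γ k s = X.freeKernel γ k s := by
  classical
  obtain ⟨-, h2⟩ := X.mem_freeDomain_iff.1 hs
  rw [integrand, freeKernel, ← Fintype.prod_subtype_mul_prod_subtype (fun v => 0 < X.idx k v)]
  -- A vertex of index `0` has color `0`, so its factor is `γ / γ`.
  have hone : ∏ v : {v // ¬ 0 < X.idx k v}, X.factor γ k (X.extend k s) v.1 = 1 := by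
    refine Finset.prod_eq_one fun v _ => ?_
    rw [factor, if_neg v.2, hP.color_of_not_free v.1 v.2, sub_zero]
    exact div_self (hT.ne 0 h0 _ (hs' _))
  rw [hone, mul_one]
  refine Finset.prod_congr (by ext; simp) fun v _ => ?_
  rw [factor, if_pos v.2, kernel, if_pos]
  · rw [extend, extend, X.rep_of_pos k v.2, form]
    change _ = (logAlong γ (s (X.rep k (X.parent v.1))) - logAlong γ (s v)) ^ (X.idx k v.1 - 1) /
      ((X.idx k v.1 - 1).factorial : ℂ) * (deriv γ (s v) / (γ (s v) - X.color v.1))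
    ring
  · exact ⟨(hs' v).1, (hs' v).2, fun hv => ⟨h2 v ((X.freeSystem_ne_root k).1 hv), (hs' _).2⟩⟩

/-- The domain lies in the closed cube and the kernels live on the open one; the faces, where `γ`
may meet a color, form a null set. -/
theorem indicator_integrand_ae_eq (hP : X.Pruned γ k) (hT : TamePath γ E S) (h0 : (0 : ℂ) ∈ E)
    [Fintype (X.Free k)] :
    (X.freeDomain k).indicator (X.integrand γ k) =ᵐ[volume] X.freeKernel γ k := by
  have hne : ∀ᵐ s : X.Free k → ℝ, ∀ v, s v ≠ 0 ∧ s v ≠ 1 := by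
    rw [ae_all_iff]
    intro v
    exact (Measure.ae_eval_ne (fun _ : X.Free k => (volume : Measure ℝ)) v 0).and
      (Measure.ae_eval_ne (fun _ : X.Free k => (volume : Measure ℝ)) v 1)
  filter_upwards [hne] with s hs
  by_cases h : s ∈ X.freeDomain k
  · rw [indicator_of_mem h]
    refine X.integrand_eq_freeKernel hP hT h0 h fun v => ?_
    have h1 := (X.mem_freeDomain_iff.1 h).1 v
    exact ⟨lt_of_le_of_ne h1.1 (hs v).1.symm, lt_of_le_of_ne h1.2 (hs v).2⟩
  · rw [indicator_of_notMem h, X.freeKernel_eq_zero h]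

/-- The point to check is that a vertex without children in the free system has none in the tree: a
free child would remain a child, and a child of index `0` would hand its own free children over. -/
theorem integrable_freeKernel (hP : X.Pruned γ k) (hT : TamePath γ E S) (h0 : (0 : ℂ) ∈ E)
    (hc : ∀ v, X.color v ∈ E) [Fintype (X.Free k)] : Integrable (X.freeKernel γ k) := by
  classical
  refine hT.integrable_prod_kernel h0 (fun v => hc v.1) ?_ (fun v hv => ?_)
    hP.color_root_ne_target
  · change X.idx k X.root - 1 = 0
    rw [X.idx_root]
  · refine hP.color_ne_source v.1 (Finset.eq_empty_of_forall_notMem fun u hu => ?_)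
    have hmem : ∀ w (hw : 0 < X.idx k w), w ≠ X.root → X.rep k (X.parent w) = v → False := by
      intro w hw hwr hrep
      have : (⟨w, hw⟩ : X.Free k) ∈ (X.freeSystem k).ch v :=
        (X.freeSystem k).mem_ch.2 ⟨(X.freeSystem_ne_root k).2 hwr, hrep⟩
      rw [hv] at this
      simp at this
    rw [mem_children] at hu
    by_cases huf : 0 < X.idx k u
    · exact hmem u huf hu.1 (by rw [hu.2, X.rep_of_pos k v.2])
    · obtain ⟨w, hw⟩ := hP.children_of_not_free u huf
      rw [mem_children] at hw
      refine hmem w (hP.free_of_parent_not_free w hw.1 (by rwa [hw.2])) hw.1 ?_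
      rw [hw.2, X.rep_of_eq_zero k huf, hu.2, X.rep_of_pos k v.2]

/-- The iterated integrals of the words `s_v` satisfy the recursion that Fubini produces for the
free system, so the value at the root is that of the whole word. -/
theorem integral_freeKernel (hP : X.Pruned γ k) (hT : TamePath γ E S) (h0 : (0 : ℂ) ∈ E)
    (hc : ∀ v, X.color v ∈ E) [Fintype (X.Free k)] :
    ∫ s, X.freeKernel γ k s = iterLin γ 1 (X.word k) := by
  classical
  set R := X.freeSystem k with hR
  have hκ : (fun v : X.Free k => X.idx k v.1 - 1) R.root = 0 := by
    change X.idx k X.root - 1 = 0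
    rw [X.idx_root]
  have hker := kernel_root (γ := γ) (R := R) (κ := fun v => X.idx k v.1 - 1)
    (c := fun v => X.color v.1) hκ
  set F : X.Free k → ℝ → ℂ := fun v t =>
    if v = R.root then iterLin γ 1 (X.word k)
    else (Ioo (0 : ℝ) 1).indicator (fun t => iterLin γ t (X.subword k v.1)) t with hF
  have hprod : ∀ v : X.Free k, ∀ x ∈ Ioo (0 : ℝ) 1,
      ∏ u ∈ R.ch v, F u x = ∏ u ∈ X.children v.1, iterLin γ x (X.subword k u) := by
    intro v x hx
    rw [← X.prod_freeSystem_ch hP (fun u => iterLin γ x (X.subword k u))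
      (fun u hu => X.iterLin_subword_of_not_free hP hT h0 hc hu hx) v]
    refine Finset.prod_congr rfl fun u hu => ?_
    simp only [hF]
    rw [if_neg (R.mem_ch.1 hu).1, indicator_of_mem hx]
  have := R.integral_prod_eq
    (kernel γ R (fun v => X.idx k v.1 - 1) (fun v => X.color v.1)) F
    (X.integrable_freeKernel hP hT h0 hc) (fun x t t' => by rw [hker, hker]) ?_ 0
  · refine Eq.trans this ?_
    simp only [hF, if_true]
  · intro v t
    by_cases hv : v = R.root
    · obtain ⟨-, -, -, hw⟩ := X.word_spec hP hT h0 hc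
      rw [show F v t = iterLin γ 1 (X.word k) by simp only [hF]; rw [if_pos hv], hv, hw, prim,
        intervalIntegral.integral_of_le zero_le_one, integral_Ioc_eq_integral_Ioo,
        ← integral_indicator measurableSet_Ioo]
      refine integral_congr_ae (Eventually.of_forall fun x => ?_)
      simp only
      rw [hker]
      by_cases hx : x ∈ Ioo (0 : ℝ) 1
      · rw [indicator_of_mem hx, indicator_of_mem hx, hprod R.root x hx]
        rfl
      · rw [indicator_of_notMem hx, indicator_of_notMem hx, zero_mul]
    · by_cases ht : t ∈ Ioo (0 : ℝ) 1
      · rw [show F v t = iterLin γ t (X.subword k v.1) by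
          simp only [hF]; rw [if_neg hv, indicator_of_mem ht],
          X.iterLin_subword_of_free hP hT h0 hc v.2 ht, prim,
          intervalIntegral.integral_of_le ht.1.le, integral_Ioc_eq_integral_Ioo,
          ← integral_indicator measurableSet_Ioo]
        refine integral_congr_ae (Eventually.of_forall fun x => ?_)
        simp only
        rw [kernel_of_ne hv ht]
        by_cases hx : x ∈ Ioo 0 t
        · rw [indicator_of_mem hx, indicator_of_mem hx, hprod v x ⟨hx.1, hx.2.trans ht.2⟩,
            mul_assoc]
        · rw [indicator_of_notMem hx, indicator_of_notMem hx, zero_mul]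
      · simp only [kernel_of_notMem hv ht, zero_mul, integral_zero]
        simp only [hF]
        rw [if_neg hv, indicator_of_notMem ht]

end ColoredTree

end TreeIntegral

end

/-! ### The theorem on harvestable trees -/

theorem mainTheorem3 {V : Type*} [Fintype V] (D : Finset ℂ) (h0 : (0 : ℂ) ∈ D)
    (p q : TreeIntegral.TangentialBasePoint) (γ : ℝ → ℂ)
    (hγ : TreeIntegral.IsPathOn γ p q ((D : Set ℂ)ᶜ))
    (X : TreeIntegral.ColoredTree (D : Set ℂ) V) (k : X.Index)
    (hX : X.Harvestable γ k) (hk : ∀ v, X.deg v = 1 → 0 < X.idx k v) :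
    X.TreeIntegrable γ k ∧
      (∀ u ∈ (X.word k).coeff.support,
        ∃ c, TreeIntegral.HasRegularizedIntegral γ u.toList c) ∧
      X.treeIntegral γ k = TreeIntegral.regularizedIntegral γ (X.word k) := by
  obtain ⟨S, hT⟩ := hγ.exists_tamePath
  have hP := hX.pruned hk
  have hc : ∀ v, X.color v ∈ D := fun v => X.color_mem v
  obtain ⟨x, hx, hw, -⟩ := X.word_spec hP hT h0 hc
  obtain ⟨hreg, hval⟩ :=
    TreeIntegral.regularizedIntegral_mul_e hT h0 hx (hc X.root) hP.color_root_ne_target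
  rw [← hw] at hreg hval
  -- This is the instance used in the definitions of `treeIntegral` and `TreeIntegrable`, so that
  -- the volume measures agree.
  let _ : Fintype (X.Free k) := Fintype.ofFinite _
  have hae := X.indicator_integrand_ae_eq hP hT h0
  have hmeas := X.measurableSet_freeDomain (k := k)
  refine ⟨?_, hreg, ?_⟩
  · exact (integrable_indicator_iff hmeas).1
      ((X.integrable_freeKernel hP hT h0 hc).congr hae.symm)
  · rw [hval, ← X.integral_freeKernel hP hT h0 hc, ← integral_congr_ae hae,
      integral_indicator hmeas]
    rfl
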